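/- **Theorem (uniform consistency of local indirect inference).** All random variables live on one probability space; $\|\cdot\|$ is the Euclidean norm; $\mathcal U=\mathcal U_T=[\delta_T,1-\delta_T]$ with $\delta_T>0$, $\delta_T\to0$, and "for all $u\in\mathcal U$" in a condition without $T$ means for all $u\in\bigcup_T\mathcal U_T$. $\Theta\subset\mathbb R^{d_\theta}$ and $\Gamma\subset\mathbb R^{d_\rho}$ are compact, $d_\rho\ge d_\theta$, and $\theta_0(u)\in\Theta$ for all $u\in\mathcal U$. *Structural model.* $(\nu_t)_{t\in\mathbb Z}$ is $\mathbb R^{d_\nu}$-valued i.i.d. white noise (centred, square integrable), with history $\nu_{\le t}=(\nu_t,\nu_{t-1},\dots)$. Put $y_t(\theta)=r(\varphi(\nu_{\le t};\theta);\theta)$, $z_t(\theta)=\zeta(\nu_{\le t};\theta)\in\mathbb R^{d_z}$, $y_{u,t}=y_t(\theta_0(u))$, $z_{u,t}=z_t(\theta_0(u))$. The observed array $(Y_{t,T},Z_{t,T})_{1\le t\le T}$ satisfies $Y_{t,T}=r(\varphi(\nu_{\le t};\theta_0(t/T));\theta_0(t/T))$. The simulated series $\tilde y_t(\theta),\tilde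 z_t(\theta)$, $\theta\in\Theta$, are obtained by the same formulas from errors $(\tilde\nu_t)$ that are white noise with the law of $(\nu_t)$; these errors need not be independent of the data. *Assumption 1.* $\theta_0$ is twice differentiable on $\mathcal U$ with uniformly bounded second derivative. $\varphi$ and $r$ are real-valued and twice continuously differentiable in $\theta\in\Theta$ with uniformly bounded second derivatives; $r$ is jointly continuous in its two arguments; $\zeta$ is continuous in $\theta\in\Theta$; $\varphi,\zeta$ are measurable in the errors. *Assumption 2.* (i) $(Y_{t,T},Z_{t,T})$ is locally stationary with strictly stationary approximants $(y_{u,t},z_{u,t})$: almost surely $\max_{t\le T}\|(Y_{t,T},Z_{t,T})-(y_{t/T,t},z_{t/T,t})\|\le C_T/T$ for every $T$, where $\sup_TE|C_T|^\eta<\infty$ for some $\eta>0$. Its $\phi$-mixing coefficients $\phi(k)=\sup_{T,t}\sup\{|P(B\mid A)-P(B)|\}$ (over events $A$ of row $T$ up to time $t$ with $P(A)>0$ and events $B$ of row $T$ from time $t+k$ on) tend to $0$, and $T\phi(m_T)/m_T\le C<\infty$ for integers $1\le m_T\le T$. (ii) For every $\theta\in\Theta$, $y_t(\theta)$ has finite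 second moment, constant mean and shift-invariant covariances. *Criteria, limits and estimators.* With $g:\mathbb R^2\to\mathbb R$, $f:\mathbb R^{d_z}\times\mathbb R^{d_\rho}\to\mathbb R$, kernel $K$ and bandwidth $h=h_T$, $$M_T[\rho;u]=\frac1{Th}\sum_{t=1}^Tg[Y_{t,T};f(Z_{t,T},\rho)]\,K\Big(\frac{u-t/T}h\Big),\qquad \tilde M_T[\rho;\theta]=\frac1T\sum_{t=1}^Tg[\tilde y_t(\theta);f(\tilde z_t(\theta),\rho)].$$ For $\rho\in\Gamma$, $u\in\mathcal U$, $\theta\in\Theta$ the variables $g[\tilde y_t(\theta);f(\tilde z_t(\theta),\rho)]$ are integrable and the limits $\mathbb M_0[\rho;u]=\lim_TE M_T[\rho;u]$ and $\tilde{\mathbb M}_0[\rho;u,\theta]=\lim_TE\tilde M_T[\rho;\theta]$ exist; $\rho_0(u)=\rho_0(u;\theta_0(u))$ is the unique minimizer of $\mathbb M_0[\cdot;u]$ over $\Gamma$, and $\rho_0(u;\theta)$ the unique minimizer of $\tilde{\mathbb M}_0[\cdot;u,\theta]$ over $\Gamma$. Almost surely for each $T$ and all $u\in\mathcal U_T$,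 $\theta\in\Theta$: $\hat\rho(u)$ minimizes $M_T[\cdot;u]$ over $\Gamma$, $\hat\rho(u;\theta)$ minimizes $\tilde M_T[\cdot;\theta]$ over $\Gamma$, and $\hat\theta(u)\in\arg\max_{\theta\in\Theta}-\|\hat\rho(u)-\hat\rho(u;\theta)\|_\Omega^2$, where $\|x\|_\Omega^2=x'\Omega x$ with $\Omega$ symmetric positive definite (any choice of optimizers is allowed). *Assumption 3.* Let $\mathcal E(u)=\{\rho\in\Gamma:\|\rho-\rho_0(u)\|\le\varepsilon_0\}$ for some $\varepsilon_0>0$, and $q=(\partial/\partial\rho)\,g[y;f(z,\rho)]$. (i) $|f(z,\rho_1)-f(z,\rho_2)|\le b(z)\|\rho_1-\rho_2\|$ on $\Gamma$ for some function $b$; $(y,z,\rho)\mapsto g[y;f(z,\rho)]$ is twice continuously differentiable with bounded first and second derivatives for $y\in\mathbb R$, $z\in\mathbb R^{d_z}$, $\rho$ in the convex hull of $\Gamma$; $\sup_{\rho\in\mathcal E(u)}E|g[Y_{t,T};f(Z_{t,T},\rho)]|<\infty$ for all $u\in\mathcal U$ and $t\le T$. (ii) For all $u\in\mathcal U$ and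 $t\le T$: for $\rho\in\mathcal E(u)$, $f(\cdot,\rho)$ is measurable and $f(z,\cdot)$ is twice differentiable at $\rho$; $\sup_{\rho\in\mathcal E(u)}E|f(Z_{t,T},\rho)|<\infty$; and $\sup_{\rho\in\mathcal E(u)}f(z,\rho)\le\bar f(z)$ with $E|\bar f(Z_{t,T})|<\infty$. (iii) $q$ is differentiable in $\rho$ on $\mathcal E(u)$; for each $u\in\mathcal U$ there is a neighbourhood of $\rho_0(u)$ in $\Gamma$ on which, almost surely for all $t\le T$, each component of $q[Y_{t,T};f(Z_{t,T},\rho)]$ is strictly monotone in its own coordinate of $\rho$; and $\sup_{u\in\mathcal U_T}\sup_{\rho\in\mathcal E(u)}\|q[Y_{t,T};f(Z_{t,T},\rho)]\|\le c_q+O_p(T^{-1})$ for $t\le T$. (iv) For each $u\in\mathcal U$ the gradient in $\rho$ of $\mathbb M_0[\rho;u]$ exists on $\Gamma$ and has $\rho_0(u)$ as its only zero in $\Gamma$, and for every $\varepsilon>0$ there is $\eta>0$ with $\mathbb M_0[\rho;u]-\mathbb M_0[\rho_0(u);u]\ge\eta$ for all $\rho\in\Gamma$ with $\|\rho-\rho_0(u)\|>\varepsilon$.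 (v) For every $\varepsilon>0$ there are $a_1,a_2>0$ such that $|E g(y_{u_1,t};f(z_{u_1,t},\rho_1))-E g(y_{u_2,t};f(z_{u_2,t},\rho_2))|\le\varepsilon$ for all $t$, all $u_1,u_2\in\mathcal U$ with $|u_1-u_2|\le a_1$ and all $\rho_1\in\mathcal E(u_1)$, $\rho_2\in\Gamma$ with $\|\rho_1-\rho_2\|\le a_2$. (vi) For each $u\in\mathcal U$, $\theta\mapsto\rho_0(u;\theta)$ is continuous and injective on $\Theta$. *Assumption 4.* For some integer $\kappa\ge2$, $K\ge0$ is bounded, symmetric, Lipschitz, $\kappa$ times continuously differentiable, with $\int K=1$, $\int K^2<\infty$, $\int x^iK(x)\,dx=0$ for $1\le i<\kappa$, $\int x^\kappa K(x)\,dx\ne0$, $\int|x|^\kappa|K(x)|\,dx<\infty$, $|x|K(x)\to0$ as $|x|\to\infty$, and either $K$ has compact support or, for some constants $C,L<\infty$ and $v>1$, $|K'|\le C$ everywhere and $|K'(x)|\le C|x|^{-v}$ for $|x|>L$. The bandwidths $h_T>0$ satisfy $h\to0$, $Th\to\infty$ and $Th/(m_T\log T)\to\infty$. Then $$\sup_{u\in\mathcal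 U_T}\|\hat\theta(u)-\theta_0(u)\|=o_p(1)\qquad(T\to\infty)$$ (in outer probability where the supremum is not measurable). -/

import Mathlib

open MeasureTheory ProbabilityTheory Filter Topology Set
open scoped ENNReal NNReal

namespace LocalII

noncomputable section

/-- `ℝⁿ` with the Euclidean norm. -/
abbrev Vec (n : ℕ) : Type := EuclideanSpace ℝ (Fin n)

/-- The squared weighted norm `x ↦ xᵀ W x`. -/
def weightedSq {n : ℕ} (W : Matrix (Fin n) (Fin n) ℝ) (x : Vec n) : ℝ :=
  ∑ i, ∑ j, x i * W i j * x j

/-- The present and past `(ν_t, ν_{t-1}, ν_{t-2}, …)` of a process. -/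
def past {S V : Type*} (ν : ℤ → S → V) (t : ℤ) (ω : S) : ℕ → V := fun k => ν (t - k) ω

/-- `X_T = o_p(1)` for nonnegative `X_T` (in outer probability when `X_T` is not measurable). -/
def IsLittleOp {S : Type*} [MeasurableSpace S] (P : Measure S) (X : ℕ → S → ℝ≥0∞) : Prop :=
  ∀ κ : ℝ≥0∞, 0 < κ → Tendsto (fun T => P {ω | κ ≤ X T ω}) atTop (𝓝 0)

/-- `R_T = O_p(T⁻¹)`. -/
def IsBigOpInv {S : Type*} [MeasurableSpace S] (P : Measure S) (R : ℕ → S → ℝ) : Prop :=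
  ∀ κ : ℝ, 0 < κ → ∃ B : ℝ, ∀ T : ℕ, 1 ≤ T → P {ω | B / T < |R T ω|} ≤ ENNReal.ofReal κ

/-- Strict stationarity of a process indexed by the integers. -/
def IsStationary {S V : Type*} [MeasurableSpace S] [MeasurableSpace V] (P : Measure S)
    (x : ℤ → S → V) : Prop :=
  (∀ t, Measurable (x t)) ∧
    ∀ m : ℤ, P.map (fun ω t => x (t + m) ω) = P.map (fun ω t => x t ω)

/-- The triangular array `X T t`, `1 ≤ t ≤ T`, is locally stationary with stationary approximants
`x u`, that is `max_{t ≤ T} ‖X T t - x (t/T) t‖ ≤ C_T / T` almost surely, where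
`sup_T E |C_T|^η < ∞` for some `η > 0`. -/
def IsLocallyStationary {S V : Type*} [MeasurableSpace S] [NormedAddCommGroup V]
    [MeasurableSpace V] (P : Measure S) (X : ℕ → ℕ → S → V) (x : ℝ → ℤ → S → V) : Prop :=
  (∀ T t : ℕ, 1 ≤ t → t ≤ T → IsStationary P (x (t / T))) ∧
  ∃ (C : ℕ → S → ℝ) (η : ℝ) (B : ℝ≥0), 0 < η ∧ (∀ T, Measurable (C T)) ∧
    (∀ T, ∫⁻ ω, ‖C T ω‖ₑ ^ η ∂P ≤ B) ∧
    ∀ T : ℕ, ∀ᵐ ω ∂P, ∀ t : ℕ, 1 ≤ t → t ≤ T → ‖X T t ω - x (t / T) t ω‖ ≤ C T ω / T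

/-- The σ-field generated by the entries `X T i`, `1 ≤ i ≤ T`, with `i` in `I`. -/
abbrev rowSigma {S V : Type*} [MeasurableSpace V] (X : ℕ → ℕ → S → V) (T : ℕ) (I : Set ℕ) :
    MeasurableSpace S :=
  ⨆ i ∈ I ∩ Icc 1 T, MeasurableSpace.comap (X T i) inferInstance

/-- The `φ`-mixing coefficient of a triangular array: the supremum of `|P(B | A) - P(B)|` over all
rows `T`, all times `t`, all events `A` of the row up to time `t` with `P(A) > 0`, and all events
`B` of the row from time `t + k` on. -/
def phiMixing {S V : Type*} [MeasurableSpace S] [MeasurableSpace V] (P : Measure S)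
    (X : ℕ → ℕ → S → V) (k : ℕ) : ℝ≥0∞ :=
  ⨆ (T : ℕ) (t : ℕ) (A : Set S) (B : Set S)
    (_ : MeasurableSet[rowSigma X T (Iic t)] A) (_ : MeasurableSet[rowSigma X T (Ici (t + k))] B)
    (_ : 0 < P A), ENNReal.ofReal |(P[|A]).real B - P.real B|

/-- Independent white noise: i.i.d., centred, with finite second moments. -/
def IsWhiteNoise {S : Type*} [MeasurableSpace S] {n : ℕ} (P : Measure S) (ν : ℤ → S → Vec n) :
    Prop :=
  (∀ t, Measurable (ν t)) ∧ iIndepFun ν P ∧ (∀ t, IdentDistrib (ν t) (ν 0) P P) ∧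
    (∀ t, MemLp (ν t) 2 P) ∧ ∀ t, ∫ ω, ν t ω ∂P = 0

/-- The data of the problem, without any condition. -/
structure Setup (S : Type*) (dν dz dθ dρ : ℕ) where
  /-- errors of the observed process -/
  ν : ℤ → S → Vec dν
  /-- simulated errors -/
  νsim : ℤ → S → Vec dν
  /-- `ε_t(θ) = φ (ν_t, ν_{t-1}, …; θ)`; the errors enter through their present and past, so that
  moving averages and latent recursions are covered -/
  φ : (ℕ → Vec dν) → Vec dθ → ℝ
  /-- `y_t(θ) = r (ε_t(θ); θ)` -/
  r : ℝ → Vec dθ → ℝ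
  /-- the rule `z_t(θ) = ζ (ν_t, ν_{t-1}, …; θ)` by which the model generates the auxiliary
  regressors (lags of `y`, or exogenous variables with errors of their own) -/
  ζ : (ℕ → Vec dν) → Vec dθ → Vec dz
  /-- the true parameter function -/
  θ₀ : ℝ → Vec dθ
  /-- the structural parameter space -/
  Θ : Set (Vec dθ)
  /-- the auxiliary parameter space -/
  Γ : Set (Vec dρ)
  /-- the observed array; `Y T t` is used for `1 ≤ t ≤ T` -/
  Y : ℕ → ℕ → S → ℝ
  /-- the observed regressors -/
  Z : ℕ → ℕ → S → Vec dz
  /-- auxiliary regression function -/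
  f : Vec dz → Vec dρ → ℝ
  /-- auxiliary criterion -/
  g : ℝ → ℝ → ℝ
  /-- kernel -/
  K : ℝ → ℝ
  /-- bandwidth -/
  h : ℕ → ℝ
  /-- trimming -/
  δ : ℕ → ℝ
  /-- block lengths in the mixing and bandwidth conditions -/
  m : ℕ → ℕ

namespace Setup

variable {S : Type*} {dν dz dθ dρ : ℕ} (M : Setup S dν dz dθ dρ)

/-- The set `𝒰 = [δ_T, 1 - δ_T]` of rescaled time points. -/
def U (T : ℕ) : Set ℝ := Icc (M.δ T) (1 - M.δ T)

/-- All rescaled time points that occur in some `𝒰`. -/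
def UAll : Set ℝ := ⋃ T, M.U T

/-- `r (φ (e; θ); θ)` for an error history `e`. -/
def out (e : ℕ → Vec dν) (θ : Vec dθ) : ℝ := M.r (M.φ e θ) θ

/-- The stationary process `y_t(θ)` driven by the errors of the data. -/
def y (θ : Vec dθ) (t : ℤ) (ω : S) : ℝ := M.out (past M.ν t ω) θ

/-- The stationary regressors `z_t(θ)` driven by the errors of the data. -/
def z (θ : Vec dθ) (t : ℤ) (ω : S) : Vec dz := M.ζ (past M.ν t ω) θ

/-- The simulated process at parameter `θ`. -/
def ysim (θ : Vec dθ) (t : ℤ) (ω : S) : ℝ := M.out (past M.νsim t ω) θ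

/-- The simulated regressors at parameter `θ`. -/
def zsim (θ : Vec dθ) (t : ℤ) (ω : S) : Vec dz := M.ζ (past M.νsim t ω) θ

/-- `g[y; f(z, ρ)]`. -/
def G (y : ℝ) (z : Vec dz) (ρ : Vec dρ) : ℝ := M.g y (M.f z ρ)

/-- `q = (∂/∂ρ) g[y; f(z, ρ)]`. -/
def q (y : ℝ) (z : Vec dz) (ρ : Vec dρ) : Vec dρ := gradient (fun ρ' => M.G y z ρ') ρ

/-- The local criterion `M_T[ρ; u]` computed from the observed data. -/
def crit (T : ℕ) (u : ℝ) (ρ : Vec dρ) (ω : S) : ℝ :=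
  1 / (T * M.h T) * ∑ t ∈ Finset.Icc 1 T,
    M.G (M.Y T t ω) (M.Z T t ω) ρ * M.K ((u - t / T) / M.h T)

/-- The criterion computed from the data simulated at `θ`. -/
def critSim (T : ℕ) (θ : Vec dθ) (ρ : Vec dρ) (ω : S) : ℝ :=
  1 / (T : ℝ) * ∑ t ∈ Finset.Icc 1 T, M.G (M.ysim θ t ω) (M.zsim θ t ω) ρ

/-- The neighbourhood `{ρ ∈ Γ : ‖ρ - ρ*‖ ≤ ε}`. -/
def nbhd (ε : ℝ) (ρstar : Vec dρ) : Set (Vec dρ) := {ρ ∈ M.Γ | ‖ρ - ρstar‖ ≤ ε}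

end Setup

/-- `a` is the unique minimizer of `F` over `A`. -/
def IsUniqueArgmin {α : Type*} (F : α → ℝ) (A : Set α) (a : α) : Prop :=
  a ∈ A ∧ ∀ b ∈ A, b ≠ a → F a < F b

section

variable {S : Type*} [MeasurableSpace S] {dν dz dθ dρ : ℕ}

/-- The structural model and its regularity. -/
structure StructuralModel (P : Measure S) (M : Setup S dν dz dθ dρ) : Prop where
  δ_pos : ∀ T, 0 < M.δ T
  δ_lim : Tendsto M.δ atTop (𝓝 0)
  θ₀_mem : ∀ u ∈ M.UAll, M.θ₀ u ∈ M.Θ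
  /-- `θ₀` has uniformly bounded second derivatives -/
  θ₀_smooth : ∃ B : ℝ, ∀ u ∈ M.UAll, DifferentiableAt ℝ M.θ₀ u ∧
    DifferentiableAt ℝ (deriv M.θ₀) u ∧ ‖deriv (deriv M.θ₀) u‖ ≤ B
  φ_meas : ∀ θ ∈ M.Θ, Measurable (fun e => M.φ e θ)
  ζ_meas : ∀ θ ∈ M.Θ, Measurable (fun e => M.ζ e θ)
  /-- `φ` and `r` are twice continuously differentiable in `θ`, with uniformly bounded second
  derivatives -/
  φ_smooth : (∀ e, ∀ θ ∈ M.Θ, ContDiffAt ℝ 2 (M.φ e) θ) ∧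
    ∃ B : ℝ, ∀ e, ∀ θ ∈ M.Θ, ‖iteratedFDeriv ℝ 2 (M.φ e) θ‖ ≤ B
  r_smooth : (∀ ε, ∀ θ ∈ M.Θ, ContDiffAt ℝ 2 (M.r ε) θ) ∧
    ∃ B : ℝ, ∀ ε, ∀ θ ∈ M.Θ, ‖iteratedFDeriv ℝ 2 (M.r ε) θ‖ ≤ B
  /-- `θ` also enters `r` through its first argument, in which `r` is continuous -/
  r_cont : ContinuousOn (fun p : ℝ × Vec dθ => M.r p.1 p.2) (univ ×ˢ M.Θ)
  /-- the generated regressors depend continuously on `θ` -/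
  ζ_cont : ∀ e, ContinuousOn (M.ζ e) M.Θ
  noise : IsWhiteNoise P M.ν
  /-- the simulated errors are white noise with the same, known, distribution; no independence of
  the observed data is needed -/
  noise_sim : IsWhiteNoise P M.νsim
  same_law : IdentDistrib (M.νsim 0) (M.ν 0) P P
  Y_meas : ∀ T t, Measurable (M.Y T t)
  Z_meas : ∀ T t, Measurable (M.Z T t)
  /-- the observed process is `Y_{t,T} = r (ε_{t,T}; θ₀(t/T))`,
  `ε_{t,T} = φ (ν_t, ν_{t-1}, …; θ₀(t/T))` -/
  model : ∀ T t : ℕ, 1 ≤ t → t ≤ T →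
    ∀ᵐ ω ∂P, M.Y T t ω = M.r (M.φ (past M.ν t ω) (M.θ₀ (t / T))) (M.θ₀ (t / T))

/-- Local stationarity, mixing, and stationarity of the model over the parameter space. -/
structure DependenceConditions (P : Measure S) (M : Setup S dν dz dθ dρ) : Prop where
  loc_stat : IsLocallyStationary P (fun T t ω => (M.Y T t ω, M.Z T t ω))
    (fun u t ω => (M.y (M.θ₀ u) t ω, M.z (M.θ₀ u) t ω))
  mixing : Tendsto (phiMixing P (fun T t ω => (M.Y T t ω, M.Z T t ω))) atTop (𝓝 0)
  block : ∀ T, 1 ≤ T → 1 ≤ M.m T ∧ M.m T ≤ T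
  mixing_rate : ∃ C : ℝ≥0, ∀ T : ℕ, 1 ≤ T →
    (T : ℝ≥0∞) * phiMixing P (fun T t ω => (M.Y T t ω, M.Z T t ω)) (M.m T) / (M.m T : ℝ≥0∞) ≤ C
  second_moment : ∀ θ ∈ M.Θ, ∀ t, MemLp (M.y θ t) 2 P
  const_mean : ∀ θ ∈ M.Θ, ∃ c : ℝ, ∀ t, ∫ ω, M.y θ t ω ∂P = c
  const_cov : ∀ θ ∈ M.Θ, ∀ t s k : ℤ,
    covariance (M.y θ t) (M.y θ s) P = covariance (M.y θ (t + k)) (M.y θ (s + k)) P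

/-- The limit criteria and their minimizers: `M₀ ρ u = lim E M_T[ρ; u]` with minimizer
`ρ₀(u) = ρ₀(u; θ₀(u))`, and `Msim₀ ρ u θ`, the limit of the mean of the simulated criterion at `θ`,
with minimizer `ρ₀(u; θ)`. -/
structure LimitQuantities (P : Measure S) (M : Setup S dν dz dθ dρ) (M₀ : Vec dρ → ℝ → ℝ)
    (Msim₀ : Vec dρ → ℝ → Vec dθ → ℝ) (ρ₀ : ℝ → Vec dθ → Vec dρ) : Prop where
  lim : ∀ u ∈ M.UAll, ∀ ρ ∈ M.Γ,
    Tendsto (fun T => ∫ ω, M.crit T u ρ ω ∂P) atTop (𝓝 (M₀ ρ u))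
  argmin : ∀ u ∈ M.UAll, IsUniqueArgmin (fun ρ => M₀ ρ u) M.Γ (ρ₀ u (M.θ₀ u))
  sim_integrable : ∀ θ ∈ M.Θ, ∀ ρ ∈ M.Γ, ∀ t : ℤ,
    Integrable (fun ω => M.G (M.ysim θ t ω) (M.zsim θ t ω) ρ) P
  lim_sim : ∀ u ∈ M.UAll, ∀ θ ∈ M.Θ, ∀ ρ ∈ M.Γ,
    Tendsto (fun T : ℕ => 1 / (T : ℝ) * ∑ t ∈ Finset.Icc 1 T,
      ∫ ω, M.G (M.ysim θ t ω) (M.zsim θ t ω) ρ ∂P) atTop (𝓝 (Msim₀ ρ u θ))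
  argmin_sim : ∀ u ∈ M.UAll, ∀ θ ∈ M.Θ, IsUniqueArgmin (fun ρ => Msim₀ ρ u θ) M.Γ (ρ₀ u θ)

/-- Conditions on the auxiliary model; `ε₀` is the radius of the neighbourhoods of `ρ₀(u)`. -/
structure AuxiliaryConditions (P : Measure S) (M : Setup S dν dz dθ dρ) (M₀ : Vec dρ → ℝ → ℝ)
    (ρ₀ : ℝ → Vec dθ → Vec dρ) (ε₀ : ℝ) : Prop where
  /-- `f` is Lipschitz in `ρ`, with a constant that depends on `z` -/
  f_lip : ∃ b : Vec dz → ℝ, ∀ z, ∀ ρ₁ ∈ M.Γ, ∀ ρ₂ ∈ M.Γ,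
    |M.f z ρ₁ - M.f z ρ₂| ≤ b z * ‖ρ₁ - ρ₂‖
  /-- `g[y; f(z, ρ)]` is twice continuously differentiable in all of its arguments `y`, `z`, `ρ`,
  with bounded derivatives (over the convex hull of `Γ`, that is over `Γ` if `Γ` is convex) -/
  G_smooth : ∀ y z, ∀ ρ ∈ convexHull ℝ M.Γ,
    ContDiffAt ℝ 2 (fun p : ℝ × Vec dz × Vec dρ => M.G p.1 p.2.1 p.2.2) (y, z, ρ)
  G_bdd : ∃ B : ℝ, ∀ y z, ∀ ρ ∈ convexHull ℝ M.Γ,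
    ‖fderiv ℝ (fun p : ℝ × Vec dz × Vec dρ => M.G p.1 p.2.1 p.2.2) (y, z, ρ)‖ ≤ B ∧
    ‖iteratedFDeriv ℝ 2 (fun p : ℝ × Vec dz × Vec dρ => M.G p.1 p.2.1 p.2.2) (y, z, ρ)‖ ≤ B
  G_moment : ∀ u ∈ M.UAll, ∀ T t : ℕ, 1 ≤ t → t ≤ T →
    (⨆ ρ ∈ M.nbhd ε₀ (ρ₀ u (M.θ₀ u)), ∫⁻ ω, ‖M.G (M.Y T t ω) (M.Z T t ω) ρ‖ₑ ∂P) < ⊤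
  f_regular : ∀ u ∈ M.UAll, ∀ ρ ∈ M.nbhd ε₀ (ρ₀ u (M.θ₀ u)), Measurable (fun z => M.f z ρ) ∧
    ∀ z, DifferentiableAt ℝ (M.f z) ρ ∧ DifferentiableAt ℝ (fderiv ℝ (M.f z)) ρ
  f_moment : ∀ u ∈ M.UAll, ∀ T t : ℕ, 1 ≤ t → t ≤ T →
    (⨆ ρ ∈ M.nbhd ε₀ (ρ₀ u (M.θ₀ u)), ∫⁻ ω, ‖M.f (M.Z T t ω) ρ‖ₑ ∂P) < ⊤
  f_envelope : ∀ u ∈ M.UAll, ∃ fbar : Vec dz → ℝ,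
    (∀ z, ∀ ρ ∈ M.nbhd ε₀ (ρ₀ u (M.θ₀ u)), M.f z ρ ≤ fbar z) ∧
    ∀ T t : ℕ, 1 ≤ t → t ≤ T → Integrable (fun ω => fbar (M.Z T t ω)) P
  q_diff : ∀ u ∈ M.UAll, ∀ ρ ∈ M.nbhd ε₀ (ρ₀ u (M.θ₀ u)), ∀ y z,
    DifferentiableAt ℝ (M.q y z) ρ
  /-- near `ρ₀(u)` each component of `q` is strictly monotone in its own coordinate of `ρ` -/
  q_mono : ∀ u ∈ M.UAll, ∃ κ : ℝ, 0 < κ ∧ ∀ T t : ℕ, 1 ≤ t → t ≤ T → ∀ᵐ ω ∂P, ∀ j : Fin dρ,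
    ∀ ρ ∈ M.nbhd κ (ρ₀ u (M.θ₀ u)),
      StrictMonoOn (fun s : ℝ => M.q (M.Y T t ω) (M.Z T t ω) (ρ + s • EuclideanSpace.single j 1) j)
        {s | ρ + s • EuclideanSpace.single j 1 ∈ M.nbhd κ (ρ₀ u (M.θ₀ u))} ∨
      StrictAntiOn (fun s : ℝ => M.q (M.Y T t ω) (M.Z T t ω) (ρ + s • EuclideanSpace.single j 1) j)
        {s | ρ + s • EuclideanSpace.single j 1 ∈ M.nbhd κ (ρ₀ u (M.θ₀ u))}
  /-- `q` is bounded near `ρ₀(u)`, uniformly in `u`, up to a term of order `O_p(T⁻¹)` -/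
  q_bdd : ∃ (c : ℝ) (R : ℕ → S → ℝ), IsBigOpInv P R ∧ ∀ T : ℕ, ∀ᵐ ω ∂P,
    ∀ t : ℕ, 1 ≤ t → t ≤ T → ∀ u ∈ M.U T, ∀ ρ ∈ M.nbhd ε₀ (ρ₀ u (M.θ₀ u)),
      ‖M.q (M.Y T t ω) (M.Z T t ω) ρ‖ ≤ c + R T ω
  /-- the gradient of the limit criterion exists, and `ρ₀(u)` is its unique zero -/
  foc : ∀ u ∈ M.UAll, ∃ Ψ₀ : Vec dρ → Vec dρ,
    (∀ ρ ∈ M.Γ, HasGradientWithinAt (fun ρ' => M₀ ρ' u) (Ψ₀ ρ) M.Γ ρ) ∧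
    ∀ ρ ∈ M.Γ, Ψ₀ ρ = 0 ↔ ρ = ρ₀ u (M.θ₀ u)
  /-- `ρ₀(u)` is a well separated minimizer -/
  separated : ∀ u ∈ M.UAll, ∀ ε : ℝ, 0 < ε → ∃ η : ℝ, 0 < η ∧
    ∀ ρ ∈ M.Γ, ε < ‖ρ - ρ₀ u (M.θ₀ u)‖ → η ≤ M₀ ρ u - M₀ (ρ₀ u (M.θ₀ u)) u
  equicont : ∀ ε : ℝ, 0 < ε → ∃ a₁ a₂ : ℝ, 0 < a₁ ∧ 0 < a₂ ∧
    ∀ u₁ ∈ M.UAll, ∀ ρ₁ ∈ M.nbhd ε₀ (ρ₀ u₁ (M.θ₀ u₁)), ∀ u₂ ∈ M.UAll, ∀ ρ₂ ∈ M.Γ,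
      |u₂ - u₁| ≤ a₁ → ‖ρ₂ - ρ₁‖ ≤ a₂ → ∀ t : ℤ,
      |∫ ω, M.G (M.y (M.θ₀ u₁) t ω) (M.z (M.θ₀ u₁) t ω) ρ₁ ∂P -
        ∫ ω, M.G (M.y (M.θ₀ u₂) t ω) (M.z (M.θ₀ u₂) t ω) ρ₂ ∂P| ≤ ε
  /-- identification: the binding function is continuous and injective -/
  binding : ∀ u ∈ M.UAll, ContinuousOn (ρ₀ u) M.Θ ∧ InjOn (ρ₀ u) M.Θ
  compact_Γ : IsCompact M.Γ
  compact_Θ : IsCompact M.Θ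
  dim_le : dθ ≤ dρ

/-- Conditions on the kernel, of order `k`, and on the bandwidth. -/
structure KernelConditions (M : Setup S dν dz dθ dρ) (k : ℕ) : Prop where
  nonneg : ∀ x, 0 ≤ M.K x
  symm : ∀ x, M.K (-x) = M.K x
  bdd : ∃ C : ℝ, ∀ x, M.K x ≤ C
  order : 2 ≤ k
  smooth : ContDiff ℝ k M.K
  integrable : Integrable M.K
  integral_one : ∫ x, M.K x = 1
  sq_integrable : Integrable (fun x => M.K x ^ 2)
  tails : (∃ L : ℝ, ∀ x, L < |x| → M.K x = 0) ∨
    ∃ C L v : ℝ, 1 < v ∧ (∀ x, |deriv M.K x| ≤ C) ∧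
      ∀ x, L < |x| → |deriv M.K x| ≤ C * |x| ^ (-v)
  moments : ∀ i : ℕ, 1 ≤ i → i < k → ∫ x, x ^ i * M.K x = 0
  moment_ne : ∫ x, x ^ k * M.K x ≠ 0
  moment_integrable : Integrable (fun x => |x| ^ k * |M.K x|)
  decay : Tendsto (fun x => |x| * M.K x) (cocompact ℝ) (𝓝 0)
  lipschitz : ∃ C : ℝ, ∀ x x', |M.K x - M.K x'| ≤ C * |x - x'|
  h_pos : ∀ T, 0 < M.h T
  h_lim : Tendsto M.h atTop (𝓝 0)
  Th_lim : Tendsto (fun T : ℕ => T * M.h T) atTop atTop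
  Th_rate : Tendsto (fun T : ℕ => T * M.h T / (M.m T * Real.log T)) atTop atTop

/-- `ρhat` and `ρsim` are auxiliary estimators, from the observed and from the simulated data, and
`θhat` is a local indirect inference estimator with weighting matrix `W`; where an optimizer is not
unique, any choice is allowed. -/
structure IsIndirectEstimator (P : Measure S) (M : Setup S dν dz dθ dρ)
    (W : Matrix (Fin dρ) (Fin dρ) ℝ) (ρhat : ℕ → ℝ → S → Vec dρ)
    (ρsim : ℕ → ℝ → Vec dθ → S → Vec dρ) (θhat : ℕ → ℝ → S → Vec dθ) : Prop where
  aux : ∀ T, ∀ᵐ ω ∂P, ∀ u ∈ M.U T, ρhat T u ω ∈ M.Γ ∧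
    IsMinOn (fun ρ => M.crit T u ρ ω) M.Γ (ρhat T u ω)
  aux_sim : ∀ T, ∀ᵐ ω ∂P, ∀ u ∈ M.U T, ∀ θ ∈ M.Θ, ρsim T u θ ω ∈ M.Γ ∧
    IsMinOn (fun ρ => M.critSim T θ ρ ω) M.Γ (ρsim T u θ ω)
  est : ∀ T, ∀ᵐ ω ∂P, ∀ u ∈ M.U T, θhat T u ω ∈ M.Θ ∧
    IsMaxOn (fun θ => -weightedSq W (ρhat T u ω - ρsim T u θ ω)) M.Θ (θhat T u ω)

end

end

end LocalII

/-! A minimizer only sees differences of its criterion. `G` is Lipschitz in all arguments and Γ is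
bounded, so G(·, ρ) - G(·, ρref) is a bounded function even when `G` is not. Let D(θ, ρ) (`meanOut`)
be its mean under the stationary model at θ. The simulated criterion does not involve u, so for
every u the point ρ₀(u; θ) is the unique minimizer of D(θ, ·), and one binding function β = ρ₀(1/2;
·) serves all u.

Two uniform laws carry the proof. The simulated relative criterion tends to D(θ, ρ) in probability,
uniformly in (θ, ρ): this is a weak law for bounded functions of an i.i.d. history
(`tendsto_measure_average_past`), made uniform by compactness (`tendsto_measure_exists_average`).
The local relative criterion is uniformly close to s_T(u) D(θ₀(u), ρ), where s_T(u) is the total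
kernel weight. Its fluctuation is controlled by an exponential inequality for blocks of a φ-mixing
row (`measure_le_abs_sum_Icc_le`) and a union bound over a grid in u
(`tendsto_measure_exists_kernel_average`); its bias by local stationarity and the continuity of θ₀
and D (`eventually_abs_bias_le`). Near the boundary s_T(u) need not be close to 1, but a positive
factor does not move a minimizer, so a positive lower bound is enough
(`exists_le_sum_kernelWeight`).

The rest is deterministic. By compactness the minimizers of D(θ, ·) are well separated uniformly in
θ, so off a bad event of small probability ρ̂(u) is close to β(θ₀(u)) and ρ̂(u; θ) to β(θ),
uniformly. Optimality of θ̂(u), compared with the candidate θ₀(u), makes β(θ̂(u)) close to β(θ₀(u));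
and β⁻¹ is uniformly continuous because β is continuous and injective on a compact set. The bad
events are combined by a union bound, so dependence between data and simulation is harmless. -/

namespace LocalII

/-! ### Exponential moments of sums over separated mixing blocks. -/

section Mixing

/-- A mixing bound for events extends to expectations of products. -/
theorem lintegral_mul_le_of_mixing {S : Type*} {𝓐 𝓑 : MeasurableSpace S}
    [m0 : MeasurableSpace S] {P : Measure S} [IsProbabilityMeasure P] (h𝓐 : 𝓐 ≤ m0) (h𝓑 : 𝓑 ≤ m0)
    {φ : ℝ≥0∞}
    (hφ : ∀ A B, MeasurableSet[𝓐] A → MeasurableSet[𝓑] B → P (A ∩ B) ≤ P A * (P B + φ))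
    {f : S → ℝ≥0∞} (hf : Measurable[𝓐] f) {g : S → ℝ} (hg : Measurable[𝓑] g)
    (hg0 : ∀ x, 0 ≤ g x) {c : ℝ} (hgc : ∀ x, g x ≤ c) :
    ∫⁻ x, f x * ENNReal.ofReal (g x) ∂P ≤
      (∫⁻ x, ENNReal.ofReal (g x) ∂P + φ * ENNReal.ofReal c) * ∫⁻ x, f x ∂P := by
  have hgm : Measurable[m0] g := hg.mono h𝓑 le_rfl
  have hfm : Measurable[m0] f := hf.mono h𝓐 le_rfl
  have hset : ∀ A, MeasurableSet[𝓐] A → ∫⁻ x in A, ENNReal.ofReal (g x) ∂P ≤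
      (∫⁻ x, ENNReal.ofReal (g x) ∂P + φ * ENNReal.ofReal c) * P A := by
    intro A hA
    -- Layer cake: the mixing bound is applied to every superlevel set {g > s}. These are empty for
    -- s ≥ c, so the error φ is integrated over (0, c) only and adds up to φ · c.
    rw [lintegral_eq_lintegral_meas_lt _ (Eventually.of_forall hg0) hgm.aemeasurable,
      lintegral_eq_lintegral_meas_lt _ (Eventually.of_forall hg0) hgm.aemeasurable]
    have hB : ∀ s : ℝ, MeasurableSet[𝓑] {a | s < g a} := fun s => hg measurableSet_Ioi
    have key : ∀ s ∈ Ioi (0 : ℝ), (P.restrict A) {a | s < g a} ≤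
        P A * (P {a | s < g a} + (Iio c).indicator (fun _ => φ) s) := by
      intro s _
      rw [Measure.restrict_apply (h𝓑 _ (hB s)), inter_comm]
      by_cases hs : s < c
      · simpa [hs] using hφ A _ hA (hB s)
      · have : {a | s < g a} = ∅ := by
          ext x; simp only [mem_ofPred_eq, mem_empty_iff_false, iff_false, not_lt]
          exact (hgc x).trans (not_lt.1 hs)
        simp [this]
    refine (setLIntegral_mono' measurableSet_Ioi key).trans ?_
    have hanti : Measurable fun s : ℝ => P {a | s < g a} :=
      Antitone.measurable fun s t hst => measure_mono fun a (ha : t < g a) => hst.trans_lt ha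
    rw [lintegral_const_mul' _ _ (measure_ne_top _ _), lintegral_add_left hanti, mul_comm]
    gcongr
    rw [lintegral_indicator measurableSet_Iio, setLIntegral_const,
      Measure.restrict_apply measurableSet_Iio, inter_comm, Ioi_inter_Iio, Real.volume_Ioo,
      sub_zero]
  -- On 𝓐 the bound just proved compares two measures, the one with density `g` and a multiple of
  -- `P`. Integrating `f` against both gives the claim.
  have hle : ((P.withDensity fun x => ENNReal.ofReal (g x)).trim h𝓐) ≤
      (∫⁻ x, ENNReal.ofReal (g x) ∂P + φ * ENNReal.ofReal c) • (P.trim h𝓐) := by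
    refine Measure.le_iff.2 fun A hA => ?_
    rw [trim_measurableSet_eq h𝓐 hA, withDensity_apply _ (h𝓐 _ hA), Measure.smul_apply,
      trim_measurableSet_eq h𝓐 hA, smul_eq_mul]
    exact hset A hA
  have hmono := lintegral_mono' hle (le_refl f)
  rw [lintegral_trim h𝓐 hf, lintegral_smul_measure, lintegral_trim h𝓐 hf, smul_eq_mul,
    lintegral_withDensity_eq_lintegral_mul _ hgm.ennreal_ofReal hfm] at hmono
  refine le_trans (le_of_eq ?_) hmono
  exact lintegral_congr fun x => mul_comm _ _

variable {S : Type*} [m0 : MeasurableSpace S] {P : Measure S} [IsProbabilityMeasure P]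

/-- Expectations of products over successive mixing blocks. -/
theorem lintegral_prod_le_of_mixing {past fut : ℕ → MeasurableSpace S} (hpast : ∀ i, past i ≤ m0)
    (hfut : ∀ i, fut i ≤ m0) {φ : ℝ≥0∞}
    (hφ : ∀ i A B, MeasurableSet[past i] A → MeasurableSet[fut (i + 1)] B →
      P (A ∩ B) ≤ P A * (P B + φ))
    {ψ : ℕ → S → ℝ} (hψp : ∀ i j, i ≤ j → Measurable[past j] (ψ i))
    (hψf : ∀ i, Measurable[fut i] (ψ i)) (hψ0 : ∀ i x, 0 ≤ ψ i x) {c : ℝ}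
    (hψc : ∀ i x, ψ i x ≤ c) (n : ℕ) :
    ∫⁻ x, ∏ i ∈ Finset.range n, ENNReal.ofReal (ψ i x) ∂P ≤
      ∏ i ∈ Finset.range n, (∫⁻ x, ENNReal.ofReal (ψ i x) ∂P + φ * ENNReal.ofReal c) := by
  induction n with
  | zero => simp
  | succ n ih =>
    simp_rw [Finset.prod_range_succ]
    -- The mixing bound pairs the past of a block with the future of the next one, so it can be used
    -- from the second factor on; the first factor is bounded by itself.
    rcases n with _ | n
    · simp
    · have hm : Measurable[past n]
          fun x => ∏ i ∈ Finset.range (n + 1), ENNReal.ofReal (ψ i x) := by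
        refine Finset.measurable_fun_prod _ fun i hi => ?_
        exact (hψp i n (Nat.lt_succ_iff.1 (Finset.mem_range.1 hi))).ennreal_ofReal
      refine (lintegral_mul_le_of_mixing (hpast n) (hfut (n + 1)) (hφ n) hm (hψf _) (hψ0 _)
        (hψc _)).trans ?_
      rw [mul_comm]
      gcongr

theorem exp_le_one_add_sq {x : ℝ} (hx : |x| ≤ 1) : Real.exp x ≤ 1 + x + x ^ 2 := by
  have := (abs_le.1 (Real.abs_exp_sub_one_sub_id_le hx)).2
  linarith

/-- The moment generating function of a centred bounded variable. -/
theorem lintegral_exp_le_of_abs_le {ξ : S → ℝ} (hξ : Measurable ξ) {a l : ℝ} (hl : 0 ≤ l)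
    (ha : ∀ x, |ξ x| ≤ a) (hla : l * a ≤ 1) (h0 : ∫ x, ξ x ∂P = 0) :
    ∫⁻ x, ENNReal.ofReal (Real.exp (l * ξ x)) ∂P ≤ ENNReal.ofReal (1 + l ^ 2 * a ^ 2) := by
  have hint : Integrable ξ P :=
    Integrable.of_bound hξ.aestronglyMeasurable a (Eventually.of_forall ha)
  have hpt : ∀ x, Real.exp (l * ξ x) ≤ (1 + l ^ 2 * a ^ 2) + l * ξ x := by
    intro x
    have h1 : |l * ξ x| ≤ l * a := by
      rw [abs_mul, abs_of_nonneg hl]; exact mul_le_mul_of_nonneg_left (ha x) hl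
    have h2 := exp_le_one_add_sq (h1.trans hla)
    have h3 : (l * ξ x) ^ 2 ≤ (l * a) ^ 2 := by
      rw [← sq_abs]; exact pow_le_pow_left₀ (abs_nonneg _) h1 2
    nlinarith
  have hint2 : Integrable (fun x => (1 + l ^ 2 * a ^ 2) + l * ξ x) P :=
    (integrable_const _).add (hint.const_mul l)
  calc ∫⁻ x, ENNReal.ofReal (Real.exp (l * ξ x)) ∂P
      ≤ ∫⁻ x, ENNReal.ofReal ((1 + l ^ 2 * a ^ 2) + l * ξ x) ∂P :=
        lintegral_mono fun x => ENNReal.ofReal_le_ofReal (hpt x)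
    _ = ENNReal.ofReal (∫ x, (1 + l ^ 2 * a ^ 2) + l * ξ x ∂P) :=
        (ofReal_integral_eq_lintegral_ofReal hint2
          (Eventually.of_forall fun x => (Real.exp_pos _).le.trans (hpt x))).symm
    _ = ENNReal.ofReal (1 + l ^ 2 * a ^ 2) := by
        rw [integral_add (integrable_const _) (hint.const_mul l), integral_const_mul, h0]
        simp

/-- An exponential inequality for sums of centred bounded variables that are separated by mixing
gaps. -/
theorem measure_le_sum_le_of_mixing {past fut : ℕ → MeasurableSpace S} (hpast : ∀ i, past i ≤ m0)
    (hfut : ∀ i, fut i ≤ m0) {φ : ℝ≥0}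
    (hφ : ∀ i A B, MeasurableSet[past i] A → MeasurableSet[fut (i + 1)] B →
      P (A ∩ B) ≤ P A * (P B + φ))
    {ξ : ℕ → S → ℝ} (hξp : ∀ i j, i ≤ j → Measurable[past j] (ξ i))
    (hξf : ∀ i, Measurable[fut i] (ξ i)) {a : ℕ → ℝ} (ha : ∀ i x, |ξ i x| ≤ a i)
    (h0 : ∀ i, ∫ x, ξ i x ∂P = 0) {l : ℝ} (hl : 0 ≤ l) (hla : ∀ i, l * a i ≤ 1) (n : ℕ) (ε : ℝ) :
    P {x | ε ≤ ∑ i ∈ Finset.range n, ξ i x} ≤ ENNReal.ofReal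
      (Real.exp (-(l * ε) + l ^ 2 * ∑ i ∈ Finset.range n, a i ^ 2 + 3 * n * φ)) := by
  have hξm : ∀ i, Measurable (ξ i) := fun i => (hξf i).mono (hfut i) le_rfl
  -- Each factor is at most e ≤ 3. This is the 3 in the mixing error 3nφ.
  have hc : ∀ i x, Real.exp (l * ξ i x) ≤ 3 := fun i x => by
    have h1 : l * ξ i x ≤ 1 :=
      (mul_le_mul_of_nonneg_left ((le_abs_self _).trans (ha i x)) hl).trans (hla i)
    calc Real.exp (l * ξ i x) ≤ Real.exp 1 := Real.exp_le_exp.2 h1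
      _ ≤ 3 := by linarith [Real.exp_one_lt_d9]
  have hprod := lintegral_prod_le_of_mixing hpast hfut hφ (ψ := fun i x => Real.exp (l * ξ i x))
    (fun i j hij => Real.measurable_exp.comp ((hξp i j hij).const_mul l))
    (fun i => Real.measurable_exp.comp ((hξf i).const_mul l)) (fun i x => (Real.exp_pos _).le) hc n
  have hfac : ∀ i, ∫⁻ x, ENNReal.ofReal (Real.exp (l * ξ i x)) ∂P + φ * ENNReal.ofReal 3 ≤
      ENNReal.ofReal (Real.exp (l ^ 2 * a i ^ 2 + 3 * φ)) := by
    intro i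
    calc ∫⁻ x, ENNReal.ofReal (Real.exp (l * ξ i x)) ∂P + φ * ENNReal.ofReal 3
        ≤ ENNReal.ofReal (1 + l ^ 2 * a i ^ 2) + ENNReal.ofReal (φ * 3) := by
          gcongr
          · exact lintegral_exp_le_of_abs_le (hξm i) hl (ha i) (hla i) (h0 i)
          · rw [ENNReal.ofReal_mul (NNReal.coe_nonneg φ), ENNReal.ofReal_coe_nnreal]
      _ = ENNReal.ofReal (1 + l ^ 2 * a i ^ 2 + φ * 3) :=
          (ENNReal.ofReal_add (by positivity) (by positivity)).symm
      _ ≤ _ := ENNReal.ofReal_le_ofReal (by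
          have := Real.add_one_le_exp (l ^ 2 * a i ^ 2 + 3 * φ)
          linarith)
  have hmgf : ∫⁻ x, ENNReal.ofReal (Real.exp (l * ∑ i ∈ Finset.range n, ξ i x)) ∂P ≤
      ENNReal.ofReal (Real.exp (l ^ 2 * ∑ i ∈ Finset.range n, a i ^ 2 + 3 * n * φ)) := by
    have e1 : ∀ x, ENNReal.ofReal (Real.exp (l * ∑ i ∈ Finset.range n, ξ i x)) =
        ∏ i ∈ Finset.range n, ENNReal.ofReal (Real.exp (l * ξ i x)) := by
      intro x
      rw [Finset.mul_sum, Real.exp_sum,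
        ENNReal.ofReal_prod_of_nonneg fun i _ => (Real.exp_pos _).le]
    simp_rw [e1]
    refine hprod.trans ((Finset.prod_le_prod' fun i _ => hfac i).trans (le_of_eq ?_))
    rw [← ENNReal.ofReal_prod_of_nonneg fun i _ => (Real.exp_pos _).le, ← Real.exp_sum,
      Finset.sum_add_distrib, ← Finset.mul_sum]
    simp only [Finset.sum_const, Finset.card_range, nsmul_eq_mul]
    congr 3
    ring
  have hsub : {x | ε ≤ ∑ i ∈ Finset.range n, ξ i x} ⊆
      {x | ENNReal.ofReal (Real.exp (l * ε)) ≤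
        ENNReal.ofReal (Real.exp (l * ∑ i ∈ Finset.range n, ξ i x))} := fun x hx =>
    ENNReal.ofReal_le_ofReal (Real.exp_le_exp.2 (mul_le_mul_of_nonneg_left hx hl))
  have hpos : ENNReal.ofReal (Real.exp (l * ε)) ≠ 0 := by
    simpa using Real.exp_pos (l * ε)
  calc P {x | ε ≤ ∑ i ∈ Finset.range n, ξ i x}
      ≤ _ := measure_mono hsub
    _ ≤ (∫⁻ x, ENNReal.ofReal (Real.exp (l * ∑ i ∈ Finset.range n, ξ i x)) ∂P) /
          ENNReal.ofReal (Real.exp (l * ε)) :=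
        meas_ge_le_lintegral_div (by fun_prop) hpos ENNReal.ofReal_ne_top
    _ ≤ ENNReal.ofReal (Real.exp (l ^ 2 * ∑ i ∈ Finset.range n, a i ^ 2 + 3 * n * φ)) /
          ENNReal.ofReal (Real.exp (l * ε)) := by gcongr
    _ = _ := by
        rw [← ENNReal.ofReal_div_of_pos (Real.exp_pos _), ← Real.exp_sub]
        congr 2
        ring

end Mixing

/-! ### An exponential inequality for a row, by splitting it into even and odd blocks. -/

section RowMixing

theorem rowSigma_mono {S V : Type*} [MeasurableSpace V] {X : ℕ → ℕ → S → V} (T : ℕ) {I J : Set ℕ} (h : I ⊆ J) : rowSigma X T I ≤ rowSigma X T J :=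
  biSup_mono fun _ hi => ⟨h hi.1, hi.2⟩

theorem comap_le_rowSigma {S V : Type*} [MeasurableSpace V] {X : ℕ → ℕ → S → V} {T t : ℕ} {I : Set ℕ} (ht : t ∈ Finset.Icc 1 T) (hI : t ∈ I) :
    MeasurableSpace.comap (X T t) inferInstance ≤ rowSigma X T I :=
  le_iSup₂_of_le t ⟨hI, by simpa using ht⟩ le_rfl

variable {S V : Type*} [m0 : MeasurableSpace S] [MeasurableSpace V] {P : Measure S}
  [IsProbabilityMeasure P] {X : ℕ → ℕ → S → V}

theorem rowSigma_le {T : ℕ} (hX : ∀ t, Measurable (X T t)) (I : Set ℕ) : rowSigma X T I ≤ m0 :=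
  iSup₂_le fun i _ => (hX i).comap_le

/-- The product form makes sense for null events as well, where the conditional probability in the
mixing coefficient is not available. -/
theorem measure_inter_le_of_phiMixing {T k : ℕ} (hX : ∀ t, Measurable (X T t)) {φ : ℝ≥0}
    (hφ : phiMixing P X k ≤ φ) {t : ℕ} {A B : Set S} (hA : MeasurableSet[rowSigma X T (Iic t)] A)
    (hB : MeasurableSet[rowSigma X T (Ici (t + k))] B) : P (A ∩ B) ≤ P A * (P B + φ) := by
  rcases eq_or_ne (P A) 0 with h0 | h0
  · rw [h0, zero_mul, nonpos_iff_eq_zero]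
    exact measure_mono_null inter_subset_left h0
  have hA' : MeasurableSet A := rowSigma_le hX _ _ hA
  have h1 : ENNReal.ofReal |(P[|A]).real B - P.real B| ≤ φ := by
    refine le_trans ?_ hφ
    unfold phiMixing
    exact le_iSup_of_le T <| le_iSup_of_le t <| le_iSup_of_le A <| le_iSup_of_le B <|
      le_iSup_of_le hA <| le_iSup_of_le hB <| le_iSup_of_le (pos_iff_ne_zero.2 h0) le_rfl
  have h2 : |(P[|A]).real B - P.real B| ≤ φ := by
    rw [← ENNReal.ofReal_coe_nnreal] at h1
    exact (ENNReal.ofReal_le_ofReal_iff φ.2).1 h1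
  have : IsProbabilityMeasure (P[|A]) := cond_isProbabilityMeasure h0
  have h3 : (P[|A]) B ≤ P B + φ := by
    have h4 : (P[|A]).real B ≤ P.real B + φ := by linarith [(abs_le.1 h2).2]
    have h5 := ENNReal.ofReal_le_ofReal h4
    rwa [ENNReal.ofReal_add measureReal_nonneg (NNReal.coe_nonneg φ), ofReal_measureReal, ofReal_measureReal,
      ENNReal.ofReal_coe_nnreal] at h5
  rw [← cond_mul_eq_inter hA' B, mul_comm]
  gcongr

theorem sum_range_two_mul {β : Type*} [AddCommMonoid β] (f : ℕ → β) (n : ℕ) :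
    ∑ j ∈ Finset.range (2 * n), f j =
      ∑ i ∈ Finset.range n, f (2 * i) + ∑ i ∈ Finset.range n, f (2 * i + 1) := by
  induction n with
  | zero => simp
  | succ n ih =>
    rw [Nat.mul_succ, Finset.sum_range_succ, Finset.sum_range_succ, ih, Finset.sum_range_succ,
      Finset.sum_range_succ]
    abel

/-- The times of the `j`-th block of length `m`. -/
def timeBlock (T m j : ℕ) : Finset ℕ := (Finset.Icc 1 T).filter fun t => (t - 1) / m = j


theorem mem_timeBlock {T m j t : ℕ} (hm : 1 ≤ m) :
    t ∈ timeBlock T m j ↔ t ∈ Finset.Icc 1 T ∧ j * m + 1 ≤ t ∧ t ≤ (j + 1) * m := by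
  rw [timeBlock, Finset.mem_filter, Finset.mem_Icc]
  refine and_congr_right fun h => ?_
  rw [Nat.div_eq_iff hm, Nat.add_mul]
  omega

theorem card_timeBlock_le {T m j : ℕ} (hm : 1 ≤ m) : (timeBlock T m j).card ≤ m := by
  have h : timeBlock T m j ⊆ Finset.Icc (j * m + 1) ((j + 1) * m) := fun t ht =>
    Finset.mem_Icc.2 ((mem_timeBlock hm).1 ht).2
  refine (Finset.card_le_card h).trans ?_
  rw [Nat.card_Icc, Nat.add_mul]
  omega

/-- Two consecutive blocks of the same parity are separated by a full block, which is the gap that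
mixing needs. Block indices are at most T / m; the surplus blocks in the two sums are empty. -/
theorem sum_Icc_eq_sum_timeBlock {β : Type*} [AddCommMonoid β] (f : ℕ → β) (T m : ℕ) :
    ∑ t ∈ Finset.Icc 1 T, f t =
      ∑ i ∈ Finset.range (T / m + 1), ∑ t ∈ timeBlock T m (2 * i), f t +
        ∑ i ∈ Finset.range (T / m + 1), ∑ t ∈ timeBlock T m (2 * i + 1), f t := by
  rw [← sum_range_two_mul (fun j => ∑ t ∈ timeBlock T m j, f t)]
  refine (Finset.sum_fiberwise_of_maps_to (fun t ht => ?_) f).symm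
  have h1 : (t - 1) / m ≤ T / m :=
    Nat.div_le_div_right ((Nat.sub_le t 1).trans (Finset.mem_Icc.1 ht).2)
  rw [Finset.mem_range]
  omega

/-- The exponential inequality for the blocks of one parity. -/
theorem measure_le_sum_timeBlock_le {T m : ℕ} (hm : 1 ≤ m) (hX : ∀ t, Measurable (X T t))
    {φ : ℝ≥0} (hφ : phiMixing P X m ≤ φ) {ξ : ℕ → S → ℝ}
    (hξ : ∀ t ∈ Finset.Icc 1 T, Measurable[MeasurableSpace.comap (X T t) inferInstance] (ξ t))
    (h0 : ∀ t ∈ Finset.Icc 1 T, ∫ x, ξ t x ∂P = 0) {c : ℕ → ℝ}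
    (hc : ∀ t ∈ Finset.Icc 1 T, ∀ x, |ξ t x| ≤ c t) {κ A : ℝ}
    (hcκ : ∀ t ∈ Finset.Icc 1 T, c t ≤ κ) (hκ : 0 ≤ κ)
    {p n : ℕ} (hA : ∑ i ∈ Finset.range n, ∑ t ∈ timeBlock T m (2 * i + p), c t ≤ A)
    {l : ℝ} (hl : 0 ≤ l) (hlκ : l * (m * κ) ≤ 1) (ε : ℝ) :
    P {x | ε ≤ ∑ i ∈ Finset.range n, ∑ t ∈ timeBlock T m (2 * i + p), ξ t x} ≤
      ENNReal.ofReal (Real.exp (-(l * ε) + l ^ 2 * (m * κ * A) + 3 * n * φ)) := by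
  have hsub : ∀ {j t}, t ∈ timeBlock T m j → t ∈ Finset.Icc 1 T := fun ht =>
    ((mem_timeBlock hm).1 ht).1
  have hc0 : ∀ t ∈ Finset.Icc 1 T, 0 ≤ c t := fun t ht => by
    have : Nonempty S := nonempty_of_isProbabilityMeasure P
    exact (abs_nonneg _).trans (hc t ht (Classical.arbitrary S))
  set a : ℕ → ℝ := fun i => ∑ t ∈ timeBlock T m (2 * i + p), c t
  have haκ : ∀ i, a i ≤ m * κ := fun i => by
    calc a i ≤ ∑ t ∈ timeBlock T m (2 * i + p), κ := Finset.sum_le_sum fun t ht => hcκ t (hsub ht)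
      _ = (timeBlock T m (2 * i + p)).card * κ := by rw [Finset.sum_const, nsmul_eq_mul]
      _ ≤ m * κ := by
        gcongr
        exact card_timeBlock_le hm
  have ha0 : ∀ i, 0 ≤ a i := fun i => Finset.sum_nonneg fun t ht => hc0 t (hsub ht)
  -- The past of block 2i + p ends at (2i + p + 1)m, and the next block of that parity starts at (2i
  -- + p + 2)m + 1. The distance is m + 1, so the coefficient at lag m applies.
  have hmain := measure_le_sum_le_of_mixing (P := P)
    (past := fun i => rowSigma X T (Iic ((2 * i + p + 1) * m)))
    (fut := fun i => rowSigma X T (Ici ((2 * i + p) * m + 1)))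
    (fun i => rowSigma_le hX _) (fun i => rowSigma_le hX _) (φ := φ)
    (fun i A B hA hB => measure_inter_le_of_phiMixing hX hφ hA
      (rowSigma_mono T (Ici_subset_Ici.2 (by ring_nf; omega)) _ hB))
    (ξ := fun i x => ∑ t ∈ timeBlock T m (2 * i + p), ξ t x)
    (fun i j hij => by
      refine Finset.measurable_fun_sum _ fun t ht => (hξ t (hsub ht)).mono
        (comap_le_rowSigma (hsub ht) ?_) le_rfl
      refine ((mem_timeBlock hm).1 ht).2.2.trans ?_
      gcongr)
    (fun i => Finset.measurable_fun_sum _ fun t ht => (hξ t (hsub ht)).mono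
        (comap_le_rowSigma (hsub ht) ((mem_timeBlock hm).1 ht).2.1) le_rfl)
    (a := a)
    (fun i x => (Finset.abs_sum_le_sum_abs _ _).trans
      (Finset.sum_le_sum fun t ht => hc t (hsub ht) x))
    (fun i => by
      rw [integral_finsetSum _ fun t ht => ?_]
      · exact Finset.sum_eq_zero fun t ht => h0 t (hsub ht)
      · exact Integrable.of_bound (((hξ t (hsub ht)).mono (hX t).comap_le
          le_rfl).aestronglyMeasurable) (c t) (Eventually.of_forall (hc t (hsub ht))))
    hl (fun i => (mul_le_mul_of_nonneg_left (haκ i) hl).trans hlκ) n ε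
  refine hmain.trans (ENNReal.ofReal_le_ofReal (Real.exp_le_exp.2 ?_))
  -- Bounding the squares by maximum times sum, rather than by n times the squared maximum, keeps
  -- the gain from localization: for kernel weights the maximum is of order 1/(Th) while the sum
  -- stays bounded.
  have hsq : ∑ i ∈ Finset.range n, a i ^ 2 ≤ m * κ * A := by
    calc ∑ i ∈ Finset.range n, a i ^ 2 ≤ ∑ i ∈ Finset.range n, m * κ * a i :=
          Finset.sum_le_sum fun i _ => by
            rw [sq]; exact mul_le_mul_of_nonneg_right (haκ i) (ha0 i)
      _ = m * κ * ∑ i ∈ Finset.range n, a i := by rw [Finset.mul_sum]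
      _ ≤ m * κ * A := mul_le_mul_of_nonneg_left hA (by positivity)
  have := mul_le_mul_of_nonneg_left hsq (sq_nonneg l)
  linarith

/-- If the whole sum reaches ε, one of the parities reaches ε / 2. The bounds c are nonnegative, so
A bounds their sum over either parity. -/
theorem measure_le_sum_Icc_le {T m : ℕ} (hm : 1 ≤ m) (hX : ∀ t, Measurable (X T t))
    {φ : ℝ≥0} (hφ : phiMixing P X m ≤ φ) {ξ : ℕ → S → ℝ}
    (hξ : ∀ t ∈ Finset.Icc 1 T, Measurable[MeasurableSpace.comap (X T t) inferInstance] (ξ t))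
    (h0 : ∀ t ∈ Finset.Icc 1 T, ∫ x, ξ t x ∂P = 0) {c : ℕ → ℝ}
    (hc : ∀ t ∈ Finset.Icc 1 T, ∀ x, |ξ t x| ≤ c t) {κ A : ℝ}
    (hcκ : ∀ t ∈ Finset.Icc 1 T, c t ≤ κ) (hκ : 0 ≤ κ) (hA : ∑ t ∈ Finset.Icc 1 T, c t ≤ A)
    {l : ℝ} (hl : 0 ≤ l) (hlκ : l * (m * κ) ≤ 1) (ε : ℝ) :
    P {x | ε ≤ ∑ t ∈ Finset.Icc 1 T, ξ t x} ≤ 2 * ENNReal.ofReal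
      (Real.exp (-(l * (ε / 2)) + l ^ 2 * (m * κ * A) + 3 * (T / m + 1 : ℕ) * φ)) := by
  have hc0 : ∀ t ∈ Finset.Icc 1 T, 0 ≤ c t := fun t ht => by
    have : Nonempty S := nonempty_of_isProbabilityMeasure P
    exact (abs_nonneg _).trans (hc t ht (Classical.arbitrary S))
  have hb : ∀ p, 0 ≤ ∑ i ∈ Finset.range (T / m + 1), ∑ t ∈ timeBlock T m (2 * i + p), c t :=
    fun p => Finset.sum_nonneg fun i _ => Finset.sum_nonneg fun t ht =>
      hc0 t ((mem_timeBlock hm).1 ht).1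
  rw [sum_Icc_eq_sum_timeBlock c T m] at hA
  have hb0 := hb 0
  have hb1 := hb 1
  rw [two_mul]
  refine (measure_mono (fun x hx => ?_)).trans ((measure_union_le _ _).trans (add_le_add
    (measure_le_sum_timeBlock_le (p := 0) (n := T / m + 1) hm hX hφ hξ h0 hc hcκ hκ
      (by simp only [add_zero] at hb0 ⊢; linarith) hl hlκ (ε / 2))
    (measure_le_sum_timeBlock_le (p := 1) (n := T / m + 1) hm hX hφ hξ h0 hc hcκ hκ
      (by simp only [add_zero] at hb0 ⊢; linarith) hl hlκ (ε / 2))))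
  rw [mem_ofPred_eq, sum_Icc_eq_sum_timeBlock (fun t => ξ t x) T m] at hx
  by_contra hcon
  simp only [mem_union, mem_ofPred_eq, not_or, not_le, add_zero] at hcon
  linarith [hcon.1, hcon.2]

/-- An exponential inequality for weighted sums over a row of a `φ`-mixing array. -/
theorem measure_le_abs_sum_Icc_le {T m : ℕ} (hm : 1 ≤ m) (hX : ∀ t, Measurable (X T t))
    {φ : ℝ≥0} (hφ : phiMixing P X m ≤ φ) {ξ : ℕ → S → ℝ}
    (hξ : ∀ t ∈ Finset.Icc 1 T, Measurable[MeasurableSpace.comap (X T t) inferInstance] (ξ t))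
    (h0 : ∀ t ∈ Finset.Icc 1 T, ∫ x, ξ t x ∂P = 0) {c : ℕ → ℝ}
    (hc : ∀ t ∈ Finset.Icc 1 T, ∀ x, |ξ t x| ≤ c t) {κ A : ℝ}
    (hcκ : ∀ t ∈ Finset.Icc 1 T, c t ≤ κ) (hκ : 0 ≤ κ) (hA : ∑ t ∈ Finset.Icc 1 T, c t ≤ A)
    {l : ℝ} (hl : 0 ≤ l) (hlκ : l * (m * κ) ≤ 1) (ε : ℝ) :
    P {x | ε ≤ |∑ t ∈ Finset.Icc 1 T, ξ t x|} ≤ 4 * ENNReal.ofReal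
      (Real.exp (-(l * (ε / 2)) + l ^ 2 * (m * κ * A) + 3 * (T / m + 1 : ℕ) * φ)) := by
  have h1 := measure_le_sum_Icc_le hm hX hφ hξ h0 hc hcκ hκ hA hl hlκ ε
  have h2 := measure_le_sum_Icc_le hm hX hφ (ξ := fun t x => -ξ t x) (fun t ht => (hξ t ht).neg)
    (fun t ht => by rw [integral_neg, h0 t ht, neg_zero])
    (fun t ht x => by rw [abs_neg]; exact hc t ht x) hcκ hκ hA hl hlκ ε
  have h4 : (4 : ℝ≥0∞) = 2 + 2 := by norm_num
  rw [h4, add_mul]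
  refine (measure_mono fun x hx => ?_).trans ((measure_union_le _ _).trans (add_le_add h1 h2))
  rcases le_abs.1 (show ε ≤ |_| from hx) with h | h
  · exact Or.inl h
  · refine Or.inr ?_
    rw [mem_ofPred_eq, Finset.sum_neg_distrib]
    exact h

end RowMixing

/-! ### Kernel weights as Riemann sums of the kernel. -/

section Kernel

/-- The `t`-th cell of the grid with origin `x₀` and mesh `s`. -/
def gridCell (x₀ s : ℝ) (t : ℕ) : Set ℝ := Ioc (x₀ + t * s) (x₀ + (t + 1 : ℕ) * s)

theorem measurableSet_gridCell (x₀ s : ℝ) (t : ℕ) : MeasurableSet (gridCell x₀ s t) :=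
  measurableSet_Ioc

theorem pairwise_disjoint_gridCell (x₀ : ℝ) {s : ℝ} (hs : 0 ≤ s) :
    Pairwise (Function.onFun Disjoint (gridCell x₀ s)) := by
  have hmono : Monotone fun t : ℕ => x₀ + t * s := fun a b hab => by
    dsimp only
    gcongr
  exact hmono.pairwise_disjoint_on_Ioc_succ

theorem integral_biUnion_gridCell (x₀ : ℝ) {s : ℝ} (hs : 0 ≤ s) (F : Finset ℕ) {g : ℝ → ℝ}
    (hg : Integrable g) :
    ∫ x in ⋃ t ∈ F, gridCell x₀ s t, g x = ∑ t ∈ F, ∫ x in gridCell x₀ s t, g x :=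
  integral_biUnion_finset F (fun t _ => measurableSet_gridCell x₀ s t)
    (fun _ _ _ _ hij => pairwise_disjoint_gridCell x₀ hs hij) fun _ _ => hg.integrableOn

theorem Ioc_subset_biUnion_gridCell {x₀ s a b : ℝ} (hs : 0 < s) {T : ℕ} (ha : x₀ + s ≤ a)
    (hb : b ≤ x₀ + (T + 1) * s) : Ioc a b ⊆ ⋃ t ∈ Finset.Icc 1 T, gridCell x₀ s t := by
  intro y hy
  have h1 : 1 < (y - x₀) / s := by rw [lt_div_iff₀ hs]; linarith [hy.1]
  have h2 : (y - x₀) / s ≤ T + 1 := by rw [div_le_iff₀ hs]; linarith [hy.2]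
  obtain ⟨t, ht⟩ : ∃ t, ⌈(y - x₀) / s⌉₊ = t + 1 :=
    Nat.exists_eq_succ_of_ne_zero (Nat.ceil_pos.2 (by linarith)).ne'
  have h3 : (t : ℝ) < (y - x₀) / s := by
    have := Nat.lt_ceil.1 (show t < ⌈(y - x₀) / s⌉₊ by omega)
    exact this
  have h4 : (y - x₀) / s ≤ (t + 1 : ℕ) := by rw [← ht]; exact Nat.le_ceil _
  have h5 : 1 ≤ t := by
    have : (1 : ℝ) < (t + 1 : ℕ) := h1.trans_le h4
    norm_cast at this
    omega
  have h6 : t ≤ T := by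
    have : (t : ℝ) < T + 1 := h3.trans_le h2
    norm_cast at this
    omega
  refine mem_biUnion (Finset.mem_coe.2 (Finset.mem_Icc.2 ⟨h5, h6⟩)) ⟨?_, ?_⟩
  · rw [lt_div_iff₀ hs] at h3; linarith
  · rw [div_le_iff₀ hs] at h4; linarith

variable {K : ℝ → ℝ}

/-- Inside a cell `K` differs from its value at the left endpoint by at most the variation of `K`
over that cell. The cells are disjoint, so a whole Riemann sum has error at most s ∫ |K'|, whatever
the number of cells. -/
theorem abs_mul_sub_setIntegral_gridCell_le (hK : ContDiff ℝ 1 K) (x₀ : ℝ) {s : ℝ} (hs : 0 ≤ s)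
    (t : ℕ) : |s * K (x₀ + t * s) - ∫ x in gridCell x₀ s t, K x| ≤
      s * ∫ x in gridCell x₀ s t, |deriv K x| := by
  have hd : Continuous (deriv K) := hK.continuous_deriv le_rfl
  have hle : x₀ + t * s ≤ x₀ + (t + 1 : ℕ) * s := by push_cast; linarith
  have hlen : x₀ + (t + 1 : ℕ) * s - (x₀ + t * s) = s := by push_cast; ring
  set a := x₀ + t * s with ha
  set b := x₀ + (t + 1 : ℕ) * s with hb
  have hcell : gridCell x₀ s t = Ioc a b := rfl
  rw [hcell, ← intervalIntegral.integral_of_le hle, ← intervalIntegral.integral_of_le hle]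
  have hpt : ∀ y ∈ Ioc a b, |K a - K y| ≤ ∫ x in a..b, |deriv K x| := by
    intro y hy
    have hay := hy.1.le
    rw [abs_sub_comm, ← intervalIntegral.integral_deriv_eq_sub
      (fun x _ => (hK.differentiable one_ne_zero).differentiableAt) (hd.intervalIntegrable _ _)]
    refine (intervalIntegral.abs_integral_le_integral_abs hay).trans ?_
    exact intervalIntegral.integral_mono_interval le_rfl hay hy.2
      (Eventually.of_forall fun x => abs_nonneg _) (hd.abs.intervalIntegrable _ _)
  have hsub : s * K a - ∫ x in a..b, K x = ∫ x in a..b, (K a - K x) := by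
    rw [intervalIntegral.integral_sub (by simp) (hK.continuous.intervalIntegrable _ _),
      intervalIntegral.integral_const, hlen, smul_eq_mul]
  rw [hsub]
  have := intervalIntegral.norm_integral_le_of_norm_le_const (a := a) (b := b)
    (f := fun x => K a - K x) (C := ∫ x in a..b, |deriv K x|) (by
      rw [uIoc_of_le hle]; exact hpt)
  rw [hlen, abs_of_nonneg hs, mul_comm] at this
  exact this

theorem sum_le_setIntegral_add (hK : ContDiff ℝ 1 K) (hK0 : ∀ x, 0 ≤ K x) (hKi : Integrable K)
    (hK' : Integrable (deriv K)) {x₀ s : ℝ} (hs : 0 ≤ s) {F : Finset ℕ} {A : Set ℝ}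
    (hF : ∀ t ∈ F, gridCell x₀ s t ⊆ A) :
    ∑ t ∈ F, s * K (x₀ + t * s) ≤ (∫ x in A, K x) + s * ∫ x, |deriv K x| := by
  calc ∑ t ∈ F, s * K (x₀ + t * s)
      ≤ ∑ t ∈ F, ((∫ x in gridCell x₀ s t, K x) + s * ∫ x in gridCell x₀ s t, |deriv K x|) :=
        Finset.sum_le_sum fun t _ => by
          linarith [(abs_le.1 (abs_mul_sub_setIntegral_gridCell_le hK x₀ hs t)).2]
    _ = (∫ x in ⋃ t ∈ F, gridCell x₀ s t, K x) +
          s * ∫ x in ⋃ t ∈ F, gridCell x₀ s t, |deriv K x| := by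
        rw [Finset.sum_add_distrib, ← Finset.mul_sum, integral_biUnion_gridCell x₀ hs F hKi,
          integral_biUnion_gridCell x₀ hs F hK'.abs]
    _ ≤ _ := by
        gcongr
        · exact ae_of_all _ hK0
        · exact hKi.integrableOn
        · exact iUnion₂_subset hF
        · exact ae_of_all _ fun x => abs_nonneg _
        · exact hK'.abs
        · exact Measure.restrict_le_self

theorem setIntegral_sub_le_sum (hK : ContDiff ℝ 1 K) (hK0 : ∀ x, 0 ≤ K x) (hKi : Integrable K)
    (hK' : Integrable (deriv K)) {x₀ s : ℝ} (hs : 0 ≤ s) {F : Finset ℕ} {A : Set ℝ}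
    (hF : A ⊆ ⋃ t ∈ F, gridCell x₀ s t) :
    (∫ x in A, K x) - s * ∫ x, |deriv K x| ≤ ∑ t ∈ F, s * K (x₀ + t * s) := by
  calc (∫ x in A, K x) - s * ∫ x, |deriv K x|
      ≤ (∫ x in ⋃ t ∈ F, gridCell x₀ s t, K x) -
          s * ∫ x in ⋃ t ∈ F, gridCell x₀ s t, |deriv K x| := by
        gcongr
        · exact ae_of_all _ hK0
        · exact hKi.integrableOn
        · exact ae_of_all _ fun x => abs_nonneg _
        · exact hK'.abs
        · exact Measure.restrict_le_self
    _ = ∑ t ∈ F, ((∫ x in gridCell x₀ s t, K x) - s * ∫ x in gridCell x₀ s t, |deriv K x|) := by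
        rw [Finset.sum_sub_distrib, ← Finset.mul_sum, integral_biUnion_gridCell x₀ hs F hKi,
          integral_biUnion_gridCell x₀ hs F hK'.abs]
    _ ≤ _ := Finset.sum_le_sum fun t _ => by
          linarith [(abs_le.1 (abs_mul_sub_setIntegral_gridCell_le hK x₀ hs t)).1]

/-- The weight of the observation at time `t` in a kernel average around `u`. -/
noncomputable def kernelWeight (K : ℝ → ℝ) (h : ℝ) (T : ℕ) (u : ℝ) (t : ℕ) : ℝ :=
  1 / (T * h) * K ((u - t / T) / h)

theorem kernelWeight_nonneg (hK0 : ∀ x, 0 ≤ K x) {h : ℝ} (hh : 0 < h) (T : ℕ) (u : ℝ) (t : ℕ) :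
    0 ≤ kernelWeight K h T u t := mul_nonneg (by positivity) (hK0 _)

theorem kernelWeight_le {C : ℝ} (hC : ∀ x, K x ≤ C) {h : ℝ} (hh : 0 < h) (T : ℕ) (u : ℝ) (t : ℕ) :
    kernelWeight K h T u t ≤ 1 / (T * h) * C :=
  mul_le_mul_of_nonneg_left (hC _) (by positivity)

theorem abs_kernelWeight_sub_le {C : ℝ} (hC : ∀ x x', |K x - K x'| ≤ C * |x - x'|) {h : ℝ}
    (hh : 0 < h) (T : ℕ) (u u' : ℝ) (t : ℕ) :
    |kernelWeight K h T u t - kernelWeight K h T u' t| ≤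
      1 / (T * h) * (C * (|u - u'| / h)) := by
  have h1 : (u - t / T) / h - (u' - t / T) / h = (u - u') / h := by ring
  rw [kernelWeight, kernelWeight, ← mul_sub, abs_mul, abs_of_nonneg (by positivity)]
  refine mul_le_mul_of_nonneg_left ((hC _ _).trans_eq ?_) (by positivity)
  rw [h1, abs_div, abs_of_pos hh]

/-- By symmetry the weights are s K at the nodes of a grid with origin -u/h and mesh s = 1/(Th), so
the Riemann sum bounds apply. -/
theorem kernelWeight_eq (hsymm : ∀ x, K (-x) = K x) {h : ℝ} {T : ℕ} (hT : 1 ≤ T) (u : ℝ)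
    (t : ℕ) : kernelWeight K h T u t = 1 / (T * h) * K (-(u / h) + t * (1 / (T * h))) := by
  have : (T : ℝ) ≠ 0 := by positivity
  rw [kernelWeight, ← hsymm]
  congr 2
  rw [sub_div, div_div]
  ring

theorem sum_kernelWeight_le (hK : ContDiff ℝ 1 K) (hK0 : ∀ x, 0 ≤ K x) (hKi : Integrable K)
    (hK' : Integrable (deriv K)) (hsymm : ∀ x, K (-x) = K x) {h : ℝ} (hh : 0 < h) {T : ℕ}
    (hT : 1 ≤ T) (u : ℝ) : ∑ t ∈ Finset.Icc 1 T, kernelWeight K h T u t ≤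
      (∫ x, K x) + 1 / (T * h) * ∫ x, |deriv K x| := by
  simp_rw [kernelWeight_eq hsymm hT]
  simpa using sum_le_setIntegral_add hK hK0 hKi hK' (x₀ := -(u / h)) (s := 1 / (T * h))
    (by positivity) (F := Finset.Icc 1 T) (A := univ) fun _ _ => subset_univ _

/-- Observations outside of a window of width proportional to the bandwidth are negligible. -/
theorem exists_tail_kernelWeight_le (hK : ContDiff ℝ 1 K) (hK0 : ∀ x, 0 ≤ K x)
    (hKi : Integrable K) (hK' : Integrable (deriv K)) (hsymm : ∀ x, K (-x) = K x) {ε : ℝ}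
    (hε : 0 < ε) : ∃ L s₀ : ℝ, 0 < L ∧ 0 < s₀ ∧ ∀ (h : ℝ) (T : ℕ) (u : ℝ), 0 < h → 1 ≤ T →
      1 / (T * h) ≤ s₀ →
      ∑ t ∈ Finset.Icc 1 T with L * h < |u - (t : ℕ) / T|, kernelWeight K h T u t ≤ ε := by
  have hset : ∀ n : ℕ, MeasurableSet {x : ℝ | (n : ℝ) < |x|} := fun n =>
    measurableSet_lt measurable_const measurable_id.abs
  have hanti : Antitone fun n : ℕ => {x : ℝ | (n : ℝ) < |x|} := fun a b hab x hx =>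
    show (a : ℝ) < |x| from (Nat.cast_le.2 hab).trans_lt hx
  have hlim := tendsto_setIntegral_of_antitone (f := K) (μ := volume) hset hanti
    ⟨0, hKi.integrableOn⟩
  have hempty : ⋂ n : ℕ, {x : ℝ | (n : ℝ) < |x|} = ∅ := by
    refine eq_empty_of_forall_notMem fun x hx => ?_
    obtain ⟨n, hn⟩ := exists_nat_gt |x|
    exact lt_asymm hn (mem_iInter.1 hx n)
  rw [hempty, setIntegral_empty] at hlim
  obtain ⟨n, hn⟩ := (hlim.eventually_lt_const (half_pos hε)).exists
  set V := ∫ x, |deriv K x|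
  have hV : 0 ≤ V := integral_nonneg fun x => abs_nonneg _
  -- With mesh at most 1, a cell whose left endpoint lies beyond n + 1 in absolute value stays in
  -- {|x| > n}, where `K` has integral below ε / 2. The second bound on the mesh makes the Riemann
  -- error at most ε / 2.
  refine ⟨n + 1, min 1 (ε / (2 * (V + 1))), by positivity, by positivity, ?_⟩
  intro h T u hh hT hs
  have hs1 := hs.trans (min_le_left _ _)
  have hs2 := hs.trans (min_le_right _ _)
  have hs0 : 0 ≤ 1 / (T * h) := by positivity
  simp_rw [kernelWeight_eq hsymm hT]
  have hT0 : (T : ℝ) ≠ 0 := by positivity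
  set s := 1 / (T * h) with hsdef
  refine (sum_le_setIntegral_add hK hK0 hKi hK' hs0
    (A := {x | (n : ℝ) < |x|}) fun t ht y hy => ?_).trans ?_
  · have ht2 := (Finset.mem_filter.1 ht).2
    have hx : |-(u / h) + t * s| = |u - t / T| / h := by
      rw [← abs_neg, ← abs_of_pos hh, ← abs_div, abs_of_pos hh, hsdef]
      congr 1
      field_simp
      ring
    have h1 : (n : ℝ) + 1 < |-(u / h) + t * s| := by rwa [hx, lt_div_iff₀ hh]
    have hy1 := hy.1
    have hy2 := hy.2
    push_cast at hy2
    rw [mem_ofPred_eq]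
    rcases lt_abs.1 h1 with h2 | h2
    · exact lt_abs.2 (Or.inl (by linarith))
    · exact lt_abs.2 (Or.inr (by linarith))
  · have h2 : s * V ≤ ε / 2 := by
      calc s * V ≤ ε / (2 * (V + 1)) * V := by gcongr
        _ ≤ ε / (2 * (V + 1)) * (V + 1) := by gcongr; linarith
        _ = ε / 2 := by field_simp
    linarith

/-- The total weight is bounded below, also next to the boundary. -/
theorem exists_le_sum_kernelWeight (hK : ContDiff ℝ 1 K) (hK0 : ∀ x, 0 ≤ K x)
    (hKi : Integrable K) (hK' : Integrable (deriv K)) (hsymm : ∀ x, K (-x) = K x)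
    (hne : ∫ x, K x ≠ 0) : ∃ w s₀ : ℝ, 0 < w ∧ 0 < s₀ ∧ ∀ (h : ℝ) (T : ℕ), 0 < h → 1 ≤ T →
      1 / (T * h) ≤ s₀ → h ≤ s₀ → ∀ u ∈ Icc (0 : ℝ) 1,
      w ≤ ∑ t ∈ Finset.Icc 1 T, kernelWeight K h T u t := by
  -- If `K` vanished on the positive axis, by symmetry it would vanish except at 0, and its integral
  -- would be 0.
  obtain ⟨x₁, hx₁, hKx⟩ : ∃ x, 0 < x ∧ 0 < K x := by
    by_contra! hcon
    have hz : ∀ x, x ≠ 0 → K x = 0 := fun x hx => by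
      rcases lt_or_gt_of_ne hx with h | h
      · rw [← hsymm]; exact le_antisymm (hcon _ (by linarith)) (hK0 _)
      · exact le_antisymm (hcon _ h) (hK0 _)
    refine hne (integral_eq_zero_of_ae ?_)
    filter_upwards [compl_mem_ae_iff.2 (measure_singleton (0 : ℝ))] with x hx using hz x hx
  have hpos : ∀ a b x, a < x → x < b → 0 < K x → 0 < ∫ y in Ioc a b, K y := by
    intro a b x hax hxb hKx
    rw [← intervalIntegral.integral_of_le (hax.trans hxb).le]
    exact intervalIntegral.integral_pos (hax.trans hxb) hK.continuous.continuousOn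
      (fun y _ => hK0 y) ⟨x, ⟨hax.le, hxb.le⟩, hKx⟩
  have hκ₁ := hpos (x₁ / 2) (2 * x₁) x₁ (by linarith) (by linarith) hKx
  have hκ₂ := hpos (-(2 * x₁)) (-(x₁ / 2)) (-x₁) (by linarith) (by linarith) (by rwa [hsymm])
  set κ₁ := ∫ y in Ioc (x₁ / 2) (2 * x₁), K y
  set κ₂ := ∫ y in Ioc (-(2 * x₁)) (-(x₁ / 2)), K y
  set V := ∫ x, |deriv K x|
  have hV : 0 ≤ V := integral_nonneg fun x => abs_nonneg _
  have hκ : 0 < min κ₁ κ₂ := lt_min hκ₁ hκ₂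
  -- The bounds on s and h make one of the windows around ±x₁ lie inside the grid, with room for a
  -- cell at either end; the last term keeps the Riemann error below half of the window's mass.
  refine ⟨min κ₁ κ₂ / 2, min (min (x₁ / 2) (1 / (2 * (3 * x₁)))) (min κ₁ κ₂ / (2 * (V + 1))),
    by positivity, by positivity, ?_⟩
  intro h T hh hT hs hh' u hu
  have hs1 := (hs.trans (min_le_left _ _)).trans (min_le_left _ _)
  have hs2 := hs.trans (min_le_right _ _)
  have hh2 := (hh'.trans (min_le_left _ _)).trans (min_le_right _ _)
  have hT0 : (T : ℝ) ≠ 0 := by positivity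
  have hs0 : 0 < 1 / (T * h) := by positivity
  simp_rw [kernelWeight_eq hsymm hT]
  have hTs : (T : ℝ) * (1 / (T * h)) = 1 / h := by field_simp
  set s := 1 / (T * h) with hsdef
  have h2 : s * V ≤ min κ₁ κ₂ / 2 := by
    calc s * V ≤ min κ₁ κ₂ / (2 * (V + 1)) * V := by gcongr
      _ ≤ min κ₁ κ₂ / (2 * (V + 1)) * (V + 1) := by gcongr; linarith
      _ = min κ₁ κ₂ / 2 := by field_simp
  have hlarge : 3 * x₁ ≤ 1 / (2 * h) := by
    rw [le_div_iff₀ (by positivity)] at hh2 ⊢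
    linarith
  have hhalf : 1 / h = 1 / (2 * h) + 1 / (2 * h) := by field_simp; norm_num
  -- The nodes fill the range from -u/h to (1 - u)/h. At least one side of 0 has length 1/(2h) or
  -- more: the right side if u ≤ 1/2, the left side otherwise.
  rcases le_total u (1 / 2) with hu2 | hu2
  · have hsub : Ioc (x₁ / 2) (2 * x₁) ⊆ ⋃ t ∈ Finset.Icc 1 T, gridCell (-(u / h)) s t := by
      have h3 : 0 ≤ u / h := div_nonneg hu.1 hh.le
      have h4 : u / h ≤ 1 / (2 * h) := by
        rw [← div_div]; gcongr
      exact Ioc_subset_biUnion_gridCell hs0 (by linarith) (by linarith)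
    have := setIntegral_sub_le_sum hK hK0 hKi hK' hs0.le hsub
    linarith [min_le_left κ₁ κ₂]
  · have hsub : Ioc (-(2 * x₁)) (-(x₁ / 2)) ⊆
        ⋃ t ∈ Finset.Icc 1 T, gridCell (-(u / h)) s t := by
      have h3 : u / h ≤ 1 / h := by gcongr; exact hu.2
      have h4 : 1 / (2 * h) ≤ u / h := by
        rw [← div_div]; gcongr
      exact Ioc_subset_biUnion_gridCell hs0 (by linarith) (by linarith)
    have := setIntegral_sub_le_sum hK hK0 hKi hK' hs0.le hsub
    linarith [min_le_right κ₁ κ₂]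

/-- The derivative of a kernel is integrable under the tail conditions. -/
theorem integrable_deriv_of_tails (hK : ContDiff ℝ 1 K)
    (htails : (∃ L : ℝ, ∀ x, L < |x| → K x = 0) ∨
      ∃ C L v : ℝ, 1 < v ∧ (∀ x, |deriv K x| ≤ C) ∧
        ∀ x, L < |x| → |deriv K x| ≤ C * |x| ^ (-v)) : Integrable (deriv K) := by
  have hd : Continuous (deriv K) := hK.continuous_deriv le_rfl
  rcases htails with ⟨L, hL⟩ | ⟨C, L, v, hv, hC, hCL⟩
  · have hcs : HasCompactSupport K := by
      refine HasCompactSupport.intro (isCompact_Icc (a := -L) (b := L)) fun x hx => hL x ?_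
      by_contra hcon
      exact hx (abs_le.1 (not_lt.1 hcon))
    exact hd.integrable_of_hasCompactSupport hcs.deriv
  · set R := max L 1
    have hC0 : 0 ≤ C := (abs_nonneg _).trans (hC 0)
    have hR : 1 ≤ R := le_max_right _ _
    -- A multiple of (1 + |x|)^(-v) dominates the derivative everywhere: the factor (1 + R)^v covers
    -- |x| ≤ R, and for |x| > R one has (1 + |x|)/|x| ≤ 1 + R because R ≥ 1.
    have hint := (integrable_one_add_norm (E := ℝ) (μ := volume) (r := v)
      (by simpa using hv)).const_mul (C * (1 + R) ^ v)
    refine hint.mono' hd.aestronglyMeasurable (ae_of_all _ fun x => ?_)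
    rw [Real.norm_eq_abs, Real.norm_eq_abs, mul_assoc, Real.rpow_neg (by positivity),
      ← div_eq_mul_inv, ← Real.div_rpow (by positivity) (by positivity)]
    rcases lt_or_ge R |x| with hx | hx
    · refine (hCL x ((le_max_left _ _).trans_lt hx)).trans ?_
      have hx0 : 0 < |x| := by linarith
      rw [Real.rpow_neg hx0.le, ← Real.inv_rpow hx0.le]
      gcongr
      rw [inv_le_iff_one_le_mul₀ hx0, div_mul_eq_mul_div, le_div_iff₀ (by positivity)]
      nlinarith
    · refine (hC x).trans (le_mul_of_one_le_right hC0 (Real.one_le_rpow ?_ (by linarith)))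
      rw [le_div_iff₀ (by positivity)]
      linarith

end Kernel

/-! ### The weak law of large numbers for functions of an i.i.d. history. -/

section History

theorem measurable_of_comap_apply_le {S ι V : Type*} [MeasurableSpace V] {σ : MeasurableSpace S}
    {x : S → ι → V} (h : ∀ i, MeasurableSpace.comap (fun ω => x ω i) inferInstance ≤ σ) :
    Measurable[σ] x :=
  measurable_pi_lambda _ fun i => measurable_iff_comap_le.2 (h i)

variable {S V : Type*} [MeasurableSpace S] [MeasurableSpace V] {P : Measure S}
  {ν : ℤ → S → V}

theorem measurable_past (hν : ∀ t, Measurable (ν t)) (t : ℤ) : Measurable (past ν t) :=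
  measurable_pi_lambda _ fun k => hν (t - k)

/-- The law of the history depends on the law of one error only. Hence it is the same at all times,
and the same for observed and simulated errors. -/
theorem map_past [IsProbabilityMeasure P] (hν : ∀ t, Measurable (ν t)) (hind : iIndepFun ν P)
    (hid : ∀ t, IdentDistrib (ν t) (ν 0) P P) (t : ℤ) :
    P.map (past ν t) = Measure.infinitePi fun _ : ℕ => P.map (ν 0) := by
  have hinj : Function.Injective fun k : ℕ => t - (k : ℤ) := fun a b hab => by
    dsimp only at hab
    omega
  have h := (hind.precomp hinj).map_fun_eq_infinitePi_map fun k : ℕ => hν (t - (k : ℤ))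
  simp_rw [(hid _).map_eq] at h
  exact h

/-- This identifies the limit in the upward martingale convergence theorem as the function itself.
-/
theorem iSup_piLE_nat : ⨆ n : ℕ, (Filtration.piLE (X := fun _ : ℕ => V)) n =
    (MeasurableSpace.pi : MeasurableSpace (ℕ → V)) := by
  refine le_antisymm (iSup_le fun n => Filtration.piLE.le n) (iSup_le fun n => ?_)
  refine le_iSup_of_le n (Measurable.comap_le ?_)
  exact (measurable_pi_apply (⟨n, mem_Iic.2 le_rfl⟩ : Set.Iic n)).comp
    (comap_measurable (Preorder.restrictLe n))

/-- Functions of an independent history have covariances that vanish with the lag. -/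
theorem abs_integral_mul_past_le (hν : ∀ t, Measurable (ν t)) (hind : iIndepFun ν P)
    {μ : Measure (ℕ → V)} [IsProbabilityMeasure μ]
    (hμ : ∀ t, P.map (past ν t) = μ) {F : (ℕ → V) → ℝ} (hF : Measurable F) {C : ℝ}
    (hC : ∀ e, |F e| ≤ C) (h0 : ∫ e, F e ∂μ = 0) {m : ℕ} {s t : ℤ} (hst : s < t - m) :
    |∫ ω, F (past ν s ω) * F (past ν t ω) ∂P| ≤
      C * ∫ e, |F e - (μ[F | Filtration.piLE (X := fun _ : ℕ => V) m]) e| ∂μ := by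
  -- `Fm` uses only the m + 1 most recent errors. Evaluated at time t these are ν_t, …, ν_{t-m}, all
  -- later than s, so `Fm` is independent of the history at s and its covariance with F vanishes.
  -- What remains is the L¹ error of replacing F by `Fm`.
  set Fm := μ[F | Filtration.piLE (X := fun _ : ℕ => V) m] with hFm
  have hFi : Integrable F μ := Integrable.of_bound hF.aestronglyMeasurable C (ae_of_all _ hC)
  have hFmm : Measurable[Filtration.piLE (X := fun _ : ℕ => V) m] Fm :=
    stronglyMeasurable_condExp.measurable
  have hFmi : Integrable Fm μ := integrable_condExp
  have hmp : ∀ t, MeasurePreserving (past ν t) P μ := fun t => ⟨measurable_past hν t, hμ t⟩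
  have hXi : ∀ t, Integrable (fun ω => F (past ν t ω)) P := fun t =>
    (hmp t).integrable_comp_of_integrable hFi
  have hYi : Integrable (fun ω => Fm (past ν t ω)) P := (hmp t).integrable_comp_of_integrable hFmi
  have hbdd : ∀ᵐ ω ∂P, ‖F (past ν s ω)‖ ≤ C := ae_of_all _ fun ω => hC _
  have hm1 : Measurable[⨆ j ∈ Iic s, MeasurableSpace.comap (ν j) inferInstance]
      fun ω => F (past ν s ω) := by
    refine hF.comp (measurable_of_comap_apply_le fun k => ?_)
    exact le_iSup₂_of_le (f := fun j (_ : j ∈ Iic s) => MeasurableSpace.comap (ν j) inferInstance)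
      (s - (k : ℤ)) (by simp) le_rfl
  have hm2 : Measurable[⨆ j ∈ Ioi s, MeasurableSpace.comap (ν j) inferInstance]
      fun ω => Fm (past ν t ω) := by
    refine hFmm.comp (measurable_comap_iff.2 (measurable_of_comap_apply_le fun k => ?_))
    have hk : ((k : ℕ) : ℤ) ≤ m := Nat.cast_le.2 k.2
    exact le_iSup₂_of_le (f := fun j (_ : j ∈ Ioi s) => MeasurableSpace.comap (ν j) inferInstance)
      (t - ((k : ℕ) : ℤ)) (by rw [mem_Ioi]; omega) le_rfl
  have hindep : IndepFun (fun ω => F (past ν s ω)) (fun ω => Fm (past ν t ω)) P := by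
    have h := indep_iSup_of_disjoint (fun j => (hν j).comap_le) hind
      (S := Iic s) (T := Ioi s) (disjoint_left.2 fun j hj hj' =>
        not_lt.2 (mem_Iic.1 hj) (mem_Ioi.1 hj'))
    exact indep_of_indep_of_le_left (indep_of_indep_of_le_right h hm2.comap_le) hm1.comap_le
  have hE0 : ∫ ω, F (past ν s ω) ∂P = 0 := by
    rw [← h0, ← hμ s, integral_map (measurable_past hν s).aemeasurable hF.aestronglyMeasurable]
  have hprod : ∫ ω, F (past ν s ω) * Fm (past ν t ω) ∂P = 0 := by
    rw [hindep.integral_fun_mul_eq_mul_integral (hXi s).aestronglyMeasurable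
      hYi.aestronglyMeasurable, hE0, zero_mul]
  have hi1 : Integrable (fun ω => F (past ν s ω) * F (past ν t ω)) P :=
    (hXi t).bdd_mul (hXi s).aestronglyMeasurable hbdd
  have hi2 : Integrable (fun ω => F (past ν s ω) * Fm (past ν t ω)) P :=
    hYi.bdd_mul (hXi s).aestronglyMeasurable hbdd
  have hdiff : ∫ ω, F (past ν s ω) * F (past ν t ω) ∂P =
      ∫ ω, F (past ν s ω) * (F (past ν t ω) - Fm (past ν t ω)) ∂P := by
    simp_rw [mul_sub]
    rw [integral_sub hi1 hi2, hprod, sub_zero]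
  have hI : Integrable (fun e => |F e - Fm e|) μ := (hFi.sub hFmi).abs
  rw [hdiff, ← hμ t, integral_map (measurable_past hν t).aemeasurable
    (by rw [hμ t]; exact hI.aestronglyMeasurable), ← integral_const_mul]
  refine abs_integral_le_integral_abs.trans (integral_mono_of_nonneg
    (ae_of_all _ fun ω => abs_nonneg _)
    (((hmp t).integrable_comp_of_integrable hI).const_mul C) (ae_of_all _ fun ω => ?_))
  dsimp only
  rw [abs_mul]
  exact mul_le_mul_of_nonneg_right (hC _) (abs_nonneg _)

theorem sum_sum_ite_abs_sub_le (T m : ℕ) : ∑ s ∈ Finset.Icc 1 T, ∑ t ∈ Finset.Icc 1 T,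
    (if (s : ℤ) ≤ t + m ∧ (t : ℤ) ≤ s + m then (1 : ℝ) else 0) ≤ T * (2 * m + 1) := by
  have h : ∀ s ∈ Finset.Icc 1 T, ∑ t ∈ Finset.Icc 1 T,
      (if (s : ℤ) ≤ t + m ∧ (t : ℤ) ≤ s + m then (1 : ℝ) else 0) ≤ 2 * m + 1 := by
    intro s _
    rw [Finset.sum_ite, Finset.sum_const_zero, add_zero, Finset.sum_const, nsmul_eq_mul, mul_one]
    have hsub : (Finset.Icc 1 T).filter (fun t : ℕ => (s : ℤ) ≤ t + m ∧ (t : ℤ) ≤ s + m) ⊆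
        Finset.Icc (s - m) (s + m) := fun t ht => by
      rw [Finset.mem_filter] at ht
      rw [Finset.mem_Icc]
      omega
    have hcard := Finset.card_le_card hsub
    rw [Nat.card_Icc] at hcard
    have : ((Finset.Icc 1 T).filter (fun t : ℕ => (s : ℤ) ≤ t + m ∧ (t : ℤ) ≤ s + m)).card ≤
        2 * m + 1 := by omega
    exact_mod_cast this
  refine (Finset.sum_le_sum h).trans_eq ?_
  rw [Finset.sum_const, Nat.card_Icc, nsmul_eq_mul, Nat.add_sub_cancel]

/-- In the double sum, at most T(2m + 1) pairs have lag up to m and contribute at most C² each;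
every other pair is bounded by the L¹ approximation error. -/
theorem integral_sq_average_le [IsProbabilityMeasure P] (hν : ∀ t, Measurable (ν t)) (hind : iIndepFun ν P)
    {μ : Measure (ℕ → V)} [IsProbabilityMeasure μ]
    (hμ : ∀ t, P.map (past ν t) = μ) {F : (ℕ → V) → ℝ} (hF : Measurable F) {C : ℝ}
    (hC : ∀ e, |F e| ≤ C) (h0 : ∫ e, F e ∂μ = 0) (m : ℕ) {T : ℕ} (hT : 1 ≤ T) :
    ∫ ω, (1 / (T : ℝ) * ∑ t ∈ Finset.Icc 1 T, F (past ν t ω)) ^ 2 ∂P ≤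
      C ^ 2 * (2 * m + 1) / T +
        C * ∫ e, |F e - (μ[F | Filtration.piLE (X := fun _ : ℕ => V) m]) e| ∂μ := by
  set δ := ∫ e, |F e - (μ[F | Filtration.piLE (X := fun _ : ℕ => V) m]) e| ∂μ with hδ
  have hδ0 : 0 ≤ δ := integral_nonneg fun e => abs_nonneg _
  have : Nonempty S := nonempty_of_isProbabilityMeasure P
  have hC0 : 0 ≤ C := (abs_nonneg _).trans (hC (past ν 0 (Classical.arbitrary S)))
  have hT0 : (0 : ℝ) < T := by positivity
  have hFm : ∀ t : ℤ, Measurable fun ω => F (past ν t ω) := fun t =>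
    hF.comp (measurable_past hν t)
  have hpt : ∀ s t ω, |F (past ν s ω) * F (past ν t ω)| ≤ C ^ 2 := fun s t ω => by
    rw [abs_mul, sq]
    exact mul_le_mul (hC _) (hC _) (abs_nonneg _) hC0
  have hint : ∀ s t : ℤ, Integrable (fun ω => F (past ν s ω) * F (past ν t ω)) P := fun s t =>
    Integrable.of_bound ((hFm s).mul (hFm t)).aestronglyMeasurable (C ^ 2)
      (ae_of_all _ (hpt s t))
  have hpair : ∀ s t : ℕ, ∫ ω, F (past ν s ω) * F (past ν t ω) ∂P ≤
      C ^ 2 * (if (s : ℤ) ≤ t + m ∧ (t : ℤ) ≤ s + m then (1 : ℝ) else 0) + C * δ := by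
    intro s t
    split_ifs with h
    · have h1 : ∫ ω, F (past ν s ω) * F (past ν t ω) ∂P ≤ ∫ _, C ^ 2 ∂P :=
        integral_mono (hint s t) (integrable_const _) fun ω => (le_abs_self _).trans (hpt s t ω)
      rw [integral_const, probReal_univ, one_smul] at h1
      have := mul_nonneg hC0 hδ0
      linarith
    · rw [mul_zero, zero_add]
      rcases not_and_or.1 h with h | h
      · simp_rw [mul_comm (F (past ν s _))]
        exact (le_abs_self _).trans
          (abs_integral_mul_past_le hν hind hμ hF hC h0 (by omega))
      · exact (le_abs_self _).trans
          (abs_integral_mul_past_le hν hind hμ hF hC h0 (by omega))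
  have hexp : ∫ ω, (1 / (T : ℝ) * ∑ t ∈ Finset.Icc 1 T, F (past ν t ω)) ^ 2 ∂P =
      1 / (T : ℝ) ^ 2 * ∑ s ∈ Finset.Icc 1 T, ∑ t ∈ Finset.Icc 1 T,
        ∫ ω, F (past ν s ω) * F (past ν t ω) ∂P := by
    simp_rw [mul_pow, sq (∑ t ∈ Finset.Icc 1 T, _), Finset.sum_mul_sum]
    rw [integral_const_mul, integral_finsetSum _ fun (s : ℕ) _ =>
      integrable_finsetSum _ fun (t : ℕ) _ => hint s t, div_pow, one_pow]
    congr 1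
    exact Finset.sum_congr rfl fun s _ => integral_finsetSum _ fun (t : ℕ) _ => hint s t
  rw [hexp]
  have hsum : ∑ s ∈ Finset.Icc 1 T, ∑ t ∈ Finset.Icc 1 T,
      ∫ ω, F (past ν s ω) * F (past ν t ω) ∂P ≤
      C ^ 2 * (T * (2 * m + 1)) + T ^ 2 * (C * δ) := by
    calc _ ≤ ∑ s ∈ Finset.Icc 1 T, ∑ t ∈ Finset.Icc 1 T, (C ^ 2 *
          (if (s : ℤ) ≤ t + m ∧ (t : ℤ) ≤ s + m then (1 : ℝ) else 0) + C * δ) :=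
          Finset.sum_le_sum fun s _ => Finset.sum_le_sum fun t _ => hpair s t
      _ = C ^ 2 * (∑ s ∈ Finset.Icc 1 T, ∑ t ∈ Finset.Icc 1 T,
          (if (s : ℤ) ≤ t + m ∧ (t : ℤ) ≤ s + m then (1 : ℝ) else 0)) + T ^ 2 * (C * δ) := by
          simp_rw [Finset.sum_add_distrib, ← Finset.mul_sum, Finset.sum_const, Nat.card_Icc,
            nsmul_eq_mul, Nat.add_sub_cancel]
          ring
      _ ≤ _ := by
          gcongr
          exact sum_sum_ite_abs_sub_le T m
  calc _ ≤ 1 / (T : ℝ) ^ 2 * (C ^ 2 * (T * (2 * m + 1)) + T ^ 2 * (C * δ)) := by gcongr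
    _ = _ := by field_simp

/-- The weak law of large numbers for a bounded function of the history of an i.i.d. sequence. -/
theorem tendsto_measure_average_past [IsProbabilityMeasure P] (hν : ∀ t, Measurable (ν t)) (hind : iIndepFun ν P)
    {μ : Measure (ℕ → V)} [IsProbabilityMeasure μ]
    (hμ : ∀ t, P.map (past ν t) = μ) {F : (ℕ → V) → ℝ} (hF : Measurable F) {C : ℝ}
    (hC : ∀ e, |F e| ≤ C) {ε : ℝ} (hε : 0 < ε) :
    Tendsto (fun T : ℕ => P {ω | ε ≤ |1 / (T : ℝ) * ∑ t ∈ Finset.Icc 1 T, F (past ν t ω) -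
      ∫ e, F e ∂μ|}) atTop (𝓝 0) := by
  set c := ∫ e, F e ∂μ with hc
  have hFi : Integrable F μ := Integrable.of_bound hF.aestronglyMeasurable C (ae_of_all _ hC)
  set F₀ : (ℕ → V) → ℝ := fun e => F e - c with hF₀
  have hF₀m : Measurable F₀ := hF.sub_const c
  have hF₀C : ∀ e, |F₀ e| ≤ C + |c| := fun e =>
    (abs_sub _ _).trans (by linarith [hC e])
  have hF₀0 : ∫ e, F₀ e ∂μ = 0 := by
    rw [hF₀, integral_sub hFi (integrable_const _), integral_const, probReal_univ, one_smul, hc,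
      sub_self]
  have hF₀i : Integrable F₀ μ := hFi.sub (integrable_const _)
  -- Lévy's upward theorem in L¹: a measurable function of the whole history is approximated by
  -- functions of finitely many errors.
  have happrox : Tendsto (fun m : ℕ =>
      ∫ e, |F₀ e - (μ[F₀ | Filtration.piLE (X := fun _ : ℕ => V) m]) e| ∂μ) atTop (𝓝 0) := by
    have h1 := tendsto_eLpNorm_condExp (μ := μ) (ℱ := Filtration.piLE (X := fun _ : ℕ => V)) F₀
    rw [iSup_piLE_nat, condExp_of_stronglyMeasurable le_rfl hF₀m.stronglyMeasurable hF₀i] at h1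
    have h2 := (ENNReal.tendsto_toReal ENNReal.zero_ne_top).comp h1
    refine h2.congr fun m => ?_
    simp only [Function.comp_apply]
    rw [eLpNorm_one_eq_lintegral_enorm, ← integral_norm_eq_lintegral_enorm
      (integrable_condExp.sub hF₀i).aestronglyMeasurable]
    refine integral_congr_ae (ae_of_all _ fun e => ?_)
    simp only [Pi.sub_apply, Real.norm_eq_abs]
    exact abs_sub_comm _ _
  have : Nonempty S := nonempty_of_isProbabilityMeasure P
  set D := C + |c| with hD
  have hD0 : 0 ≤ D := (abs_nonneg _).trans (hF₀C (past ν 0 (Classical.arbitrary S)))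
  have hvar : Tendsto (fun T : ℕ =>
      ∫ ω, (1 / (T : ℝ) * ∑ t ∈ Finset.Icc 1 T, F₀ (past ν t ω)) ^ 2 ∂P) atTop (𝓝 0) := by
    rw [Metric.tendsto_atTop]
    intro κ hκ
    have h1 : Tendsto (fun m : ℕ => D *
        ∫ e, |F₀ e - (μ[F₀ | Filtration.piLE (X := fun _ : ℕ => V) m]) e| ∂μ) atTop (𝓝 0) := by
      simpa using happrox.const_mul D
    -- The memory length m is fixed before T grows, so the term of order m/T vanishes.
    obtain ⟨m, hm⟩ := (h1.eventually_lt_const (half_pos hκ)).exists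
    have h2 : Tendsto (fun T : ℕ => D ^ 2 * (2 * m + 1) / (T : ℝ)) atTop (𝓝 0) :=
      tendsto_const_div_atTop_nhds_zero_nat _
    obtain ⟨N, hN⟩ := eventually_atTop.1 ((h2.eventually_lt_const (half_pos hκ)).and
      (eventually_ge_atTop 1))
    refine ⟨N, fun T hT => ?_⟩
    obtain ⟨h3, h4⟩ := hN T hT
    rw [dist_zero_right, Real.norm_of_nonneg (integral_nonneg fun ω => sq_nonneg _)]
    have := integral_sq_average_le hν hind hμ hF₀m hF₀C hF₀0 m h4
    linarith
  have hmeas : ∀ T : ℕ, Measurable fun ω =>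
      1 / (T : ℝ) * ∑ t ∈ Finset.Icc 1 T, F₀ (past ν t ω) := fun T =>
    (Finset.measurable_fun_sum _ fun (t : ℕ) _ => hF₀m.comp (measurable_past hν t)).const_mul _
  have hbound : ∀ᶠ T : ℕ in atTop, P {ω | ε ≤ |1 / (T : ℝ) *
      ∑ t ∈ Finset.Icc 1 T, F (past ν t ω) - c|} ≤ ENNReal.ofReal
      ((∫ ω, (1 / (T : ℝ) * ∑ t ∈ Finset.Icc 1 T, F₀ (past ν t ω)) ^ 2 ∂P) / ε ^ 2) := by
    filter_upwards [eventually_ge_atTop 1] with T hT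
    have hT0 : (T : ℝ) ≠ 0 := by positivity
    have heq : ∀ ω, 1 / (T : ℝ) * ∑ t ∈ Finset.Icc 1 T, F (past ν t ω) - c =
        1 / (T : ℝ) * ∑ t ∈ Finset.Icc 1 T, F₀ (past ν t ω) := fun ω => by
      simp only [hF₀, Finset.sum_sub_distrib, Finset.sum_const, Nat.card_Icc, nsmul_eq_mul,
        Nat.add_sub_cancel]
      field_simp
    simp_rw [heq]
    have hbd : ∀ ω, |1 / (T : ℝ) * ∑ t ∈ Finset.Icc 1 T, F₀ (past ν t ω)| ≤ D := fun ω => by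
      rw [abs_mul, abs_of_nonneg (by positivity), one_div, inv_mul_le_iff₀ (by positivity)]
      refine (Finset.abs_sum_le_sum_abs _ _).trans ((Finset.sum_le_sum fun (t : ℕ) _ =>
        hF₀C (past ν t ω)).trans_eq ?_)
      rw [Finset.sum_const, Nat.card_Icc, nsmul_eq_mul, Nat.add_sub_cancel]
    have hint : Integrable (fun ω =>
        (1 / (T : ℝ) * ∑ t ∈ Finset.Icc 1 T, F₀ (past ν t ω)) ^ 2) P :=
      Integrable.of_bound ((hmeas T).pow_const 2).aestronglyMeasurable (D ^ 2)
        (ae_of_all _ fun ω => by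
          rw [norm_pow, Real.norm_eq_abs]
          exact pow_le_pow_left₀ (abs_nonneg _) (hbd ω) 2)
    have hmarkov := mul_meas_ge_le_integral_of_nonneg
      (ae_of_all P fun ω => sq_nonneg (1 / (T : ℝ) * ∑ t ∈ Finset.Icc 1 T, F₀ (past ν t ω)))
      hint (ε ^ 2)
    have hset : {ω | ε ≤ |1 / (T : ℝ) * ∑ t ∈ Finset.Icc 1 T, F₀ (past ν t ω)|} =
        {ω | ε ^ 2 ≤ (1 / (T : ℝ) * ∑ t ∈ Finset.Icc 1 T, F₀ (past ν t ω)) ^ 2} := by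
      ext ω
      rw [mem_ofPred_eq, mem_ofPred_eq, sq_le_sq, abs_of_pos hε]
    rw [hset, ← ofReal_measureReal]
    refine ENNReal.ofReal_le_ofReal ?_
    rw [le_div_iff₀ (by positivity), mul_comm]
    exact hmarkov
  have hlim : Tendsto (fun T : ℕ => ENNReal.ofReal
      ((∫ ω, (1 / (T : ℝ) * ∑ t ∈ Finset.Icc 1 T, F₀ (past ν t ω)) ^ 2 ∂P) / ε ^ 2)) atTop
      (𝓝 0) := by
    have := ENNReal.tendsto_ofReal (hvar.div_const (ε ^ 2))
    simpa using this
  exact tendsto_of_tendsto_of_tendsto_of_le_of_le' tendsto_const_nhds hlim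
    (Eventually.of_forall fun _ => zero_le) hbound

end History

/-! ### From a pointwise law of large numbers to one uniform over a compact parameter space. -/

section UniformLaw

variable {S E Q : Type*} [MeasurableSpace S] {P : Measure S} [MeasurableSpace E] {μ : Measure E}
  [IsProbabilityMeasure μ] [PseudoMetricSpace Q] {Φ : E → Q → ℝ} {C : ℝ}

/-- A bounded family of functions that depends continuously on a parameter has locally a small
measurable modulus of continuity in mean. -/
theorem exists_measurable_modulus [SecondCountableTopology Q] (hcont : ∀ e, Continuous (Φ e))
    (hmeas : ∀ q, Measurable fun e => Φ e q) (hC : ∀ e q, |Φ e q| ≤ C) (q : Q) {ε : ℝ}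
    (hε : 0 < ε) : ∃ (δ : ℝ) (W : E → ℝ), 0 < δ ∧ Measurable W ∧ (∀ e, |W e| ≤ 2 * C) ∧
      ∫ e, W e ∂μ < ε ∧ ∀ q' ∈ Metric.ball q δ, ∀ e, |Φ e q' - Φ e q| ≤ W e := by
  obtain ⟨D, hDc, hDd⟩ := TopologicalSpace.exists_countable_dense Q
  -- The supremum over a countable dense set is measurable, unlike in general the one over the ball.
  -- Continuity in the parameter later extends the bound to the whole ball.
  set w : ℕ → E → ℝ≥0∞ := fun n e =>
    ⨆ q' ∈ D ∩ Metric.ball q (1 / ((n : ℝ) + 1)), ENNReal.ofReal |Φ e q' - Φ e q| with hw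
  have hwm : ∀ n, Measurable (w n) := fun n =>
    Measurable.biSup _ (hDc.mono inter_subset_left) fun q' _ =>
      ((hmeas q').sub (hmeas q)).abs.ennreal_ofReal
  have hdiff : ∀ e q', |Φ e q' - Φ e q| ≤ 2 * C := fun e q' =>
    (abs_sub _ _).trans (by linarith [hC e q', hC e q])
  have hwC : ∀ n e, w n e ≤ ENNReal.ofReal (2 * C) := fun n e =>
    iSup₂_le fun q' _ => ENNReal.ofReal_le_ofReal (hdiff e q')
  have hwlim : ∀ e, Tendsto (fun n => w n e) atTop (𝓝 0) := fun e => by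
    rw [ENNReal.tendsto_atTop_zero]
    intro κ hκ
    rcases eq_or_ne κ ⊤ with rfl | hκt
    · exact ⟨0, fun _ _ => le_top⟩
    obtain ⟨δ, hδ, hball⟩ := Metric.continuousAt_iff.1 (hcont e).continuousAt κ.toReal
      (ENNReal.toReal_pos hκ.ne' hκt)
    obtain ⟨N, hN⟩ := exists_nat_one_div_lt hδ
    refine ⟨N, fun n hn => iSup₂_le fun q' hq' => ?_⟩
    have h1 : dist q' q < δ := hq'.2.trans ((Nat.one_div_le_one_div hn).trans_lt hN)
    exact ENNReal.ofReal_le_of_le_toReal (hball h1).le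
  have hlim : Tendsto (fun n => ∫⁻ e, w n e ∂μ) atTop (𝓝 0) := by
    have := tendsto_lintegral_of_dominated_convergence (μ := μ) (f := fun _ => 0)
      (fun _ => ENNReal.ofReal (2 * C)) hwm (fun n => ae_of_all _ (hwC n))
      (by rw [lintegral_const, measure_univ, mul_one]; exact ENNReal.ofReal_ne_top)
      (ae_of_all _ hwlim)
    simpa using this
  obtain ⟨n, hn⟩ := (hlim.eventually_lt_const (ENNReal.ofReal_pos.2 hε)).exists
  have hwtop : ∀ e, w n e ≠ ⊤ := fun e => ((hwC n e).trans_lt ENNReal.ofReal_lt_top).ne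
  refine ⟨1 / ((n : ℝ) + 1), fun e => (w n e).toReal, by positivity, (hwm n).ennreal_toReal,
    fun e => ?_, ?_, fun q' hq' e => ?_⟩
  · rw [abs_of_nonneg ENNReal.toReal_nonneg]
    exact ENNReal.toReal_le_of_le_ofReal ((abs_nonneg _).trans (hdiff e q)) (hwC n e)
  · rw [integral_toReal (hwm n).aemeasurable (ae_of_all _ fun e => (hwtop e).lt_top)]
    exact (ENNReal.lt_ofReal_iff_toReal_lt hn.ne_top).1 hn
  · have hclosed : IsClosed {p : Q | |Φ e p - Φ e q| ≤ (w n e).toReal} :=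
      isClosed_le ((hcont e).sub continuous_const).abs continuous_const
    have hsub : Metric.ball q (1 / ((n : ℝ) + 1)) ∩ D ⊆
        {p : Q | |Φ e p - Φ e q| ≤ (w n e).toReal} := fun p hp => by
      refine (ENNReal.ofReal_le_iff_le_toReal (hwtop e)).1 ?_
      exact le_iSup₂_of_le (f := fun q' (_ : q' ∈ D ∩ Metric.ball q (1 / ((n : ℝ) + 1))) =>
        ENNReal.ofReal |Φ e q' - Φ e q|) p ⟨hp.2, hp.1⟩ le_rfl
    exact closure_minimal hsub hclosed
      (hDd.open_subset_closure_inter Metric.isOpen_ball hq')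

theorem abs_average_sub_average_le {a b c : ℕ → ℝ} (h : ∀ t, |a t - b t| ≤ c t) (T : ℕ) :
    |1 / (T : ℝ) * ∑ t ∈ Finset.Icc 1 T, a t - 1 / (T : ℝ) * ∑ t ∈ Finset.Icc 1 T, b t| ≤
      1 / (T : ℝ) * ∑ t ∈ Finset.Icc 1 T, c t := by
  rw [← mul_sub, ← Finset.sum_sub_distrib, abs_mul, abs_of_nonneg (by positivity)]
  gcongr
  exact (Finset.abs_sum_le_sum_abs _ _).trans (Finset.sum_le_sum fun t _ => h t)

theorem tendsto_measure_zero_of_subset {ι : Type*} {l : Filter ι} {A : ι → Set S}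
    {B : ι → Set S} (hB : Tendsto (fun i => P (B i)) l (𝓝 0)) (h : ∀ᶠ i in l, A i ⊆ B i) :
    Tendsto (fun i => P (A i)) l (𝓝 0) :=
  tendsto_of_tendsto_of_tendsto_of_le_of_le' tendsto_const_nhds hB
    (Eventually.of_forall fun _ => zero_le) (h.mono fun _ hi => measure_mono hi)

theorem tendsto_measure_union_zero {ι : Type*} {l : Filter ι} {A B : ι → Set S}
    (hA : Tendsto (fun i => P (A i)) l (𝓝 0)) (hB : Tendsto (fun i => P (B i)) l (𝓝 0)) :
    Tendsto (fun i => P (A i ∪ B i)) l (𝓝 0) := by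
  have h := hA.add hB
  rw [add_zero] at h
  exact tendsto_of_tendsto_of_tendsto_of_le_of_le tendsto_const_nhds h (fun _ => zero_le)
    fun i => measure_union_le _ _

theorem tendsto_measure_biUnion_finset_zero {ι κ : Type*} {l : Filter ι} (F : Finset κ)
    {A : κ → ι → Set S} (hA : ∀ k ∈ F, Tendsto (fun i => P (A k i)) l (𝓝 0)) :
    Tendsto (fun i => P (⋃ k ∈ F, A k i)) l (𝓝 0) := by
  have h := tendsto_finsetSum F hA
  rw [Finset.sum_const_zero] at h
  exact tendsto_of_tendsto_of_tendsto_of_le_of_le tendsto_const_nhds h (fun _ => zero_le)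
    fun i => measure_biUnion_finset_le _ _

/-- A weak law of large numbers is uniform over a bounded family of functions that depends
continuously on a parameter in a compact space. -/
theorem tendsto_measure_exists_average [CompactSpace Q] {x : ℕ → S → E}
    (hlln : ∀ F : E → ℝ, Measurable F → ∀ B : ℝ, (∀ e, |F e| ≤ B) → ∀ ε : ℝ, 0 < ε →
      Tendsto (fun T : ℕ => P {ω | ε ≤ |1 / (T : ℝ) * ∑ t ∈ Finset.Icc 1 T, F (x t ω) -
        ∫ e, F e ∂μ|}) atTop (𝓝 0))
    (hcont : ∀ e, Continuous (Φ e)) (hmeas : ∀ q, Measurable fun e => Φ e q)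
    (hC : ∀ e q, |Φ e q| ≤ C) {ε : ℝ} (hε : 0 < ε) :
    Tendsto (fun T : ℕ => P {ω | ∃ q, ε ≤ |1 / (T : ℝ) * ∑ t ∈ Finset.Icc 1 T, Φ (x t ω) q -
      ∫ e, Φ e q ∂μ|}) atTop (𝓝 0) := by
  -- At the centre of a covering ball the average deviates by less than ε/4, the average of the
  -- modulus is below ε/4 + ε/4, and the two means differ by less than ε/4.
  have hε4 : 0 < ε / 4 := by positivity
  choose δ W hδ hWm hWC hWε hW using fun q =>
    exists_measurable_modulus (μ := μ) hcont hmeas hC q hε4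
  obtain ⟨F, -, hF⟩ := isCompact_univ.elim_nhds_subcover (fun q : Q => Metric.ball q (δ q))
    fun q _ => Metric.ball_mem_nhds q (hδ q)
  have h1 := tendsto_measure_biUnion_finset_zero (P := P) F fun q _ =>
    tendsto_measure_union_zero (hlln (W q) (hWm q) _ (hWC q) _ hε4)
      (hlln (fun e => Φ e q) (hmeas q) _ (fun e => hC e q) _ hε4)
  refine tendsto_measure_zero_of_subset h1 (Eventually.of_forall fun T ω => ?_)
  rintro ⟨q', hq'⟩
  obtain ⟨q, hqF, hq⟩ := mem_iUnion₂.1 (hF (mem_univ q'))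
  refine mem_iUnion₂.2 ⟨q, hqF, ?_⟩
  by_contra hcon
  simp only [mem_union, mem_ofPred_eq, not_or, not_le] at hcon
  obtain ⟨hc1, hc2⟩ := hcon
  have hi : ∀ p, Integrable (fun e => Φ e p) μ := fun p =>
    Integrable.of_bound (hmeas p).aestronglyMeasurable C (ae_of_all _ fun e => hC e p)
  have hWi : Integrable (W q) μ :=
    Integrable.of_bound (hWm q).aestronglyMeasurable _ (ae_of_all _ (hWC q))
  have h2 := abs_average_sub_average_le (fun t => hW q q' hq (x t ω)) T
  have h3 : |∫ e, Φ e q' ∂μ - ∫ e, Φ e q ∂μ| ≤ ∫ e, W q e ∂μ := by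
    rw [← integral_sub (hi q') (hi q)]
    exact abs_integral_le_integral_abs.trans
      (integral_mono ((hi q').sub (hi q)).abs hWi fun e => hW q q' hq e)
  have h4 := hWε q
  rw [abs_lt] at hc1 hc2
  rw [abs_le] at h2 h3
  rcases le_abs.1 hq' with h | h <;> linarith [hc1.1, hc1.2, hc2.1, hc2.2, h2.1, h2.2, h3.1, h3.2]

end UniformLaw

/-! ### Deterministic facts on minimizers, inverses and weighted norms over compact sets. -/

section Extremum

/-- A continuous function that is positive on a closed part of a compact set is bounded away from
zero there. -/
theorem exists_pos_le_of_isCompact {α : Type*} [TopologicalSpace α] [T2Space α] {A : Set α}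
    (hA : IsCompact A) {f g : α → ℝ} (hf : ContinuousOn f A) (hg : ContinuousOn g A) {ε : ℝ}
    (hpos : ∀ a ∈ A, ε ≤ g a → 0 < f a) : ∃ η : ℝ, 0 < η ∧ ∀ a ∈ A, ε ≤ g a → η ≤ f a := by
  have hc : IsCompact (A ∩ g ⁻¹' Ici ε) :=
    hA.of_isClosed_subset (hg.preimage_isClosed_of_isClosed hA.isClosed isClosed_Ici)
      inter_subset_left
  rcases (A ∩ g ⁻¹' Ici ε).eq_empty_or_nonempty with h | h
  · exact ⟨1, one_pos, fun a ha hga => absurd (show a ∈ A ∩ g ⁻¹' Ici ε from ⟨ha, hga⟩)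
      (by rw [h]; exact notMem_empty a)⟩
  · obtain ⟨a, ha, hmin⟩ := hc.exists_isMinOn h (hf.mono inter_subset_left)
    exact ⟨f a, hpos a ha.1 ha.2, fun b hb hgb => hmin ⟨hb, hgb⟩⟩

/-- The inverse of a continuous injective function on a compact set is uniformly continuous. -/
theorem exists_norm_sub_lt_of_injOn {E F : Type*} [NormedAddCommGroup E] [NormedAddCommGroup F]
    {Θ : Set E} (hΘ : IsCompact Θ) {β : E → F} (hβ : ContinuousOn β Θ) (hinj : InjOn β Θ) {ε : ℝ}
    (hε : 0 < ε) : ∃ η : ℝ, 0 < η ∧ ∀ a ∈ Θ, ∀ b ∈ Θ, ‖β a - β b‖ < η → ‖a - b‖ < ε := by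
  obtain ⟨η, hη, h⟩ := exists_pos_le_of_isCompact (hΘ.prod hΘ)
    (f := fun p : E × E => ‖β p.1 - β p.2‖) (g := fun p => ‖p.1 - p.2‖) (ε := ε)
    ((hβ.comp continuousOn_fst fun p hp => hp.1).sub
      (hβ.comp continuousOn_snd fun p hp => hp.2)).norm
    (by fun_prop) fun p hp hle => by
      rw [norm_pos_iff, sub_ne_zero]
      intro heq
      rw [hinj hp.1 hp.2 heq, sub_self, norm_zero] at hle
      linarith
  refine ⟨η, hη, fun a ha b hb hab => ?_⟩
  by_contra hcon
  exact not_le.2 hab (h (a, b) ⟨ha, hb⟩ (not_lt.1 hcon))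

/-- Unique minimizers that depend continuously on a parameter in a compact set are uniformly well
separated. -/
theorem exists_add_le_of_isUniqueArgmin {E F : Type*} [NormedAddCommGroup E]
    [NormedAddCommGroup F] {Θ : Set E} {Γ : Set F} (hΘ : IsCompact Θ) (hΓ : IsCompact Γ)
    {D : E → F → ℝ} (hD : ContinuousOn (fun p : E × F => D p.1 p.2) (Θ ×ˢ Γ)) {β : E → F}
    (hβ : ContinuousOn β Θ) (hmin : ∀ θ ∈ Θ, IsUniqueArgmin (D θ) Γ (β θ)) {ε : ℝ} (hε : 0 < ε) :
    ∃ η : ℝ, 0 < η ∧ ∀ θ ∈ Θ, ∀ ρ ∈ Γ, ε ≤ ‖ρ - β θ‖ → D θ (β θ) + η ≤ D θ ρ := by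
  have hβ' : ContinuousOn (fun p : E × F => β p.1) (Θ ×ˢ Γ) :=
    hβ.comp continuousOn_fst fun p hp => hp.1
  obtain ⟨η, hη, h⟩ := exists_pos_le_of_isCompact (hΘ.prod hΓ)
    (f := fun p : E × F => D p.1 p.2 - D p.1 (β p.1)) (g := fun p => ‖p.2 - β p.1‖) (ε := ε)
    (hD.sub (hD.comp (continuousOn_fst.prodMk hβ') fun p hp => ⟨hp.1, (hmin p.1 hp.1).1⟩))
    (continuousOn_snd.sub hβ').norm fun p hp hle => by
      refine sub_pos.2 ((hmin p.1 hp.1).2 p.2 hp.2 fun heq => ?_)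
      rw [heq, sub_self, norm_zero] at hle
      linarith
  exact ⟨η, hη, fun θ hθ ρ hρ hle => by linarith [h (θ, ρ) ⟨hθ, hρ⟩ hle]⟩

/-- A minimizer of a criterion that is uniformly close to a multiple of a function with a well
separated minimizer `b` is close to `b`. -/
theorem norm_sub_lt_of_isMinOn {F : Type*} [NormedAddCommGroup F] {Γ : Set F} {m D : F → ℝ}
    {w w₀ η e ε : ℝ} {b r : F} (hw : w₀ ≤ w) (hη : 0 ≤ η) (he : 2 * e < w₀ * η)
    (hclose : ∀ ρ ∈ Γ, |m ρ - w * D ρ| ≤ e) (hb : b ∈ Γ) (hr : r ∈ Γ) (hmin : m r ≤ m b)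
    (hw₀ : 0 < w₀) (hsep : ∀ ρ ∈ Γ, ε ≤ ‖ρ - b‖ → D b + η ≤ D ρ) : ‖r - b‖ < ε := by
  by_contra hcon
  have h1 := mul_le_mul_of_nonneg_left (hsep r hr (not_lt.1 hcon)) (hw₀.le.trans hw)
  have h2 := (abs_le.1 (hclose r hr)).1
  have h3 := (abs_le.1 (hclose b hb)).2
  have h4 := mul_le_mul_of_nonneg_right hw hη
  linarith

theorem weightedSq_smul {n : ℕ} (W : Matrix (Fin n) (Fin n) ℝ) (c : ℝ) (x : Vec n) :
    weightedSq W (c • x) = c ^ 2 * weightedSq W x := by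
  simp only [weightedSq, PiLp.smul_apply, smul_eq_mul, Finset.mul_sum]
  exact Finset.sum_congr rfl fun i _ => Finset.sum_congr rfl fun j _ => by ring

theorem continuous_weightedSq {n : ℕ} (W : Matrix (Fin n) (Fin n) ℝ) :
    Continuous (weightedSq W) := by
  unfold weightedSq
  fun_prop

theorem weightedSq_pos {n : ℕ} {W : Matrix (Fin n) (Fin n) ℝ} (hW : W.PosDef) {x : Vec n}
    (hx : x ≠ 0) : 0 < weightedSq W x := by
  have h := hW.dotProduct_mulVec_pos (x := x.ofLp) (by simpa using hx)
  simpa [weightedSq, dotProduct, Matrix.mulVec, Finset.mul_sum, mul_assoc] using h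

/-- The weighted norm of a positive definite matrix is equivalent to the Euclidean norm. -/
theorem exists_weightedSq_bounds {n : ℕ} {W : Matrix (Fin n) (Fin n) ℝ} (hW : W.PosDef) :
    ∃ a b : ℝ, 0 < a ∧ 0 < b ∧ ∀ x : Vec n,
      a * ‖x‖ ^ 2 ≤ weightedSq W x ∧ weightedSq W x ≤ b * ‖x‖ ^ 2 := by
  have hc : IsCompact (Metric.sphere (0 : Vec n) 1) := isCompact_sphere 0 1
  obtain ⟨a, ha, hle⟩ := exists_pos_le_of_isCompact hc (f := weightedSq W) (g := fun _ => 0)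
    (ε := 0) (continuous_weightedSq W).continuousOn continuousOn_const fun x hx _ =>
      weightedSq_pos hW fun h => by simp [h] at hx
  obtain ⟨b, hb⟩ := hc.exists_bound_of_continuousOn (continuous_weightedSq W).continuousOn
  refine ⟨a, max b 1, ha, by positivity, fun x => ?_⟩
  rcases eq_or_ne x 0 with rfl | hx
  · simp [weightedSq]
  have hx0 : 0 < ‖x‖ := norm_pos_iff.2 hx
  have hmem : ‖x‖⁻¹ • x ∈ Metric.sphere (0 : Vec n) 1 := by
    rw [mem_sphere_zero_iff_norm, norm_smul, norm_inv, norm_norm, inv_mul_cancel₀ hx0.ne']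
  have heq : weightedSq W x = ‖x‖ ^ 2 * weightedSq W (‖x‖⁻¹ • x) := by
    rw [weightedSq_smul]
    field_simp
  have h1 := hle _ hmem le_rfl
  have h2 := ((le_abs_self _).trans (hb _ hmem)).trans (le_max_left b 1)
  rw [heq, mul_comm a, mul_comm (max b 1)]
  exact ⟨by gcongr, by gcongr⟩

end Extremum

/-! ### Uniform convergence of kernel averages over a mixing row. -/

section KernelAverage

variable {S V : Type*} [MeasurableSpace S] [MeasurableSpace V] {P : Measure S}
  {X : ℕ → ℕ → S → V} {m : ℕ → ℕ} {K : ℝ → ℝ} {h : ℕ → ℝ}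

theorem phiMixing_le_of_rate {T m : ℕ} (hT : 1 ≤ T) (hm : 1 ≤ m) {c : ℝ≥0}
    (hφ : (T : ℝ≥0∞) * phiMixing P X m / (m : ℝ≥0∞) ≤ c) :
    phiMixing P X m ≤ ((c * m / T : ℝ≥0) : ℝ≥0∞) := by
  have hT0 : (T : ℝ≥0) ≠ 0 := by positivity
  have hm0 : (m : ℝ≥0∞) ≠ 0 := by
    rw [Nat.cast_ne_zero]; omega
  rw [ENNReal.div_le_iff hm0 (ENNReal.natCast_ne_top m)] at hφ
  rw [ENNReal.coe_div hT0, ENNReal.coe_mul, ENNReal.coe_natCast, ENNReal.coe_natCast,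
    ENNReal.le_div_iff_mul_le (Or.inl (by rw [Nat.cast_ne_zero]; omega))
      (Or.inl (ENNReal.natCast_ne_top T)), mul_comm]
  exact hφ

variable [IsProbabilityMeasure P]

/-- Kernel averages of bounded functions of a `φ`-mixing row, at a fixed point. -/
theorem measure_le_abs_kernel_average_le {T m : ℕ} (hT : 1 ≤ T) (hm : 1 ≤ m) (hmT : m ≤ T)
    (hX : ∀ t, Measurable (X T t)) {c : ℝ≥0}
    (hφ : (T : ℝ≥0∞) * phiMixing P X m / (m : ℝ≥0∞) ≤ c) (hK0 : ∀ x, 0 ≤ K x) {Kb : ℝ}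
    (hKb : ∀ x, K x ≤ Kb) {h : ℝ} (hh : 0 < h) {u A : ℝ}
    (hA : ∑ t ∈ Finset.Icc 1 T, kernelWeight K h T u t ≤ A) {H : V → ℝ} (hH : Measurable H)
    {C : ℝ} (hHC : ∀ v, |H v| ≤ C) (hC : 0 ≤ C) {ε τ : ℝ} (hτ : 0 ≤ τ)
    (hτ1 : τ * (2 * C * Kb) ≤ 1) (hτ2 : τ * (2 * C * Kb * (2 * C * A)) ≤ ε / 4) :
    P {ω | ε ≤ |∑ t ∈ Finset.Icc 1 T, kernelWeight K h T u t *
      (H (X T t ω) - ∫ ω', H (X T t ω') ∂P)|} ≤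
      4 * ENNReal.ofReal (Real.exp (-(τ * ε / 4 * (T * h / m)) + 6 * c)) := by
  have hT0 : (0 : ℝ) < T := by positivity
  have hm0 : (0 : ℝ) < m := by positivity
  have hKb0 : 0 ≤ Kb := (hK0 0).trans (hKb 0)
  have hw0 := fun t => kernelWeight_nonneg hK0 hh T u t
  have hHi : ∀ t, Integrable (fun ω => H (X T t ω)) P := fun t =>
    Integrable.of_bound (hH.comp (hX t)).aestronglyMeasurable C (ae_of_all _ fun ω => hHC _)
  have hE : ∀ t, |∫ ω', H (X T t ω') ∂P| ≤ C := fun t => by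
    have := norm_integral_le_of_norm_le_const (μ := P) (f := fun ω => H (X T t ω)) (C := C)
      (ae_of_all _ fun ω => hHC _)
    rwa [probReal_univ, mul_one] at this
  have hcen : ∀ t ω, |H (X T t ω) - ∫ ω', H (X T t ω') ∂P| ≤ 2 * C := fun t ω =>
    (abs_sub _ _).trans (by linarith [hHC (X T t ω), hE t])
  have hmain := measure_le_abs_sum_Icc_le (P := P) hm hX (phiMixing_le_of_rate hT hm hφ)
    (ξ := fun t ω => kernelWeight K h T u t * (H (X T t ω) - ∫ ω', H (X T t ω') ∂P))
    (fun t _ => ((hH.comp (comap_measurable (X T t))).sub_const _).const_mul _)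
    (fun t _ => by
      rw [integral_const_mul, integral_sub (hHi t) (integrable_const _), integral_const,
        probReal_univ, one_smul, sub_self, mul_zero])
    (c := fun t => kernelWeight K h T u t * (2 * C))
    (fun t _ ω => by
      rw [abs_mul, abs_of_nonneg (hw0 t)]
      exact mul_le_mul_of_nonneg_left (hcen t ω) (hw0 t))
    (κ := 1 / (T * h) * Kb * (2 * C)) (A := A * (2 * C))
    (fun t _ => mul_le_mul_of_nonneg_right (kernelWeight_le hKb hh T u t) (by positivity))
    (by positivity) (by rw [← Finset.sum_mul]; gcongr) (l := τ * (T * h / m)) (by positivity)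
    (by
      refine le_of_eq_of_le ?_ hτ1
      field_simp) ε
  refine hmain.trans (mul_le_mul' le_rfl (ENNReal.ofReal_le_ofReal (Real.exp_le_exp.2 ?_)))
  -- The exponent l = τTh/m has the largest order allowed by the bound Kb · 2C/(Th) on a single
  -- term. The choice of τ makes the quadratic term at most half of the linear one, which leaves
  -- -lε/4.
  have h1 : (τ * (T * h / m)) ^ 2 * (m * (1 / (T * h) * Kb * (2 * C)) * (A * (2 * C))) =
      τ * (T * h / m) * (τ * (2 * C * Kb * (2 * C * A))) := by
    field_simp
  have h2 : τ * (T * h / m) * (τ * (2 * C * Kb * (2 * C * A))) ≤ τ * (T * h / m) * (ε / 4) :=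
    mul_le_mul_of_nonneg_left hτ2 (by positivity)
  -- There are about T/m blocks and each costs a mixing error of at most c m/T, so the total stays
  -- bounded.
  have h3 : ((T / m + 1 : ℕ) : ℝ) * ((c * m / T : ℝ≥0) : ℝ) ≤ 2 * c := by
    have h4 : ((T / m : ℕ) : ℝ) ≤ T / m := Nat.cast_div_le
    have h5 : (m : ℝ) ≤ T := by exact_mod_cast hmT
    push_cast
    calc (((T / m : ℕ) : ℝ) + 1) * (c * m / T) ≤ ((T : ℝ) / m + 1) * (c * m / T) := by gcongr
      _ = c + c * (m / T) := by field_simp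
      _ ≤ c + c * 1 := by
        gcongr
        exact (div_le_one hT0).2 h5
      _ = 2 * c := by ring
  rw [h1, mul_assoc 3]
  linarith

theorem exists_grid_abs_sub_le {T : ℕ} (hT : 1 ≤ T) {u : ℝ} (hu : u ∈ Icc (0 : ℝ) 1) :
    ∃ i ∈ Finset.range (T ^ 3 + 1), |u - (i : ℝ) / (T : ℝ) ^ 3| ≤ 1 / (T : ℝ) ^ 3 := by
  have hT0 : (0 : ℝ) < (T : ℝ) ^ 3 := by positivity
  have h0 : 0 ≤ u * (T : ℝ) ^ 3 := mul_nonneg hu.1 hT0.le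
  refine ⟨⌊u * (T : ℝ) ^ 3⌋₊, ?_, ?_⟩
  · rw [Finset.mem_range, Nat.lt_succ_iff]
    refine Nat.floor_le_of_le ?_
    push_cast
    exact mul_le_of_le_one_left hT0.le hu.2
  · have h1 := Nat.floor_le h0
    have h2 := Nat.lt_floor_add_one (u * (T : ℝ) ^ 3)
    have h3 : u - (⌊u * (T : ℝ) ^ 3⌋₊ : ℝ) / (T : ℝ) ^ 3 =
        (u * (T : ℝ) ^ 3 - ⌊u * (T : ℝ) ^ 3⌋₊) / (T : ℝ) ^ 3 := by field_simp
    rw [h3, abs_of_nonneg (div_nonneg (by linarith) hT0.le)]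
    gcongr
    linarith

/-- Kernel averages of bounded functions of the rows of a `φ`-mixing array converge uniformly
over the points at which they are taken. -/
theorem tendsto_measure_exists_kernel_average (hX : ∀ T t, Measurable (X T t))
    (hm : ∀ T, 1 ≤ T → 1 ≤ m T ∧ m T ≤ T) {c : ℝ≥0}
    (hφ : ∀ T : ℕ, 1 ≤ T → (T : ℝ≥0∞) * phiMixing P X (m T) / (m T : ℝ≥0∞) ≤ c)
    (hK0 : ∀ x, 0 ≤ K x) {Kb : ℝ} (hKb : ∀ x, K x ≤ Kb) {Kl : ℝ}
    (hKl : ∀ x x', |K x - K x'| ≤ Kl * |x - x'|) (hh : ∀ T, 0 < h T) {A : ℝ}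
    (hA : ∀ᶠ T : ℕ in atTop, ∀ u, ∑ t ∈ Finset.Icc 1 T, kernelWeight K (h T) T u t ≤ A)
    (hTh : Tendsto (fun T : ℕ => T * h T) atTop atTop)
    (hrate : Tendsto (fun T : ℕ => T * h T / (m T * Real.log T)) atTop atTop) {H : V → ℝ}
    (hH : Measurable H) {C : ℝ} (hHC : ∀ v, |H v| ≤ C) (hC : 0 ≤ C) {ε : ℝ} (hε : 0 < ε) :
    Tendsto (fun T : ℕ => P {ω | ∃ u ∈ Icc (0 : ℝ) 1, ε ≤ |∑ t ∈ Finset.Icc 1 T,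
      kernelWeight K (h T) T u t * (H (X T t ω) - ∫ ω', H (X T t ω') ∂P)|}) atTop (𝓝 0) := by
  have hKb0 : 0 ≤ Kb := (hK0 0).trans (hKb 0)
  have hKl0 : 0 ≤ Kl := by simpa using (abs_nonneg _).trans (hKl 1 0)
  have hA0 : 0 ≤ A := by
    obtain ⟨T, hT⟩ := hA.exists
    exact (Finset.sum_nonneg fun t _ => kernelWeight_nonneg hK0 (hh T) T 0 t).trans (hT 0)
  set ε' := ε / 2 with hε'
  have hε'0 : 0 < ε' := half_pos hε
  obtain ⟨τ, hτ, hτ1, hτ2⟩ : ∃ τ : ℝ, 0 < τ ∧ τ * (2 * C * Kb) ≤ 1 ∧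
      τ * (2 * C * Kb * (2 * C * A)) ≤ ε' / 4 := by
    set a := 2 * C * Kb
    set b := 2 * C * Kb * (2 * C * A)
    have ha : 0 ≤ a := by positivity
    have hb : 0 ≤ b := by positivity
    refine ⟨min (1 / (a + 1)) (ε' / 4 / (b + 1)), by positivity, ?_, ?_⟩
    · calc _ ≤ 1 / (a + 1) * (a + 1) := by
            gcongr
            · exact min_le_left _ _
            · linarith
        _ = 1 := by field_simp
    · calc _ ≤ ε' / 4 / (b + 1) * (b + 1) := by
            gcongr
            · exact min_le_right _ _
            · linarith
        _ = ε' / 4 := by field_simp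
  set b := τ * ε' / 4 with hb
  have hb0 : 0 < b := by positivity
  have hlim : Tendsto (fun T : ℕ => ENNReal.ofReal (8 * Real.exp (6 * c) / (T : ℝ))) atTop
      (𝓝 0) := by
    have := ENNReal.tendsto_ofReal (tendsto_const_div_atTop_nhds_zero_nat (8 * Real.exp (6 * c)))
    simpa using this
  have hsmall : ∀ᶠ T : ℕ in atTop, 2 * C * Kl / (T : ℝ) < ε' :=
    (tendsto_const_div_atTop_nhds_zero_nat _).eventually_lt_const hε'0
  refine tendsto_of_tendsto_of_tendsto_of_le_of_le' tendsto_const_nhds hlim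
    (Eventually.of_forall fun _ => zero_le) ?_
  filter_upwards [hA, hsmall, hTh.eventually_ge_atTop 1, hrate.eventually_ge_atTop (4 / b),
    eventually_ge_atTop 2] with T hAT hsmallT hThT hrateT hT2
  have hT1 : 1 ≤ T := by omega
  have hT0 : (0 : ℝ) < T := by positivity
  have hT1' : (1 : ℝ) ≤ T := by exact_mod_cast hT1
  obtain ⟨hm1, hmT⟩ := hm T hT1
  have hm0 : (0 : ℝ) < m T := by positivity
  have hlog : 0 < Real.log T := Real.log_pos (by exact_mod_cast hT2)
  -- Each grid point then has probability of order T⁻⁴, which beats the T³ + 1 points of the grid.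
  have hexp : 4 * Real.log T ≤ b * (T * h T / m T) := by
    rw [div_le_div_iff₀ hb0 (by positivity)] at hrateT
    rw [← mul_div_assoc, le_div_iff₀ hm0]
    linarith
  have hsub : {ω | ∃ u ∈ Icc (0 : ℝ) 1, ε ≤ |∑ t ∈ Finset.Icc 1 T,
      kernelWeight K (h T) T u t * (H (X T t ω) - ∫ ω', H (X T t ω') ∂P)|} ⊆
      ⋃ i ∈ Finset.range (T ^ 3 + 1), {ω | ε' ≤ |∑ t ∈ Finset.Icc 1 T,
        kernelWeight K (h T) T ((i : ℝ) / (T : ℝ) ^ 3) t *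
          (H (X T t ω) - ∫ ω', H (X T t ω') ∂P)|} := by
    rintro ω ⟨u, hu, hεu⟩
    obtain ⟨i, hi, hui⟩ := exists_grid_abs_sub_le hT1 hu
    refine mem_iUnion₂.2 ⟨i, hi, ?_⟩
    set u' := (i : ℝ) / (T : ℝ) ^ 3
    have hE : ∀ t, |∫ ω', H (X T t ω') ∂P| ≤ C := fun t => by
      have := norm_integral_le_of_norm_le_const (μ := P) (f := fun ω => H (X T t ω)) (C := C)
        (ae_of_all _ fun ω => hHC _)
      rwa [probReal_univ, mul_one] at this
    have hh2 : 1 / h T ≤ T := by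
      rw [div_le_iff₀ (hh T)]; exact hThT
    -- The mesh T⁻³ is fine enough even after two factors 1/h ≤ T: the terms change by O(T⁻²), so
    -- their sum changes by O(T⁻¹), eventually less than half of ε.
    have hterm : ∀ t ∈ Finset.Icc 1 T, |kernelWeight K (h T) T u t *
        (H (X T t ω) - ∫ ω', H (X T t ω') ∂P) - kernelWeight K (h T) T u' t *
        (H (X T t ω) - ∫ ω', H (X T t ω') ∂P)| ≤ 2 * C * Kl / (T : ℝ) / T := fun t _ => by
      have hh0 := hh T
      rw [← sub_mul, abs_mul]
      calc _ ≤ 1 / (T * h T) * (Kl * (1 / (T : ℝ) ^ 3 / h T)) * (2 * C) := by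
            gcongr
            · refine (abs_kernelWeight_sub_le hKl hh0 T u u' t).trans ?_
              gcongr
            · exact (abs_sub _ _).trans (by linarith [hHC (X T t ω), hE t])
        _ = 2 * C * Kl / (T : ℝ) ^ 4 * (1 / h T) * (1 / h T) := by field_simp
        _ ≤ 2 * C * Kl / (T : ℝ) ^ 4 * T * T := by gcongr
        _ = _ := by field_simp
    have hdiff : |∑ t ∈ Finset.Icc 1 T, kernelWeight K (h T) T u t *
        (H (X T t ω) - ∫ ω', H (X T t ω') ∂P) - ∑ t ∈ Finset.Icc 1 T,
        kernelWeight K (h T) T u' t * (H (X T t ω) - ∫ ω', H (X T t ω') ∂P)| ≤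
        2 * C * Kl / (T : ℝ) := by
      rw [← Finset.sum_sub_distrib]
      refine (Finset.abs_sum_le_sum_abs _ _).trans ((Finset.sum_le_sum hterm).trans_eq ?_)
      rw [Finset.sum_const, Nat.card_Icc, nsmul_eq_mul, Nat.add_sub_cancel]
      field_simp
    have := abs_sub_abs_le_abs_sub (∑ t ∈ Finset.Icc 1 T, kernelWeight K (h T) T u t *
        (H (X T t ω) - ∫ ω', H (X T t ω') ∂P)) (∑ t ∈ Finset.Icc 1 T,
        kernelWeight K (h T) T u' t * (H (X T t ω) - ∫ ω', H (X T t ω') ∂P))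
    rw [mem_ofPred_eq]
    linarith
  refine (measure_mono hsub).trans ((measure_biUnion_finset_le _ _).trans ?_)
  calc _ ≤ ∑ _i ∈ Finset.range (T ^ 3 + 1),
        4 * ENNReal.ofReal (Real.exp (-(b * (T * h T / m T)) + 6 * c)) :=
        Finset.sum_le_sum fun i _ => measure_le_abs_kernel_average_le hT1 hm1 hmT (hX T)
          (hφ T hT1) hK0 hKb (hh T) (hAT _) hH hHC hC hτ.le hτ1 hτ2
    _ = ENNReal.ofReal (((T : ℝ) ^ 3 + 1) * (4 *
          Real.exp (-(b * (T * h T / m T)) + 6 * c))) := by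
        rw [Finset.sum_const, Finset.card_range, nsmul_eq_mul,
          ENNReal.ofReal_mul (by positivity), ENNReal.ofReal_mul (by norm_num)]
        congr 1
        · rw [← Nat.cast_pow, ← Nat.cast_add_one, ENNReal.ofReal_natCast]
        · congr 1
          exact (ENNReal.ofReal_ofNat 4).symm
    _ ≤ ENNReal.ofReal (8 * Real.exp (6 * c) / (T : ℝ)) := by
        refine ENNReal.ofReal_le_ofReal ?_
        have h1 : Real.exp (-(b * (T * h T / m T)) + 6 * c) ≤
            Real.exp (6 * c) / (T : ℝ) ^ 4 := by
          calc _ ≤ Real.exp (6 * c - ((4 : ℕ) : ℝ) * Real.log T) := by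
                refine Real.exp_le_exp.2 ?_
                push_cast
                linarith
            _ = _ := by rw [Real.exp_sub, Real.exp_nat_mul, Real.exp_log hT0]
        have h2 : (T : ℝ) ^ 3 + 1 ≤ 2 * (T : ℝ) ^ 3 := by
          have := one_le_pow₀ (n := 3) hT1'
          linarith
        calc _ ≤ 2 * (T : ℝ) ^ 3 * (4 * (Real.exp (6 * c) / (T : ℝ) ^ 4)) := by gcongr
          _ = _ := by field_simp; norm_num

end KernelAverage

/-! ### The relative criterion, its mean under the model, and the simulated criterion. -/

namespace Setup

variable {S : Type*} {dν dz dθ dρ : ℕ} (M : Setup S dν dz dθ dρ)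

/-- The auxiliary criterion relative to its value at a reference point. -/
def relG (ρref : Vec dρ) (y : ℝ) (z : Vec dz) (ρ : Vec dρ) : ℝ := M.G y z ρ - M.G y z ρref

/-- The relative criterion as a function of the error history and the parameters. -/
def relOut (ρref : Vec dρ) (e : ℕ → Vec dν) (θ : Vec dθ) (ρ : Vec dρ) : ℝ :=
  M.relG ρref (M.out e θ) (M.ζ e θ) ρ

variable {M}

theorem crit_sub_crit (T : ℕ) (u : ℝ) (ρ ρref : Vec dρ) (ω : S) :
    M.crit T u ρ ω - M.crit T u ρref ω = ∑ t ∈ Finset.Icc 1 T,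
      kernelWeight M.K (M.h T) T u t * M.relG ρref (M.Y T t ω) (M.Z T t ω) ρ := by
  rw [crit, crit, ← mul_sub, ← Finset.sum_sub_distrib, Finset.mul_sum]
  refine Finset.sum_congr rfl fun t _ => ?_
  rw [kernelWeight, relG]
  ring

theorem critSim_sub_critSim (T : ℕ) (θ : Vec dθ) (ρ ρref : Vec dρ) (ω : S) :
    M.critSim T θ ρ ω - M.critSim T θ ρref ω = 1 / (T : ℝ) * ∑ t ∈ Finset.Icc 1 T,
      M.relOut ρref (past M.νsim (t : ℤ) ω) θ ρ := by
  rw [critSim, critSim, ← mul_sub, ← Finset.sum_sub_distrib]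
  rfl

variable (M) in
/-- The criterion is Lipschitz with constant `B` over the parameter space. -/
def IsLipschitzG (B : ℝ) : Prop :=
  0 ≤ B ∧ ∀ y y' z z', ∀ ρ ∈ M.Γ, ∀ ρ' ∈ M.Γ,
    |M.G y z ρ - M.G y' z' ρ'| ≤ B * ‖((y, z), ρ) - ((y', z'), ρ')‖

/-- The criterion is Lipschitz when it has a bounded derivative. -/
theorem exists_isLipschitzG
    (hs : ∀ y z, ∀ ρ ∈ convexHull ℝ M.Γ,
      ContDiffAt ℝ 2 (fun p : ℝ × Vec dz × Vec dρ => M.G p.1 p.2.1 p.2.2) (y, z, ρ))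
    (hb : ∃ B : ℝ, ∀ y z, ∀ ρ ∈ convexHull ℝ M.Γ,
      ‖fderiv ℝ (fun p : ℝ × Vec dz × Vec dρ => M.G p.1 p.2.1 p.2.2) (y, z, ρ)‖ ≤ B) :
    ∃ B : ℝ, M.IsLipschitzG B := by
  obtain ⟨B, hB⟩ := hb
  set s : Set (ℝ × Vec dz × Vec dρ) := univ ×ˢ univ ×ˢ convexHull ℝ M.Γ
  have hconv : Convex ℝ s := convex_univ.prod (convex_univ.prod (convex_convexHull ℝ _))
  refine ⟨max B 0, le_max_right _ _, fun y y' z z' ρ hρ ρ' hρ' => ?_⟩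
  have h := hconv.norm_image_sub_le_of_norm_fderiv_le
    (f := fun p : ℝ × Vec dz × Vec dρ => M.G p.1 p.2.1 p.2.2) (𝕜 := ℝ) (C := max B 0)
    (fun p hp => (hs p.1 p.2.1 p.2.2 hp.2.2).differentiableAt (by norm_num))
    (fun p hp => (hB p.1 p.2.1 p.2.2 hp.2.2).trans (le_max_left _ _))
    (x := (y', z', ρ')) (y := (y, z, ρ)) ⟨mem_univ _, mem_univ _, subset_convexHull ℝ _ hρ'⟩
    ⟨mem_univ _, mem_univ _, subset_convexHull ℝ _ hρ⟩
  rw [Real.norm_eq_abs] at h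
  refine h.trans_eq ?_
  simp only [Prod.mk_sub_mk, Prod.norm_mk, max_assoc]

namespace IsLipschitzG

variable {B : ℝ} {ρref : Vec dρ}

theorem abs_relG_sub_le_of_param (hG : M.IsLipschitzG B) (y : ℝ) (z : Vec dz) {ρ ρ' : Vec dρ}
    (hρ : ρ ∈ M.Γ) (hρ' : ρ' ∈ M.Γ) :
    |M.relG ρref y z ρ - M.relG ρref y z ρ'| ≤ B * ‖ρ - ρ'‖ := by
  have h := hG.2 y y z z ρ hρ ρ' hρ'
  simpa [relG] using h

/-- This is what the reference point is for: the limit theorems above are for bounded functions, and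
`G` itself may be unbounded. -/
theorem abs_relG_le (hG : M.IsLipschitzG B) (hΓ : IsCompact M.Γ) (href : ρref ∈ M.Γ) (y : ℝ)
    (z : Vec dz) {ρ : Vec dρ} (hρ : ρ ∈ M.Γ) :
    |M.relG ρref y z ρ| ≤ B * Metric.diam M.Γ := by
  have h := hG.2 y y z z ρ hρ ρref href
  simp only [Prod.mk_sub_mk, sub_self, Prod.norm_mk, norm_zero] at h
  refine h.trans (mul_le_mul_of_nonneg_left ?_ hG.1)
  rw [max_eq_right (norm_nonneg _), ← dist_eq_norm]
  exact Metric.dist_le_diam_of_mem hΓ.isBounded hρ href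

theorem abs_relG_sub_le_of_data (hG : M.IsLipschitzG B) (href : ρref ∈ M.Γ) (y y' : ℝ)
    (z z' : Vec dz) {ρ : Vec dρ} (hρ : ρ ∈ M.Γ) :
    |M.relG ρref y z ρ - M.relG ρref y' z' ρ| ≤ 2 * B * ‖(y, z) - (y', z')‖ := by
  have h1 := hG.2 y y' z z' ρ hρ ρ hρ
  have h2 := hG.2 y y' z z' ρref href ρref href
  rw [Prod.mk_sub_mk, sub_self, Prod.norm_mk, norm_zero, max_eq_left (norm_nonneg _)] at h1 h2
  have h3 : M.relG ρref y z ρ - M.relG ρref y' z' ρ =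
      (M.G y z ρ - M.G y' z' ρ) - (M.G y z ρref - M.G y' z' ρref) := by
    rw [relG, relG]; ring
  rw [h3]
  exact (abs_sub _ _).trans (by linarith)

theorem continuous_relG (hG : M.IsLipschitzG B) (href : ρref ∈ M.Γ) {ρ : Vec dρ}
    (hρ : ρ ∈ M.Γ) : Continuous fun p : ℝ × Vec dz => M.relG ρref p.1 p.2 ρ := by
  have h : LipschitzWith (2 * B).toNNReal fun p : ℝ × Vec dz => M.relG ρref p.1 p.2 ρ :=
    LipschitzWith.of_dist_le' fun p p' => by
      rw [Real.dist_eq, dist_eq_norm]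
      exact hG.abs_relG_sub_le_of_data href p.1 p'.1 p.2 p'.2 hρ
  exact h.continuous

theorem continuousOn_G (hG : M.IsLipschitzG B) :
    ContinuousOn (fun p : (ℝ × Vec dz) × Vec dρ => M.G p.1.1 p.1.2 p.2) (univ ×ˢ M.Γ) := by
  have h : LipschitzOnWith B.toNNReal
      (fun p : (ℝ × Vec dz) × Vec dρ => M.G p.1.1 p.1.2 p.2) (univ ×ˢ M.Γ) :=
    LipschitzOnWith.of_dist_le' fun p hp p' hp' => by
      rw [Real.dist_eq, dist_eq_norm]
      exact hG.2 p.1.1 p'.1.1 p.1.2 p'.1.2 p.2 hp.2 p'.2 hp'.2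
  exact h.continuousOn

end IsLipschitzG

section Model

variable [MeasurableSpace S] {P : Measure S}

theorem measurable_out (hmodel : StructuralModel P M) {θ : Vec dθ} (hθ : θ ∈ M.Θ) :
    Measurable fun e => M.out e θ := by
  have h : Continuous fun ε : ℝ => M.r ε θ := by
    refine continuousOn_univ.1 (hmodel.r_cont.comp (f := fun ε : ℝ => (ε, θ)) (by fun_prop) ?_)
    exact fun ε _ => ⟨mem_univ _, hθ⟩
  exact h.measurable.comp (hmodel.φ_meas θ hθ)

theorem continuousOn_out (hmodel : StructuralModel P M) (e : ℕ → Vec dν) :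
    ContinuousOn (fun θ => M.out e θ) M.Θ := by
  have h : ContinuousOn (fun θ => (M.φ e θ, θ)) M.Θ := by
    refine ContinuousOn.prodMk (fun θ hθ => ?_) continuousOn_id
    exact (hmodel.φ_smooth.1 e θ hθ).continuousAt.continuousWithinAt
  exact hmodel.r_cont.comp h fun θ hθ => ⟨mem_univ _, hθ⟩

variable {B : ℝ} {ρref : Vec dρ}

theorem measurable_relOut (hmodel : StructuralModel P M) (hG : M.IsLipschitzG B)
    (href : ρref ∈ M.Γ) {θ : Vec dθ} (hθ : θ ∈ M.Θ) {ρ : Vec dρ} (hρ : ρ ∈ M.Γ) :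
    Measurable fun e => M.relOut ρref e θ ρ :=
  (hG.continuous_relG href hρ).measurable.comp
    ((measurable_out hmodel hθ).prodMk (hmodel.ζ_meas θ hθ))

theorem continuousOn_relOut (hmodel : StructuralModel P M) (hG : M.IsLipschitzG B)
    (href : ρref ∈ M.Γ) (e : ℕ → Vec dν) :
    ContinuousOn (fun p : Vec dθ × Vec dρ => M.relOut ρref e p.1 p.2) (M.Θ ×ˢ M.Γ) := by
  have h1 : ContinuousOn (fun p : Vec dθ × Vec dρ => (M.out e p.1, M.ζ e p.1)) (M.Θ ×ˢ M.Γ) :=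
    ((continuousOn_out hmodel e).prodMk (hmodel.ζ_cont e)).comp continuousOn_fst
      fun p hp => hp.1
  exact (hG.continuousOn_G.comp (h1.prodMk continuousOn_snd)
      fun p hp => ⟨mem_univ _, hp.2⟩).sub
    (hG.continuousOn_G.comp (h1.prodMk (continuousOn_const (c := ρref)))
      fun p _ => ⟨mem_univ _, href⟩)

variable (P M) in
/-- The law of the error history. -/
noncomputable def historyLaw : Measure (ℕ → Vec dν) :=
  Measure.infinitePi fun _ => P.map (M.ν 0)

variable (P M) in
/-- The mean of the relative criterion under the stationary model. -/
noncomputable def meanOut (ρref : Vec dρ) (θ : Vec dθ) (ρ : Vec dρ) : ℝ :=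
  ∫ e, M.relOut ρref e θ ρ ∂M.historyLaw P

variable [IsProbabilityMeasure P]

theorem map_past_eq_historyLaw (hmodel : StructuralModel P M) (t : ℤ) :
    P.map (past M.ν t) = M.historyLaw P :=
  map_past hmodel.noise.1 hmodel.noise.2.1 hmodel.noise.2.2.1 t

theorem map_past_sim_eq_historyLaw (hmodel : StructuralModel P M) (t : ℤ) :
    P.map (past M.νsim t) = M.historyLaw P := by
  rw [historyLaw, ← hmodel.same_law.map_eq]
  exact map_past hmodel.noise_sim.1 hmodel.noise_sim.2.1 hmodel.noise_sim.2.2.1 t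

theorem isProbabilityMeasure_historyLaw (hmodel : StructuralModel P M) :
    IsProbabilityMeasure (M.historyLaw P) := by
  rw [← map_past_eq_historyLaw hmodel 0]
  exact Measure.isProbabilityMeasure_map (measurable_past hmodel.noise.1 0).aemeasurable

theorem continuousOn_meanOut (hmodel : StructuralModel P M) (hG : M.IsLipschitzG B)
    (hΓ : IsCompact M.Γ) (href : ρref ∈ M.Γ) :
    ContinuousOn (fun p : Vec dθ × Vec dρ => M.meanOut P ρref p.1 p.2) (M.Θ ×ˢ M.Γ) := by
  have := isProbabilityMeasure_historyLaw hmodel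
  exact continuousOn_of_dominated (bound := fun _ => B * Metric.diam M.Γ)
    (fun p hp => (measurable_relOut hmodel hG href hp.1 hp.2).aestronglyMeasurable)
    (fun p hp => ae_of_all _ fun e => hG.abs_relG_le hΓ href _ _ hp.2)
    (integrable_const _) (ae_of_all _ fun e => continuousOn_relOut hmodel hG href e)

/-- The minimizers of the limit of the simulated criterion are the minimizers of the mean of the
relative criterion. -/
theorem isUniqueArgmin_meanOut (hmodel : StructuralModel P M) (hG : M.IsLipschitzG B)
    (href : ρref ∈ M.Γ) {M₀ : Vec dρ → ℝ → ℝ}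
    {Msim₀ : Vec dρ → ℝ → Vec dθ → ℝ} {ρ₀ : ℝ → Vec dθ → Vec dρ}
    (hlim : LimitQuantities P M M₀ Msim₀ ρ₀) {u : ℝ} (hu : u ∈ M.UAll) {θ : Vec dθ}
    (hθ : θ ∈ M.Θ) : IsUniqueArgmin (M.meanOut P ρref θ) M.Γ (ρ₀ u θ) := by
  -- Every history has the same law, so this mean depends neither on t nor on u. Averaging over t
  -- then shows that `Msim₀` equals `meanOut` up to a constant in ρ.
  have hmean : ∀ t : ℤ, ∀ ρ ∈ M.Γ, ∫ ω, M.G (M.ysim θ t ω) (M.zsim θ t ω) ρ ∂P -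
      ∫ ω, M.G (M.ysim θ t ω) (M.zsim θ t ω) ρref ∂P = M.meanOut P ρref θ ρ := by
    intro t ρ hρ
    rw [← integral_sub (hlim.sim_integrable θ hθ ρ hρ t) (hlim.sim_integrable θ hθ ρref href t),
      meanOut, ← map_past_sim_eq_historyLaw hmodel t,
      integral_map (measurable_past hmodel.noise_sim.1 t).aemeasurable
        (measurable_relOut hmodel hG href hθ hρ).aestronglyMeasurable]
    rfl
  have hdiff : ∀ ρ ∈ M.Γ, M.meanOut P ρref θ ρ = Msim₀ ρ u θ - Msim₀ ρref u θ := by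
    intro ρ hρ
    have h1 := (hlim.lim_sim u hu θ hθ ρ hρ).sub (hlim.lim_sim u hu θ hθ ρref href)
    refine tendsto_nhds_unique (tendsto_const_nhds.congr' ?_) h1
    filter_upwards [eventually_ge_atTop 1] with T hT
    have hT0 : (T : ℝ) ≠ 0 := by positivity
    rw [← mul_sub, ← Finset.sum_sub_distrib,
      Finset.sum_congr rfl fun (t : ℕ) _ => hmean (t : ℤ) ρ hρ, Finset.sum_const, Nat.card_Icc,
      nsmul_eq_mul, Nat.add_sub_cancel]
    field_simp
  obtain ⟨h1, h2⟩ := hlim.argmin_sim u hu θ hθ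
  refine ⟨h1, fun ρ hρ hne => ?_⟩
  rw [hdiff _ h1, hdiff ρ hρ]
  linarith [h2 ρ hρ hne]

/-- The simulated criterion converges uniformly over the parameter spaces. -/
theorem tendsto_measure_critSim (hmodel : StructuralModel P M) (hG : M.IsLipschitzG B)
    (hΓ : IsCompact M.Γ) (hΘ : IsCompact M.Θ) (href : ρref ∈ M.Γ) {ε : ℝ} (hε : 0 < ε) :
    Tendsto (fun T : ℕ => P {ω | ∃ θ ∈ M.Θ, ∃ ρ ∈ M.Γ,
      ε ≤ |M.critSim T θ ρ ω - M.critSim T θ ρref ω - M.meanOut P ρref θ ρ|}) atTop (𝓝 0) := by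
  have := isProbabilityMeasure_historyLaw hmodel
  have : CompactSpace (M.Θ ×ˢ M.Γ : Set (Vec dθ × Vec dρ)) :=
    isCompact_iff_compactSpace.1 (hΘ.prod hΓ)
  have h := tendsto_measure_exists_average (P := P) (μ := M.historyLaw P)
    (Q := (M.Θ ×ˢ M.Γ : Set (Vec dθ × Vec dρ)))
    (Φ := fun e q => M.relOut ρref e q.1.1 q.1.2) (C := B * Metric.diam M.Γ)
    (x := fun t : ℕ => past M.νsim (t : ℤ))
    (fun F hF C hC κ hκ => tendsto_measure_average_past hmodel.noise_sim.1 hmodel.noise_sim.2.1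
      (map_past_sim_eq_historyLaw hmodel) hF hC hκ)
    (fun e => continuousOn_iff_continuous_domRestrict.1 (continuousOn_relOut hmodel hG href e))
    (fun q => measurable_relOut hmodel hG href q.2.1 q.2.2)
    (fun e q => hG.abs_relG_le hΓ href _ _ q.2.2) hε
  refine tendsto_measure_zero_of_subset h (Eventually.of_forall fun T ω => ?_)
  rintro ⟨θ, hθ, ρ, hρ, hle⟩
  rw [critSim_sub_critSim] at hle
  exact ⟨⟨(θ, ρ), hθ, hρ⟩, hle⟩

end Model

end Setup

/-! ### Consequences of smoothness of the parameter function and of local stationarity. -/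

namespace Setup

variable {S : Type*} [MeasurableSpace S] {P : Measure S} {dν dz dθ dρ : ℕ}
  {M : Setup S dν dz dθ dρ}

/-- The interval is convex and contains 1/2 and t/T for 1 ≤ t < T. It does not contain 1, so the
last observation t = T needs separate treatment. -/
theorem UAll_eq_Ioo (hmodel : StructuralModel P M) : M.UAll = Ioo 0 1 := by
  ext u
  simp only [UAll, U, mem_iUnion, mem_Icc, mem_Ioo]
  constructor
  · rintro ⟨T, h1, h2⟩
    have := hmodel.δ_pos T
    exact ⟨by linarith, by linarith⟩
  · rintro ⟨h1, h2⟩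
    obtain ⟨T, hT⟩ := (hmodel.δ_lim.eventually_lt_const
      (lt_min h1 (sub_pos.2 h2))).exists
    exact ⟨T, (hT.trans_le (min_le_left _ _)).le,
      by linarith [hT.trans_le (min_le_right u (1 - u))]⟩

theorem U_subset_UAll {S : Type*} {M : Setup S dν dz dθ dρ} (T : ℕ) : M.U T ⊆ M.UAll := subset_iUnion M.U T

/-- The parameter function is Lipschitz. -/
theorem exists_lipschitz_θ₀ (hmodel : StructuralModel P M) :
    ∃ L : ℝ, 0 ≤ L ∧ ∀ u ∈ M.UAll, ∀ v ∈ M.UAll, ‖M.θ₀ u - M.θ₀ v‖ ≤ L * |u - v| := by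
  obtain ⟨B, hB⟩ := hmodel.θ₀_smooth
  have hconv : Convex ℝ M.UAll := by
    rw [UAll_eq_Ioo hmodel]; exact convex_Ioo 0 1
  have hhalf : (1 / 2 : ℝ) ∈ M.UAll := by
    rw [UAll_eq_Ioo hmodel]; norm_num
  have hB0 : 0 ≤ B := (norm_nonneg _).trans (hB _ hhalf).2.2
  have hd : ∀ u ∈ M.UAll, ‖deriv M.θ₀ u‖ ≤ ‖deriv M.θ₀ (1 / 2)‖ + B := by
    intro u hu
    -- A bounded second derivative on an interval of length 1 keeps the first derivative within `B`
    -- of its value at 1/2.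
    have h := hconv.norm_image_sub_le_of_norm_deriv_le (f := deriv M.θ₀) (C := B)
      (fun x hx => (hB x hx).2.1) (fun x hx => (hB x hx).2.2) hhalf hu
    have h1 : ‖u - 1 / 2‖ ≤ 1 := by
      rw [UAll_eq_Ioo hmodel] at hu
      rw [Real.norm_eq_abs, abs_le]
      constructor <;> linarith [hu.1, hu.2]
    have h2 := norm_sub_norm_le (deriv M.θ₀ u) (deriv M.θ₀ (1 / 2))
    have h3 := mul_le_mul_of_nonneg_left h1 hB0
    linarith
  exact ⟨_, by positivity, fun u hu v hv => hconv.norm_image_sub_le_of_norm_deriv_le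
    (f := M.θ₀) (fun x hx => (hB x hx).1) hd hv hu⟩

/-- Markov's inequality for |C_T|^η: the moments stay bounded while the threshold κT tends to
infinity. -/
theorem tendsto_measure_lt_div_of_moment {C : ℕ → S → ℝ} {η : ℝ} {b : ℝ≥0} (hη : 0 < η)
    (hC : ∀ T, Measurable (C T)) (hb : ∀ T, ∫⁻ ω, ‖C T ω‖ₑ ^ η ∂P ≤ b) {κ : ℝ} (hκ : 0 < κ) :
    Tendsto (fun T : ℕ => P {ω | κ < C T ω / T}) atTop (𝓝 0) := by
  have hlim : Tendsto (fun T : ℕ => (b : ℝ≥0∞) / ENNReal.ofReal ((κ * T) ^ η)) atTop (𝓝 0) := by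
    have h1 : Tendsto (fun T : ℕ => (κ * T) ^ η) atTop atTop :=
      (tendsto_rpow_atTop hη).comp (tendsto_natCast_atTop_atTop.const_mul_atTop hκ)
    have h2 := ENNReal.Tendsto.const_div (a := (b : ℝ≥0∞)) (ENNReal.tendsto_ofReal_atTop.comp h1)
      (Or.inr ENNReal.coe_ne_top)
    rwa [ENNReal.div_top] at h2
  refine tendsto_of_tendsto_of_tendsto_of_le_of_le' tendsto_const_nhds hlim
    (Eventually.of_forall fun _ => zero_le) ?_
  filter_upwards [eventually_ge_atTop 1] with T hT
  have hT0 : (0 : ℝ) < T := by positivity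
  have hpos : ENNReal.ofReal ((κ * T) ^ η) ≠ 0 :=
    (ENNReal.ofReal_pos.2 (Real.rpow_pos_of_pos (by positivity) _)).ne'
  calc P {ω | κ < C T ω / T}
      ≤ P {ω | ENNReal.ofReal ((κ * T) ^ η) ≤ ‖C T ω‖ₑ ^ η} := by
        refine measure_mono fun ω hω => ?_
        rw [mem_ofPred_eq, lt_div_iff₀ hT0] at hω
        rw [mem_ofPred_eq, ← ENNReal.ofReal_rpow_of_pos (by positivity)]
        refine ENNReal.rpow_le_rpow ?_ hη.le
        rw [Real.enorm_eq_ofReal_abs]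
        exact ENNReal.ofReal_le_ofReal (hω.le.trans (le_abs_self _))
    _ ≤ (∫⁻ ω, ‖C T ω‖ₑ ^ η ∂P) / ENNReal.ofReal ((κ * T) ^ η) :=
        meas_ge_le_lintegral_div ((hC T).enorm.pow_const η).aemeasurable hpos
          ENNReal.ofReal_ne_top
    _ ≤ _ := by gcongr; exact hb T

variable [IsProbabilityMeasure P] {B : ℝ} {ρref : Vec dρ}

/-- The means of the relative criterion for the observed array approach those of the stationary
approximants. -/
theorem eventually_abs_integral_relG_sub_le (hmodel : StructuralModel P M)
    (hdep : DependenceConditions P M) (hG : M.IsLipschitzG B) (hΓ : IsCompact M.Γ)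
    (href : ρref ∈ M.Γ) {ε : ℝ} (hε : 0 < ε) :
    ∀ᶠ T : ℕ in atTop, ∀ t : ℕ, 1 ≤ t → t < T → ∀ ρ ∈ M.Γ,
      |∫ ω, M.relG ρref (M.Y T t ω) (M.Z T t ω) ρ ∂P -
        M.meanOut P ρref (M.θ₀ (t / T)) ρ| ≤ ε := by
  obtain ⟨-, C, η, b, hη, hCm, hCb, hC⟩ := hdep.loc_stat
  set D := B * Metric.diam M.Γ with hD
  have hD0 : 0 ≤ D := mul_nonneg hG.1 Metric.diam_nonneg
  -- Off the event C_T/T > κ the Lipschitz bound gives at most 2Bκ ≤ ε/2; on that event the crude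
  -- bound 2D is multiplied by a vanishing probability. The + 1 covers B = 0.
  set κ := ε / (4 * (B + 1)) with hκdef
  have hB0 := hG.1
  have hκ : 0 < κ := by positivity
  have hbad := tendsto_measure_lt_div_of_moment hη hCm hCb hκ
  have hbad' : Tendsto (fun T : ℕ => 2 * D * P.real {ω | κ < C T ω / T}) atTop (𝓝 0) := by
    have := ((ENNReal.tendsto_toReal ENNReal.zero_ne_top).comp hbad).const_mul (2 * D)
    simpa [Measure.real] using this
  filter_upwards [hbad'.eventually_lt_const (half_pos hε), eventually_ge_atTop 1] with
    T hT hT1 t ht htT ρ hρ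
  have hT0 : (0 : ℝ) < T := by positivity
  have hu : (t / T : ℝ) ∈ M.UAll := by
    rw [UAll_eq_Ioo hmodel]
    have h1 : (0 : ℝ) < t := by positivity
    have h2 : (t : ℝ) < T := by exact_mod_cast htT
    exact ⟨by positivity, (div_lt_one hT0).2 h2⟩
  have hθ := hmodel.θ₀_mem _ hu
  set θ := M.θ₀ (t / T)
  have hmO := measurable_relOut hmodel hG href hθ hρ
  have hmp := measurable_past hmodel.noise.1 (t : ℤ)
  have hi1 : Integrable (fun ω => M.relG ρref (M.Y T t ω) (M.Z T t ω) ρ) P :=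
    Integrable.of_bound ((hG.continuous_relG href hρ).measurable.comp
      ((hmodel.Y_meas T t).prodMk (hmodel.Z_meas T t))).aestronglyMeasurable D
      (ae_of_all _ fun ω => hG.abs_relG_le hΓ href _ _ hρ)
  have hi2 : Integrable (fun ω => M.relOut ρref (past M.ν (t : ℤ) ω) θ ρ) P :=
    Integrable.of_bound (hmO.comp hmp).aestronglyMeasurable D
      (ae_of_all _ fun ω => hG.abs_relG_le hΓ href _ _ hρ)
  have hbm : MeasurableSet {ω | κ < C T ω / T} :=
    measurableSet_lt measurable_const ((hCm T).div_const _)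
  rw [meanOut, ← map_past_eq_historyLaw hmodel (t : ℤ),
    integral_map hmp.aemeasurable hmO.aestronglyMeasurable, ← integral_sub hi1 hi2]
  have hpt : ∀ᵐ ω ∂P, |M.relG ρref (M.Y T t ω) (M.Z T t ω) ρ -
      M.relOut ρref (past M.ν (t : ℤ) ω) θ ρ| ≤
      ε / 2 + {ω | κ < C T ω / T}.indicator (fun _ => 2 * D) ω := by
    filter_upwards [hC T] with ω hω
    by_cases hb : κ < C T ω / T
    · rw [indicator_of_mem (show ω ∈ {ω | κ < C T ω / T} from hb)]
      have h1 := hG.abs_relG_le hΓ href (M.Y T t ω) (M.Z T t ω) hρ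
      have h2 : |M.relOut ρref (past M.ν (t : ℤ) ω) θ ρ| ≤ D := hG.abs_relG_le hΓ href _ _ hρ
      exact (abs_sub _ _).trans (by linarith)
    · rw [indicator_of_notMem (show ω ∉ {ω | κ < C T ω / T} from hb), add_zero]
      refine (hG.abs_relG_sub_le_of_data href _ _ _ _ hρ).trans ?_
      have h1 := (hω t ht htT.le).trans (not_lt.1 hb)
      calc _ ≤ 2 * B * κ := mul_le_mul_of_nonneg_left h1 (by linarith)
        _ ≤ 2 * (B + 1) * κ := by gcongr; linarith
        _ = ε / 2 := by rw [hκdef]; field_simp; norm_num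
  refine abs_integral_le_integral_abs.trans ((integral_mono_ae (hi1.sub hi2).abs
    ((integrable_const _).add ((integrable_const _).indicator hbm)) hpt).trans ?_)
  rw [integral_add' (integrable_const _) ((integrable_const _).indicator hbm),
    integral_indicator hbm, setIntegral_const, integral_const, probReal_univ, smul_eq_mul,
    smul_eq_mul]
  linarith

end Setup

/-! ### Large-T bounds on the kernel weights along the bandwidth sequence. -/

namespace KernelConditions

variable {S : Type*} {dν dz dθ dρ k : ℕ} {M : Setup S dν dz dθ dρ}

theorem contDiff_one (hker : KernelConditions M k) : ContDiff ℝ 1 M.K :=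
  hker.smooth.of_le (by exact_mod_cast (one_le_two.trans hker.order))

theorem integrable_deriv (hker : KernelConditions M k) : Integrable (deriv M.K) :=
  integrable_deriv_of_tails hker.contDiff_one hker.tails

theorem tendsto_one_div (hker : KernelConditions M k) :
    Tendsto (fun T : ℕ => 1 / (T * M.h T)) atTop (𝓝 0) := by
  simp_rw [one_div]
  exact hker.Th_lim.inv_tendsto_atTop

theorem eventually_sum_le (hker : KernelConditions M k) : ∀ᶠ T : ℕ in atTop, ∀ u,
    ∑ t ∈ Finset.Icc 1 T, kernelWeight M.K (M.h T) T u t ≤ 2 := by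
  have h1 : Tendsto (fun T : ℕ => 1 / (T * M.h T) * ∫ x, |deriv M.K x|) atTop (𝓝 0) := by
    simpa using hker.tendsto_one_div.mul_const (∫ x, |deriv M.K x|)
  filter_upwards [h1.eventually_lt_const one_pos, eventually_ge_atTop 1] with T hT hT1 u
  have h2 := sum_kernelWeight_le hker.contDiff_one hker.nonneg hker.integrable
    hker.integrable_deriv hker.symm (hker.h_pos T) hT1 u
  rw [hker.integral_one] at h2
  linarith

theorem exists_eventually_tail_le (hker : KernelConditions M k) {ε : ℝ} (hε : 0 < ε) :
    ∃ L : ℝ, 0 < L ∧ ∀ᶠ T : ℕ in atTop, ∀ u : ℝ,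
      ∑ t ∈ Finset.Icc 1 T with L * M.h T < |u - (t : ℕ) / T|,
        kernelWeight M.K (M.h T) T u t ≤ ε := by
  obtain ⟨L, s₀, hL, hs₀, h⟩ := exists_tail_kernelWeight_le hker.contDiff_one hker.nonneg
    hker.integrable hker.integrable_deriv hker.symm hε
  refine ⟨L, hL, ?_⟩
  filter_upwards [hker.tendsto_one_div.eventually_lt_const hs₀, eventually_ge_atTop 1] with
    T hT hT1 u
  exact h _ T u (hker.h_pos T) hT1 hT.le

theorem exists_eventually_le_sum (hker : KernelConditions M k) :
    ∃ w : ℝ, 0 < w ∧ ∀ᶠ T : ℕ in atTop, ∀ u ∈ Icc (0 : ℝ) 1,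
      w ≤ ∑ t ∈ Finset.Icc 1 T, kernelWeight M.K (M.h T) T u t := by
  obtain ⟨w, s₀, hw, hs₀, h⟩ := exists_le_sum_kernelWeight hker.contDiff_one hker.nonneg
    hker.integrable hker.integrable_deriv hker.symm (by rw [hker.integral_one]; exact one_ne_zero)
  refine ⟨w, hw, ?_⟩
  filter_upwards [hker.tendsto_one_div.eventually_lt_const hs₀,
    hker.h_lim.eventually_lt_const hs₀, eventually_ge_atTop 1] with T hT hT' hT1
  exact h _ T (hker.h_pos T) hT1 hT.le hT'.le

end KernelConditions

/-! ### Bias and uniform convergence of the local criterion. -/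

namespace Setup

variable {S : Type*} [MeasurableSpace S] {P : Measure S} [IsProbabilityMeasure P]
  {dν dz dθ dρ k : ℕ} {M : Setup S dν dz dθ dρ} {B : ℝ} {ρref : Vec dρ}

/-- The bias of the local criterion vanishes uniformly. -/
theorem eventually_abs_bias_le (hmodel : StructuralModel P M) (hdep : DependenceConditions P M)
    (hker : KernelConditions M k) (hG : M.IsLipschitzG B) (hΓ : IsCompact M.Γ)
    (hΘ : IsCompact M.Θ) (href : ρref ∈ M.Γ) {ε : ℝ} (hε : 0 < ε) :
    ∀ᶠ T : ℕ in atTop, ∀ u ∈ M.U T, ∀ ρ ∈ M.Γ,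
      |∑ t ∈ Finset.Icc 1 T, kernelWeight M.K (M.h T) T u t *
          ∫ ω, M.relG ρref (M.Y T t ω) (M.Z T t ω) ρ ∂P -
        (∑ t ∈ Finset.Icc 1 T, kernelWeight M.K (M.h T) T u t) *
          M.meanOut P ρref (M.θ₀ u) ρ| ≤ ε := by
  set D := B * Metric.diam M.Γ with hD
  have hD0 : 0 ≤ D := mul_nonneg hG.1 Metric.diam_nonneg
  have := isProbabilityMeasure_historyLaw hmodel
  obtain ⟨Kb, hKb⟩ := hker.bdd
  obtain ⟨L, hL, htail⟩ := hker.exists_eventually_tail_le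
    (show 0 < ε / (6 * (D + 1)) by positivity)
  have hε12 : 0 < ε / 12 := by positivity
  obtain ⟨δ, hδ, hunif⟩ := Metric.uniformContinuousOn_iff.1
    ((hΘ.prod hΓ).uniformContinuousOn_of_continuous
      (continuousOn_meanOut hmodel hG hΓ href)) (ε / 12) hε12
  obtain ⟨l, hl, hlip⟩ := exists_lipschitz_θ₀ hmodel
  have hlast : Tendsto (fun T : ℕ => 2 * D * (1 / (T * M.h T) * Kb)) atTop (𝓝 0) := by
    simpa using (hker.tendsto_one_div.mul_const Kb).const_mul (2 * D)
  have hwin : Tendsto (fun T : ℕ => l * (L * M.h T)) atTop (𝓝 0) := by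
    simpa using (hker.h_lim.const_mul L).const_mul l
  filter_upwards [eventually_abs_integral_relG_sub_le hmodel hdep hG hΓ href hε12, htail,
    hker.eventually_sum_le, hlast.eventually_lt_const (show 0 < ε / 3 by positivity),
    hwin.eventually_lt_const hδ, eventually_ge_atTop 1] with T hmean htailT hsumT hlastT hwinT hT1
    u hu ρ hρ
  have hT0 : (0 : ℝ) < T := by positivity
  have huA := U_subset_UAll T hu
  have hw0 := fun t => kernelWeight_nonneg hker.nonneg (hker.h_pos T) T u t
  set w := fun t => kernelWeight M.K (M.h T) T u t with hw
  set E := fun t => ∫ ω, M.relG ρref (M.Y T t ω) (M.Z T t ω) ρ ∂P with hE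
  set d := M.meanOut P ρref (M.θ₀ u) ρ with hd
  have hEb : ∀ t, |E t| ≤ D := fun t => by
    have := norm_integral_le_of_norm_le_const (μ := P)
      (f := fun ω => M.relG ρref (M.Y T t ω) (M.Z T t ω) ρ) (C := D)
      (ae_of_all _ fun ω => hG.abs_relG_le hΓ href _ _ hρ)
    rwa [probReal_univ, mul_one] at this
  have hdb : |d| ≤ D := by
    have := norm_integral_le_of_norm_le_const (μ := M.historyLaw P)
      (f := fun e => M.relOut ρref e (M.θ₀ u) ρ) (C := D)
      (ae_of_all _ fun e => hG.abs_relG_le hΓ href _ _ hρ)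
    rwa [probReal_univ, mul_one] at this
  -- Times within L h of u other than T have mean close to that at θ₀(u), by local stationarity
  -- (ε/12) and uniform continuity (ε/12). The time T and the times outside the window get the crude
  -- bound 2D, and their weights are small.
  have hterm : ∀ t ∈ Finset.Icc 1 T, |w t * (E t - d)| ≤ w t * (ε / 6) +
      (2 * D * (if t = T then w t else 0) +
        2 * D * (if L * M.h T < |u - (t : ℕ) / T| then w t else 0)) := by
    intro t ht
    rw [Finset.mem_Icc] at ht
    have hwt : 0 ≤ w t := hw0 t
    have hDw : 0 ≤ 2 * D * w t := by positivity
    rw [abs_mul, abs_of_nonneg hwt]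
    have hcrude : |E t - d| ≤ 2 * D := (abs_sub _ _).trans (by linarith [hEb t])
    have hcrude' := mul_le_mul_of_nonneg_left hcrude hwt
    have hwε : 0 ≤ w t * (ε / 6) := by positivity
    by_cases h1 : t = T
    · rw [if_pos h1]
      split_ifs <;> linarith
    by_cases h2 : L * M.h T < |u - (t : ℕ) / T|
    · rw [if_neg h1, if_pos h2]
      linarith
    rw [if_neg h1, if_neg h2, mul_zero, add_zero, add_zero]
    refine mul_le_mul_of_nonneg_left ?_ hwt
    have htT : t < T := lt_of_le_of_ne ht.2 h1
    have htU : (t / T : ℝ) ∈ M.UAll := by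
      rw [UAll_eq_Ioo hmodel]
      have h3 : (0 : ℝ) < t := by
        have := ht.1
        positivity
      have h4 : (t : ℝ) < T := by exact_mod_cast htT
      exact ⟨by positivity, (div_lt_one hT0).2 h4⟩
    have hθd : dist (M.θ₀ (t / T)) (M.θ₀ u) < δ := by
      rw [dist_comm, dist_eq_norm]
      refine (hlip u huA _ htU).trans_lt ?_
      exact (mul_le_mul_of_nonneg_left (not_lt.1 h2) hl).trans_lt hwinT
    have h5 := hunif (M.θ₀ (t / T), ρ) ⟨hmodel.θ₀_mem _ htU, hρ⟩ (M.θ₀ u, ρ)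
      ⟨hmodel.θ₀_mem _ huA, hρ⟩ (by rw [dist_prod_same_right]; exact hθd)
    rw [Real.dist_eq] at h5
    have h6 := abs_sub_le (E t) (M.meanOut P ρref (M.θ₀ (t / T)) ρ) d
    have h7 := hmean t ht.1 htT ρ hρ
    linarith
  rw [Finset.sum_mul, ← Finset.sum_sub_distrib]
  calc |∑ t ∈ Finset.Icc 1 T, (w t * E t - w t * d)|
      ≤ ∑ t ∈ Finset.Icc 1 T, |w t * (E t - d)| := by
        simp_rw [← mul_sub]
        exact Finset.abs_sum_le_sum_abs _ _
    _ ≤ _ := Finset.sum_le_sum hterm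
    _ = (∑ t ∈ Finset.Icc 1 T, w t) * (ε / 6) + (2 * D * w T + 2 * D *
          ∑ t ∈ Finset.Icc 1 T with L * M.h T < |u - (t : ℕ) / T|, w t) := by
        rw [Finset.sum_add_distrib, Finset.sum_add_distrib, ← Finset.sum_mul, ← Finset.mul_sum,
          ← Finset.mul_sum, Finset.sum_ite_eq', if_pos (Finset.mem_Icc.2 ⟨hT1, le_rfl⟩),
          Finset.sum_filter]
    _ ≤ 2 * (ε / 6) + (2 * D * (1 / (T * M.h T) * Kb) + 2 * D * (ε / (6 * (D + 1)))) := by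
        gcongr
        · exact hsumT u
        · exact kernelWeight_le hKb (hker.h_pos T) T u T
        · exact htailT u
    _ ≤ ε := by
        have h8 : 2 * D * (ε / (6 * (D + 1))) ≤ ε / 3 := by
          calc _ ≤ 2 * (D + 1) * (ε / (6 * (D + 1))) := by gcongr; linarith
            _ = ε / 3 := by field_simp; norm_num
        linarith

/-- The local criterion converges uniformly, up to the total kernel weight. -/
theorem tendsto_measure_crit (hmodel : StructuralModel P M) (hdep : DependenceConditions P M)
    (hker : KernelConditions M k) (hG : M.IsLipschitzG B) (hΓ : IsCompact M.Γ)
    (hΘ : IsCompact M.Θ) (href : ρref ∈ M.Γ) {ε : ℝ} (hε : 0 < ε) :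
    Tendsto (fun T : ℕ => P {ω | ∃ u ∈ M.U T, ∃ ρ ∈ M.Γ,
      ε ≤ |M.crit T u ρ ω - M.crit T u ρref ω -
        (∑ t ∈ Finset.Icc 1 T, kernelWeight M.K (M.h T) T u t) *
          M.meanOut P ρref (M.θ₀ u) ρ|}) atTop (𝓝 0) := by
  set D := B * Metric.diam M.Γ with hD
  have hB0 := hG.1
  have hD0 : 0 ≤ D := mul_nonneg hB0 Metric.diam_nonneg
  obtain ⟨Kb, hKb⟩ := hker.bdd
  obtain ⟨Kl, hKl⟩ := hker.lipschitz
  obtain ⟨c, hc⟩ := hdep.mixing_rate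
  set r := ε / (16 * (B + 1)) with hr
  have hr0 : 0 < r := by positivity
  obtain ⟨F, hFΓ, hFc⟩ := hΓ.elim_nhds_subcover (fun ρ => Metric.ball ρ r)
    fun ρ _ => Metric.ball_mem_nhds ρ hr0
  have hfluct := tendsto_measure_biUnion_finset_zero (P := P) F fun ρ hρ =>
    tendsto_measure_exists_kernel_average (P := P)
      (X := fun T t ω => (M.Y T t ω, M.Z T t ω))
      (fun T t => (hmodel.Y_meas T t).prodMk (hmodel.Z_meas T t)) hdep.block hc hker.nonneg hKb
      hKl hker.h_pos hker.eventually_sum_le hker.Th_lim hker.Th_rate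
      (H := fun p => M.relG ρref p.1 p.2 ρ)
      (hG.continuous_relG href (hFΓ ρ hρ)).measurable
      (fun p => hG.abs_relG_le hΓ href p.1 p.2 (hFΓ ρ hρ)) hD0
      (show 0 < ε / 4 by positivity)
  refine tendsto_measure_zero_of_subset hfluct ?_
  filter_upwards [hker.eventually_sum_le, eventually_abs_bias_le hmodel hdep hker hG hΓ hΘ href
    (show 0 < ε / 4 by positivity)] with T hsum hbias
  rintro ω ⟨u, hu, ρ, hρ, hle⟩
  obtain ⟨ρ', hρ'F, hρ'⟩ := mem_iUnion₂.1 (hFc hρ)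
  have hρ'Γ := hFΓ ρ' hρ'F
  refine mem_iUnion₂.2 ⟨ρ', hρ'F, u, ?_, ?_⟩
  · have := U_subset_UAll T hu
    rw [UAll_eq_Ioo hmodel] at this
    exact Ioo_subset_Icc_self this
  have hw0 := fun t => kernelWeight_nonneg hker.nonneg (hker.h_pos T) T u t
  set w := fun t => kernelWeight M.K (M.h T) T u t with hw
  have hint : ∀ t, ∀ ρ ∈ M.Γ, Integrable (fun ω => M.relG ρref (M.Y T t ω) (M.Z T t ω) ρ) P :=
    fun t ρ hρ => Integrable.of_bound ((hG.continuous_relG href hρ).measurable.comp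
      ((hmodel.Y_meas T t).prodMk (hmodel.Z_meas T t))).aestronglyMeasurable D
      (ae_of_all _ fun ω => hG.abs_relG_le hΓ href _ _ hρ)
  have hdist : B * ‖ρ - ρ'‖ ≤ ε / 16 := by
    rw [Metric.mem_ball, dist_eq_norm] at hρ'
    calc B * ‖ρ - ρ'‖ ≤ (B + 1) * r := by
          gcongr
          linarith
      _ = ε / 16 := by rw [hr]; field_simp
  have hrel : ∀ y z, |M.relG ρref y z ρ - M.relG ρref y z ρ'| ≤ ε / 16 := fun y z =>
    (hG.abs_relG_sub_le_of_param y z hρ hρ'Γ).trans hdist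
  have hmean : ∀ t, |∫ ω', M.relG ρref (M.Y T t ω') (M.Z T t ω') ρ ∂P -
      ∫ ω', M.relG ρref (M.Y T t ω') (M.Z T t ω') ρ' ∂P| ≤ ε / 16 := fun t => by
    rw [← integral_sub (hint t ρ hρ) (hint t ρ' hρ'Γ)]
    have := norm_integral_le_of_norm_le_const (μ := P) (f := fun ω =>
      M.relG ρref (M.Y T t ω) (M.Z T t ω) ρ - M.relG ρref (M.Y T t ω) (M.Z T t ω) ρ')
      (C := ε / 16) (ae_of_all _ fun ω => hrel _ _)
    rwa [probReal_univ, mul_one] at this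
  rw [crit_sub_crit] at hle
  -- Fluctuation at the nearby net point ρ', error of passing from ρ to ρ', and bias. The last two
  -- are at most ε/4 each, so a deviation of ε forces the fluctuation at ρ' to exceed ε/4.
  have hsplit : ∑ t ∈ Finset.Icc 1 T, w t * M.relG ρref (M.Y T t ω) (M.Z T t ω) ρ -
      (∑ t ∈ Finset.Icc 1 T, w t) * M.meanOut P ρref (M.θ₀ u) ρ =
      ∑ t ∈ Finset.Icc 1 T, w t * (M.relG ρref (M.Y T t ω) (M.Z T t ω) ρ' -
        ∫ ω', M.relG ρref (M.Y T t ω') (M.Z T t ω') ρ' ∂P) +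
      ∑ t ∈ Finset.Icc 1 T, w t * ((M.relG ρref (M.Y T t ω) (M.Z T t ω) ρ -
        M.relG ρref (M.Y T t ω) (M.Z T t ω) ρ') -
        (∫ ω', M.relG ρref (M.Y T t ω') (M.Z T t ω') ρ ∂P -
          ∫ ω', M.relG ρref (M.Y T t ω') (M.Z T t ω') ρ' ∂P)) +
      (∑ t ∈ Finset.Icc 1 T, w t * ∫ ω', M.relG ρref (M.Y T t ω') (M.Z T t ω') ρ ∂P -
        (∑ t ∈ Finset.Icc 1 T, w t) * M.meanOut P ρref (M.θ₀ u) ρ) := by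
    rw [← add_sub_assoc, ← Finset.sum_add_distrib, ← Finset.sum_add_distrib]
    congr 1
    exact Finset.sum_congr rfl fun t _ => by ring
  have hmid : |∑ t ∈ Finset.Icc 1 T, w t * ((M.relG ρref (M.Y T t ω) (M.Z T t ω) ρ -
        M.relG ρref (M.Y T t ω) (M.Z T t ω) ρ') -
        (∫ ω', M.relG ρref (M.Y T t ω') (M.Z T t ω') ρ ∂P -
          ∫ ω', M.relG ρref (M.Y T t ω') (M.Z T t ω') ρ' ∂P))| ≤ ε / 4 := by
    calc _ ≤ ∑ t ∈ Finset.Icc 1 T, w t * (ε / 8) := by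
          refine (Finset.abs_sum_le_sum_abs _ _).trans (Finset.sum_le_sum fun t _ => ?_)
          rw [abs_mul, abs_of_nonneg (hw0 t)]
          refine mul_le_mul_of_nonneg_left ((abs_sub _ _).trans ?_) (hw0 t)
          linarith [hrel (M.Y T t ω) (M.Z T t ω), hmean t]
      _ = (∑ t ∈ Finset.Icc 1 T, w t) * (ε / 8) := by rw [Finset.sum_mul]
      _ ≤ 2 * (ε / 8) := by gcongr; exact hsum u
      _ = ε / 4 := by ring
  rw [hsplit] at hle
  have h1 := hle.trans ((abs_add_le _ _).trans (add_le_add (abs_add_le _ _) (hbias u hu ρ hρ)))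
  linarith

end Setup

end LocalII

/-! ### Consistency of the indirect inference estimator. -/

theorem theorem2 {S : Type*} [MeasurableSpace S] (P : MeasureTheory.Measure S)
    [MeasureTheory.IsProbabilityMeasure P] {dν dz dθ dρ : ℕ}
    (M : LocalII.Setup S dν dz dθ dρ)
    (M₀ : LocalII.Vec dρ → ℝ → ℝ) (Msim₀ : LocalII.Vec dρ → ℝ → LocalII.Vec dθ → ℝ)
    (ρ₀ : ℝ → LocalII.Vec dθ → LocalII.Vec dρ) (ε₀ : ℝ) (hε₀ : 0 < ε₀) (k : ℕ)
    (hmodel : LocalII.StructuralModel P M)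
    (hdep : LocalII.DependenceConditions P M)
    (hlim : LocalII.LimitQuantities P M M₀ Msim₀ ρ₀)
    (haux : LocalII.AuxiliaryConditions P M M₀ ρ₀ ε₀)
    (hker : LocalII.KernelConditions M k)
    (W : Matrix (Fin dρ) (Fin dρ) ℝ) (hW : W.PosDef)
    (ρhat : ℕ → ℝ → S → LocalII.Vec dρ)
    (ρsim : ℕ → ℝ → LocalII.Vec dθ → S → LocalII.Vec dρ)
    (θhat : ℕ → ℝ → S → LocalII.Vec dθ)
    (hest : LocalII.IsIndirectEstimator P M W ρhat ρsim θhat) :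
    LocalII.IsLittleOp P (fun T ω => ⨆ u ∈ M.U T, ‖θhat T u ω - M.θ₀ u‖ₑ) := by
  intro κ hκ
  -- A bound by some finite κ' < κ for each u keeps the supremum strictly below κ; κ itself may be
  -- infinite.
  obtain ⟨κ', hκ'0, hκ'⟩ := ENNReal.lt_iff_exists_nnreal_btwn.1 hκ
  replace hκ'0 : 0 < (κ' : ℝ) := by exact_mod_cast hκ'0
  have hu₀ : (1 / 2 : ℝ) ∈ M.UAll := by
    rw [LocalII.Setup.UAll_eq_Ioo hmodel]; norm_num
  have hΓ := haux.compact_Γ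
  have hΘ := haux.compact_Θ
  -- Any u would do: ρ₀(u; θ) minimizes `meanOut` at θ, which does not involve u. So injectivity at
  -- one u gives an inverse modulus that is valid for all u.
  set β := ρ₀ (1 / 2) with hβ
  obtain ⟨hβc, hβi⟩ := haux.binding _ hu₀
  obtain ⟨B, hG⟩ := LocalII.Setup.exists_isLipschitzG haux.G_smooth
    (haux.G_bdd.imp fun B h y z ρ hρ => (h y z ρ hρ).1)
  obtain ⟨ρref, href⟩ : M.Γ.Nonempty :=
    ⟨_, (hlim.argmin_sim _ hu₀ _ (hmodel.θ₀_mem _ hu₀)).1⟩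
  have hmin : ∀ θ ∈ M.Θ, LocalII.IsUniqueArgmin (M.meanOut P ρref θ) M.Γ (β θ) := fun θ hθ =>
    LocalII.Setup.isUniqueArgmin_meanOut hmodel hG href hlim hu₀ hθ
  obtain ⟨η₁, hη₁, hinv⟩ := LocalII.exists_norm_sub_lt_of_injOn hΘ hβc hβi hκ'0
  obtain ⟨a, b, ha, hb, hab⟩ := LocalII.exists_weightedSq_bounds hW
  set c := √(b / a) with hc
  have hc0 : 0 ≤ c := Real.sqrt_nonneg _
  -- Chosen so that 2ε + c · 2ε = η₁: two estimation errors, plus the minimal distance transferred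
  -- through the weighted norm, whose distortion is at most c.
  set ε := η₁ / (2 * (1 + c)) with hε
  have hε0 : 0 < ε := by positivity
  obtain ⟨η, hη, hsep⟩ := LocalII.exists_add_le_of_isUniqueArgmin hΘ hΓ
    (LocalII.Setup.continuousOn_meanOut hmodel hG hΓ href) hβc hmin hε0
  obtain ⟨w, hw, hwsum⟩ := hker.exists_eventually_le_sum
  have hbad₁ := LocalII.Setup.tendsto_measure_critSim hmodel hG hΓ hΘ href
    (show 0 < η / 4 by positivity)
  have hbad₂ := LocalII.Setup.tendsto_measure_crit hmodel hdep hker hG hΓ hΘ href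
    (show 0 < w * η / 4 by positivity)
  -- The exceptional set of the optimality properties has outer measure zero for every T, whether or
  -- not it is measurable.
  have hbad₃ : Tendsto (fun T => P {ω | ¬((∀ u ∈ M.U T, ρhat T u ω ∈ M.Γ ∧
      IsMinOn (fun ρ => M.crit T u ρ ω) M.Γ (ρhat T u ω)) ∧
      (∀ u ∈ M.U T, ∀ θ ∈ M.Θ, ρsim T u θ ω ∈ M.Γ ∧
      IsMinOn (fun ρ => M.critSim T θ ρ ω) M.Γ (ρsim T u θ ω)) ∧
      ∀ u ∈ M.U T, θhat T u ω ∈ M.Θ ∧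
      IsMaxOn (fun θ => -LocalII.weightedSq W (ρhat T u ω - ρsim T u θ ω)) M.Θ
        (θhat T u ω))}) atTop (𝓝 0) := by
    refine tendsto_const_nhds.congr fun T => (ae_iff.1 ?_).symm
    filter_upwards [hest.aux T, hest.aux_sim T, hest.est T] with ω h1 h2 h3
    exact ⟨h1, h2, h3⟩
  refine LocalII.tendsto_measure_zero_of_subset (LocalII.tendsto_measure_union_zero
    (LocalII.tendsto_measure_union_zero hbad₁ hbad₂) hbad₃) ?_
  filter_upwards [hwsum] with T hwT ω hω
  by_contra hcon
  rw [mem_union, mem_union, not_or, not_or] at hcon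
  obtain ⟨⟨hc₁, hc₂⟩, hc₃⟩ := hcon
  simp only [mem_ofPred_eq, not_exists, not_and, not_le] at hc₁ hc₂
  obtain ⟨hρhat, hρsim, hθhat⟩ := not_not.1 hc₃
  have hsim : ∀ u ∈ M.U T, ∀ θ ∈ M.Θ, ‖ρsim T u θ ω - β θ‖ < ε := by
    intro u hu θ hθ
    obtain ⟨h1, h2⟩ := hρsim u hu θ hθ
    have hβΓ := (hmin θ hθ).1
    exact LocalII.norm_sub_lt_of_isMinOn (w := 1) (w₀ := 1) (e := η / 4)
      (m := fun ρ => M.critSim T θ ρ ω - M.critSim T θ ρref ω) le_rfl hη.le (by linarith)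
      (fun ρ hρ => by rw [one_mul]; exact (hc₁ θ hθ ρ hρ).le) hβΓ h1
      (sub_le_sub_right (h2 hβΓ) _) one_pos (hsep θ hθ)
  -- The local criterion is compared with its total weight times `meanOut` at θ₀(u), whose minimizer
  -- is β(θ₀(u)); only the lower bound w on the weight enters.
  have hobs : ∀ u ∈ M.U T, ‖ρhat T u ω - β (M.θ₀ u)‖ < ε := by
    intro u hu
    have huA := LocalII.Setup.U_subset_UAll T hu
    have hθ := hmodel.θ₀_mem u huA
    obtain ⟨h1, h2⟩ := hρhat u hu
    have hβΓ := (hmin _ hθ).1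
    rw [LocalII.Setup.UAll_eq_Ioo hmodel] at huA
    have := mul_pos hw hη
    exact LocalII.norm_sub_lt_of_isMinOn (e := w * η / 4)
      (m := fun ρ => M.crit T u ρ ω - M.crit T u ρref ω) (hwT u (Ioo_subset_Icc_self huA)) hη.le
      (by linarith) (fun ρ hρ => (hc₂ u hu ρ hρ).le) hβΓ h1 (sub_le_sub_right (h2 hβΓ) _) hw
      (hsep _ hθ)
  have hfinal : ∀ u ∈ M.U T, ‖θhat T u ω - M.θ₀ u‖ₑ ≤ κ' := by
    intro u hu
    have hθ := hmodel.θ₀_mem u (LocalII.Setup.U_subset_UAll T hu)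
    obtain ⟨h1, h2⟩ := hθhat u hu
    set x := ρhat T u ω - ρsim T u (θhat T u ω) ω with hx
    set x₀ := ρhat T u ω - ρsim T u (M.θ₀ u) ω with hx₀
    -- The competitor θ₀(u) attains a distance x₀ of norm at most 2ε, so the optimal distance x has
    -- norm at most c · 2ε.
    have h3 : LocalII.weightedSq W x ≤ LocalII.weightedSq W x₀ := neg_le_neg_iff.1 (h2 hθ)
    have h4 : ‖x‖ ^ 2 ≤ b / a * ‖x₀‖ ^ 2 := by
      rw [div_mul_eq_mul_div, le_div_iff₀ ha, mul_comm]
      exact ((hab x).1.trans h3).trans (hab x₀).2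
    have h5 : ‖x‖ ≤ c * ‖x₀‖ := by
      rw [hc, ← Real.sqrt_sq (norm_nonneg x), ← Real.sqrt_sq (norm_nonneg x₀),
        ← Real.sqrt_mul (by positivity)]
      exact Real.sqrt_le_sqrt h4
    have h6 := hobs u hu
    have h7 := hsim u hu _ hθ
    have h8 := hsim u hu _ h1
    have h9 : ‖x₀‖ ≤ 2 * ε := by
      have : x₀ = (ρhat T u ω - β (M.θ₀ u)) - (ρsim T u (M.θ₀ u) ω - β (M.θ₀ u)) := by
        rw [hx₀]; abel
      rw [this]
      exact (norm_sub_le _ _).trans (by linarith)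
    have h10 : ‖β (θhat T u ω) - β (M.θ₀ u)‖ < η₁ := by
      have : β (θhat T u ω) - β (M.θ₀ u) = (ρhat T u ω - β (M.θ₀ u)) -
          (ρsim T u (θhat T u ω) ω - β (θhat T u ω)) - x := by
        rw [hx]; abel
      rw [this]
      have h11 := norm_sub_le ((ρhat T u ω - β (M.θ₀ u)) -
        (ρsim T u (θhat T u ω) ω - β (θhat T u ω))) x
      have h12 := norm_sub_le (ρhat T u ω - β (M.θ₀ u))
        (ρsim T u (θhat T u ω) ω - β (θhat T u ω))
      have h13 := mul_le_mul_of_nonneg_left h9 hc0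
      have h14 : η₁ = 2 * ε + c * (2 * ε) := by rw [hε]; field_simp
      linarith
    have h15 := hinv _ h1 _ hθ h10
    rw [← ofReal_norm, ← ENNReal.ofReal_coe_nnreal]
    exact ENNReal.ofReal_le_ofReal h15.le
  exact not_le.2 hκ' (le_trans hω (iSup₂_le hfinal))
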